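/- Let $\mathfrak g$ be a finite-dimensional simple complex Lie algebra with a Cartan subalgebra $\mathfrak h$, a choice of simple roots, sets $\Delta_\pm$ of positive/negative roots, $\mathfrak n_\pm=\bigoplus_{\alpha\in\Delta_\pm}\mathfrak g_\alpha$, highest root $\theta$, and let $(\cdot\mid\cdot)$ be the multiple of the Killing form with $(\theta\mid\theta)=2$. Let $\mathfrak L(\mathfrak g)$ be the affine-Virasoro algebra, with underlying space $\bigoplus_{m\in\mathbb Z}\mathfrak g(m)\oplus\bigoplus_{m\in\mathbb Z}\mathbb C d_m\oplus\mathbb C\mathbf k\oplus\mathbb C\mathbf c$ (where $\mathfrak g(m)=\{x(m)\mid x\in\mathfrak g\}$ is a copy of $\mathfrak g$), $\mathbf k,\mathbf c$ central and $$[x(m),y(n)]=[x,y](m+n)+m(x\mid y)\delta_{m+n,0}\mathbf k,\quad [d_m,d_n]=(n-m)d_{m+n}+\delta_{m+n,0}\tfrac{m^3-m}{12}\mathbf c,\quad [d_n,x(m)]=m\,x(m+n).$$ Identify $x\in\mathfrak g$ with $x(0)$, and put $\mathcal V_-=\bigoplus_{m<0}\mathbb Cd_m$, $\mathfrak g\otimes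 t^{-1}\mathbb C[t^{-1}]=\bigoplus_{m<0}\mathfrak g(m)$ and $\mathfrak L(\mathfrak g)_-=\mathfrak n_-\oplus\bigoplus_{m<0}(\mathfrak g(m)\oplus\mathbb C d_m)$. Let $\lambda\in\mathfrak h^*$, $l,k,c\in\mathbb C$. Let $L(\lambda,l,k,c)$ be the irreducible highest weight $\mathfrak L(\mathfrak g)$-module, i.e. the quotient by its unique maximal proper submodule of the Verma module generated by a vector $u$ subject to $hu=\lambda(h)u$ $(h\in\mathfrak h)$, $d_0u=lu$, $\mathbf ku=ku$, $\mathbf cu=cu$, $\mathfrak g_\alpha u=0$ $(\alpha\in\Delta_+)$, $x(n)u=d_nu=0$ $(x\in\mathfrak g,\ n>0)$. Let $\bar u$ be the image of $u$ and $L(\lambda,l,k,c)_0=\{w\mid d_0w=lw\}$. Let $\mu\ne0$ be a dominant integral weight, $L(\mu)$ the finite-dimensional irreducible $\mathfrak g$-module of highest weight $\mu$, and $a,b\in\mathbb C$ with $0\le\operatorname{Re}a<1$. Let $L_{\lambda,l,k,c}^{\mu,a,b}=L(\lambda,l,k,c)\otimes L(\mu)\otimes\mathbb C[t^{\pm1}]$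 be the $\mathfrak L(\mathfrak g)$-module with $$d_m(w\otimes v\otimes t^n)=(d_m+a+n-j+bm)w\otimes v\otimes t^{m+n}\quad\text{if } d_0w=(l+j)w,$$ $$x(m)(w\otimes v\otimes t^n)=(x(m)w\otimes v+w\otimes xv)\otimes t^{m+n},$$ and with $\mathbf k$, $\mathbf c$ acting by the scalars $k$, $c$. For $n\in\mathbb Z$ let $\psi_n:U(\mathcal V_-)\to\mathbb C$ be the linear map with $$\psi_n(d_{-k_r}\cdots d_{-k_1})=\prod_{j=1}^r\Bigl(k_jb-a-n-\sum_{i=1}^jk_i\Bigr)\qquad(k_1,\dots,k_r\ge1).$$ Let $x\mapsto\tilde x$ be the algebra homomorphism $U(\mathfrak g\otimes t^{-1}\mathbb C[t^{-1}])\to U(\mathfrak g)$ with $x(-i)\mapsto x$ $(x\in\mathfrak g,\ i\ge1)$, and for $v\in L(\mu)$ put $1\circ v=v$, $(g_1g_2\cdots g_s)\circ v=(-1)^sg_s\cdots g_2g_1v$ $(g_i\in\mathfrak g)$, extended linearly to $U(\mathfrak g)$. Let $\varphi_n:U(\mathfrak L(\mathfrak g)_-)\otimes L(\mu)\to L(\lambda,l,k,c)_0\otimes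 L(\mu)$ be the linear map with $$\varphi_n(xyz\otimes v)=\psi_n(y)\,z\bar u\otimes(\tilde x\circ v)$$ for $x\in U(\mathfrak g\otimes t^{-1}\mathbb C[t^{-1}])$, $y\in U(\mathcal V_-)$, $z\in U(\mathfrak n_-)$, $v\in L(\mu)$. Let $\operatorname{Ann}(\bar u)=\{P\in U(\mathfrak L(\mathfrak g)_-)\mid P\bar u=0\}$. **Theorem.** $L_{\lambda,l,k,c}^{\mu,a,b}$ is irreducible if and only if $\varphi_n(\operatorname{Ann}(\bar u)\otimes L(\mu))=L(\lambda,l,k,c)_0\otimes L(\mu)$ for every $n\in\mathbb Z$. -/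

import Mathlib

open scoped TensorProduct

noncomputable section

namespace AffineVirasoro

attribute [local instance 100] LieRing.ofAssociativeRing

/-! ### The affine-Virasoro algebra -/

/-- The underlying vector space `(⊕ₘ g(m)) ⊕ (⊕ₘ ℂ dₘ) ⊕ ℂ 𝐤 ⊕ ℂ 𝐜` of the affine-Virasoro algebra
of `g`. An element is a triple `(f, s, t)`; it stands for
`∑ₘ (x(m) + r dₘ) + s 𝐤 + t 𝐜` where `(x, r) = f m ∈ g × ℂ`.
The scalar `ν` fixes the invariant form `(x | y) = ν κ(x, y)`, with `κ` the trace form of the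
adjoint representation, which enters the bracket. -/
def AffVir (g : Type*) [LieRing g] (_ν : ℂ) : Type _ := (ℤ →₀ g × ℂ) × ℂ × ℂ

section Algebra

variable {g : Type*} [LieRing g] [LieAlgebra ℂ g] {ν : ℂ}

instance : AddCommGroup (AffVir g ν) := inferInstanceAs (AddCommGroup ((ℤ →₀ g × ℂ) × ℂ × ℂ))
instance : Module ℂ (AffVir g ν) := inferInstanceAs (Module ℂ ((ℤ →₀ g × ℂ) × ℂ × ℂ))

/-- The inclusion of `⊕ₘ (g(m) ⊕ ℂ dₘ)`. -/
def ofLoop (ν : ℂ) : (ℤ →₀ g × ℂ) →ₗ[ℂ] AffVir g ν := LinearMap.inl ℂ (ℤ →₀ g × ℂ) (ℂ × ℂ)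

/-- The element `s 𝐤 + t 𝐜`, for `z = (s, t)`. -/
def cen (ν : ℂ) : ℂ × ℂ →ₗ[ℂ] AffVir g ν := LinearMap.inr ℂ (ℤ →₀ g × ℂ) (ℂ × ℂ)

/-- The component in `⊕ₘ (g(m) ⊕ ℂ dₘ)`. -/
def loopPart : AffVir g ν →ₗ[ℂ] (ℤ →₀ g × ℂ) := LinearMap.fst ℂ (ℤ →₀ g × ℂ) (ℂ × ℂ)

/-- The component in `ℂ 𝐤 ⊕ ℂ 𝐜`. -/
def cenPart : AffVir g ν →ₗ[ℂ] ℂ × ℂ := LinearMap.snd ℂ (ℤ →₀ g × ℂ) (ℂ × ℂ)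

/-- The element `x(m) + r dₘ`, for `p = (x, r)`. -/
def hom (ν : ℂ) (m : ℤ) : g × ℂ →ₗ[ℂ] AffVir g ν := ofLoop ν ∘ₗ Finsupp.lsingle m

@[simp] theorem loopPart_ofLoop (f : ℤ →₀ g × ℂ) : loopPart (ofLoop ν f) = f := rfl
@[simp] theorem cenPart_ofLoop (f : ℤ →₀ g × ℂ) : cenPart (ofLoop ν f) = 0 := rfl
@[simp] theorem loopPart_cen (z : ℂ × ℂ) : loopPart (cen ν z : AffVir g ν) = 0 := rfl
@[simp] theorem cenPart_cen (z : ℂ × ℂ) : cenPart (cen ν z : AffVir g ν) = z := rfl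
@[simp] theorem loopPart_hom (m : ℤ) (p : g × ℂ) :
    loopPart (hom ν m p) = Finsupp.single m p := rfl
@[simp] theorem cenPart_hom (m : ℤ) (p : g × ℂ) : cenPart (hom ν m p) = 0 := rfl

theorem ofLoop_add_cen (X : AffVir g ν) : ofLoop ν (loopPart X) + cen ν (cenPart X) = X :=
  Prod.ext (add_zero _) (zero_add _)

/-- The current `x(m) = x ⊗ t ^ m`. -/
def cur (ν : ℂ) (x : g) (m : ℤ) : AffVir g ν := hom ν m (x, 0)

variable (g ν) in
/-- The Virasoro element `dₘ`. -/
def vir (m : ℤ) : AffVir g ν := hom ν m (0, 1)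

variable (g ν) in
/-- The central element `𝐤`. -/
def kk : AffVir g ν := cen ν (1, 0)

variable (g ν) in
/-- The central element `𝐜`. -/
def cc : AffVir g ν := cen ν (0, 1)

/-- The bracket `[x(m) + r dₘ, y(n) + s dₙ]`, for `p = (x, r)` and `q = (y, s)`. -/
def homBracket (ν : ℂ) (m n : ℤ) : g × ℂ →ₗ[ℂ] g × ℂ →ₗ[ℂ] AffVir g ν :=
  LinearMap.mk₂ ℂ
    (fun p q =>
      hom ν (m + n)
        (⁅p.1, q.1⁆ + ((n : ℂ) * p.2) • q.1 - ((m : ℂ) * q.2) • p.1,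
          ((n : ℂ) - m) * (p.2 * q.2)) +
      cen ν
        (if m + n = 0 then (m : ℂ) * (ν * killingForm ℂ g p.1 q.1) else 0,
          if m + n = 0 then ((m : ℂ) ^ 3 - m) / 12 * (p.2 * q.2) else 0))
    (by
      intro p p' q
      rw [add_add_add_comm, ← map_add, ← map_add]
      congr 2
      · ext <;> simp [add_smul, mul_add, add_mul] <;> abel
      · ext <;> simp only [Prod.fst_add, Prod.snd_add, map_add, LinearMap.add_apply] <;>
          split_ifs <;> ring)
    (by
      intro t p q
      rw [smul_add, ← map_smul, ← map_smul]
      congr 2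
      · ext
        · simp only [Prod.smul_fst, Prod.smul_snd, smul_lie, smul_eq_mul]; module
        · simp only [Prod.smul_snd, smul_eq_mul]; ring
      · ext <;> simp only [Prod.smul_fst, Prod.smul_snd, map_smul, LinearMap.smul_apply,
          smul_eq_mul] <;> split_ifs <;> ring)
    (by
      intro p q q'
      rw [add_add_add_comm, ← map_add, ← map_add]
      congr 2
      · ext <;> simp [add_smul, mul_add] <;> abel
      · ext <;> simp only [Prod.fst_add, Prod.snd_add, map_add] <;>
          split_ifs <;> ring)
    (by
      intro t p q
      rw [smul_add, ← map_smul, ← map_smul]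
      congr 2
      · ext
        · simp only [Prod.smul_fst, Prod.smul_snd, lie_smul, smul_eq_mul]; module
        · simp only [Prod.smul_snd, smul_eq_mul]; ring
      · ext <;> simp only [Prod.smul_fst, Prod.smul_snd, map_smul, smul_eq_mul] <;>
          split_ifs <;> ring)

/-- The bracket on `⊕ₘ (g(m) ⊕ ℂ dₘ)`, with values in the central extension. -/
def loopBracket (ν : ℂ) :
    (ℤ →₀ g × ℂ) →ₗ[ℂ] (ℤ →₀ g × ℂ) →ₗ[ℂ] AffVir g ν :=
  Finsupp.lsum ℂ fun m => (Finsupp.lsum ℂ fun n => (homBracket ν m n).flip).flip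

instance : Bracket (AffVir g ν) (AffVir g ν) := ⟨fun X Y => loopBracket ν (loopPart X) (loopPart Y)⟩

theorem bracket_def (X Y : AffVir g ν) : ⁅X, Y⁆ = loopBracket ν (loopPart X) (loopPart Y) := rfl

theorem loopBracket_single (m n : ℤ) (p q : g × ℂ) :
    loopBracket ν (Finsupp.single m p) (Finsupp.single n q) = homBracket ν m n p q := by
  simp [loopBracket]

theorem homBracket_apply (m n : ℤ) (p q : g × ℂ) :
    homBracket ν m n p q =
      hom ν (m + n)
        (⁅p.1, q.1⁆ + ((n : ℂ) * p.2) • q.1 - ((m : ℂ) * q.2) • p.1,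
          ((n : ℂ) - m) * (p.2 * q.2)) +
      cen ν
        (if m + n = 0 then (m : ℂ) * (ν * killingForm ℂ g p.1 q.1) else 0,
          if m + n = 0 then ((m : ℂ) ^ 3 - m) / 12 * (p.2 * q.2) else 0) := rfl

theorem hom_bracket (m n : ℤ) (p q : g × ℂ) : ⁅hom ν m p, hom ν n q⁆ = homBracket ν m n p q :=
  loopBracket_single m n p q

/-- Induction on elements of the affine-Virasoro algebra. -/
theorem induction {P : AffVir g ν → Prop} (X : AffVir g ν)
    (add : ∀ X Y, P X → P Y → P (X + Y)) (hom : ∀ m p, P (hom ν m p)) (cen : ∀ z, P (cen ν z)) :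
    P X := by
  have key (f : ℤ →₀ g × ℂ) : P (ofLoop ν f) := by
    induction f using Finsupp.induction_linear with
    | zero =>
      have := cen 0
      rwa [map_zero] at this ⊢
    | add f f' hf hf' => rw [map_add]; exact add _ _ hf hf'
    | single m p => exact hom m p
  rw [← ofLoop_add_cen X]
  exact add _ _ (key _) (cen _)

theorem cen_bracket (z : ℂ × ℂ) (X : AffVir g ν) : ⁅(cen ν z : AffVir g ν), X⁆ = 0 := by
  rw [bracket_def, loopPart_cen, map_zero, LinearMap.zero_apply]

theorem bracket_cen (z : ℂ × ℂ) (X : AffVir g ν) : ⁅X, (cen ν z : AffVir g ν)⁆ = 0 := by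
  rw [bracket_def, loopPart_cen, map_zero]

theorem add_br (X Y Z : AffVir g ν) : ⁅X + Y, Z⁆ = ⁅X, Z⁆ + ⁅Y, Z⁆ := by
  simp only [bracket_def, map_add, LinearMap.add_apply]

theorem br_add (X Y Z : AffVir g ν) : ⁅X, Y + Z⁆ = ⁅X, Y⁆ + ⁅X, Z⁆ := by
  simp only [bracket_def, map_add]

theorem br_skew (X Y : AffVir g ν) : ⁅X, Y⁆ = -⁅Y, X⁆ := by
  induction X using induction with
  | add X X' h h' => rw [add_br, br_add, h, h', neg_add]
  | cen z => rw [cen_bracket, bracket_cen, neg_zero]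
  | hom m p =>
  induction Y using induction with
  | add X X' h h' => rw [add_br, br_add, h, h', neg_add]
  | cen z => rw [cen_bracket, bracket_cen, neg_zero]
  | hom n q =>
  rw [hom_bracket, hom_bracket, homBracket_apply, homBracket_apply, add_comm n m, neg_add,
    ← map_neg, ← map_neg]
  congr 2
  · ext
    · simp only [Prod.fst_neg]; rw [← lie_skew q.1 p.1]; module
    · simp only [Prod.snd_neg]; ring
  · ext <;> simp only [Prod.fst_neg, Prod.snd_neg] <;> split_ifs with h
    · have : (n : ℂ) = -m := by rw [eq_neg_iff_add_eq_zero, add_comm]; exact_mod_cast h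
      rw [show killingForm ℂ g q.1 p.1 = killingForm ℂ g p.1 q.1 from
        LieModule.traceForm_comm ℂ g g _ _, this]; ring
    · simp
    · have : (n : ℂ) = -m := by rw [eq_neg_iff_add_eq_zero, add_comm]; exact_mod_cast h
      rw [this]; ring
    · simp

theorem br_leibniz (X Y Z : AffVir g ν) : ⁅X, ⁅Y, Z⁆⁆ = ⁅⁅X, Y⁆, Z⁆ + ⁅Y, ⁅X, Z⁆⁆ := by
  have zb (X : AffVir g ν) : ⁅(0 : AffVir g ν), X⁆ = 0 := by simpa using cen_bracket 0 X
  have bz (X : AffVir g ν) : ⁅X, (0 : AffVir g ν)⁆ = 0 := by simpa using bracket_cen 0 X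
  induction X using induction with
  | add X X' h h' => simp only [add_br, br_add, h, h']; abel
  | cen z => simp only [cen_bracket, zb, bz, add_zero]
  | hom m p =>
  induction Y using induction with
  | add X X' h h' => simp only [add_br, br_add, h, h']; abel
  | cen z => simp only [cen_bracket, bracket_cen, zb, bz, add_zero]
  | hom n q =>
  induction Z using induction with
  | add X X' h h' => simp only [br_add, h, h']; abel
  | cen z => simp only [bracket_cen, bz, add_zero]
  | hom k r =>
  obtain ⟨x, a⟩ := p
  obtain ⟨y, b⟩ := q
  obtain ⟨z, c⟩ := r
  simp only [hom_bracket, homBracket_apply, br_add, add_br, cen_bracket, bracket_cen, add_zero]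
  rw [show n + (m + k) = m + (n + k) by ring, show m + n + k = m + (n + k) by ring,
    add_add_add_comm, ← map_add, ← map_add]
  congr 2
  · ext
    · simp only [Prod.fst_add, lie_add, lie_sub, lie_smul, add_lie, sub_lie, smul_lie]
      rw [leibniz_lie x y z, ← lie_skew y x]
      push_cast
      module
    · simp only [Prod.snd_add]
      push_cast
      ring
  · by_cases h : m + (n + k) = 0
    · have hk : (k : ℂ) = -m - n := by
        have : (m : ℂ) + (n + k) = 0 := by exact_mod_cast h
        linear_combination this
      have i1 : killingForm ℂ g ⁅x, y⁆ z = killingForm ℂ g x ⁅y, z⁆ :=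
        LieModule.traceForm_apply_lie_apply ℂ g g x y z
      have i2 : killingForm ℂ g y ⁅x, z⁆ = - killingForm ℂ g x ⁅y, z⁆ := by
        rw [← i1, ← lie_skew x y, map_neg, LinearMap.neg_apply, neg_neg]
        exact (LieModule.traceForm_apply_lie_apply ℂ g g y x z).symm
      have s1 : killingForm ℂ g y x = killingForm ℂ g x y := LieModule.traceForm_comm ℂ g g _ _
      simp only [h, if_true]
      ext
      · simp only [map_add, map_sub, map_smul, LinearMap.add_apply, LinearMap.sub_apply,
          LinearMap.smul_apply, smul_eq_mul, i1, i2, s1, Prod.fst_add]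
        push_cast
        rw [hk]
        ring
      · simp only [Prod.snd_add]
        push_cast
        rw [hk]
        ring
    · simp [h]

instance : LieRing (AffVir g ν) where
  add_lie := add_br
  lie_add := br_add
  lie_self X := by
    have h : (2 : ℂ) • ⁅X, X⁆ = 0 := by rw [two_smul]; nth_rw 2 [br_skew]; exact add_neg_cancel _
    exact (smul_eq_zero.mp h).resolve_left two_ne_zero
  leibniz_lie := br_leibniz

instance : LieAlgebra ℂ (AffVir g ν) where
  lie_smul t X Y := by
    simp only [bracket_def, map_smul]

theorem cur_lie_cur (x y : g) (m n : ℤ) :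
    ⁅cur ν x m, cur ν y n⁆ = cur ν ⁅x, y⁆ (m + n) +
      ((m : ℂ) * (ν * killingForm ℂ g x y) * (if m + n = 0 then 1 else 0)) • kk g ν := by
  rw [cur, cur, hom_bracket, homBracket_apply, cur, kk, ← map_smul]
  congr 2 <;> ext <;> by_cases h : m + n = 0 <;> simp [h]

theorem vir_lie_vir (m n : ℤ) :
    ⁅vir g ν m, vir g ν n⁆ = ((n : ℂ) - m) • vir g ν (m + n) +
      ((if m + n = 0 then 1 else 0) * (((m : ℂ) ^ 3 - m) / 12)) • cc g ν := by
  rw [vir, vir, hom_bracket, homBracket_apply, vir, cc, ← map_smul, ← map_smul]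
  congr 2 <;> ext <;> by_cases h : m + n = 0 <;> simp [h]

theorem vir_lie_cur (x : g) (m n : ℤ) :
    ⁅vir g ν n, cur ν x m⁆ = (m : ℂ) • cur ν x (m + n) := by
  rw [vir, cur, hom_bracket, homBracket_apply, cur, add_comm n m, ← map_smul]
  rw [← add_zero (hom ν (m + n) ((m : ℂ) • (x, 0)))]
  congr 1
  · congr 1; ext <;> simp
  · rw [← map_zero (cen ν)]; congr 1; ext <;> simp

theorem kk_lie (X : AffVir g ν) : ⁅kk g ν, X⁆ = 0 := cen_bracket _ X

theorem cc_lie (X : AffVir g ν) : ⁅cc g ν, X⁆ = 0 := cen_bracket _ X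

end Algebra

/-! ### Actions on spaces graded by `ℤ` -/

section Graded

variable {g : Type*} [LieRing g] [LieAlgebra ℂ g] {ν : ℂ}
variable {W : Type*} [AddCommGroup W] [Module ℂ W]

/-- The linear map sending `x(m) + r dₘ` to the operator `w t ^ n ↦ (op m n (x, r) w) t ^ (m + n)`
on `⊕ₙ W t ^ n`, and `𝐤`, `𝐜` to zero. -/
def gradedAct (ν : ℂ) (op : ℤ → ℤ → g × ℂ →ₗ[ℂ] Module.End ℂ W) :
    AffVir g ν →ₗ[ℂ] Module.End ℂ (ℤ →₀ W) :=
  (Finsupp.lsum ℂ fun m =>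
    { toFun := fun p => Finsupp.lsum ℂ fun n => Finsupp.lsingle (m + n) ∘ₗ op m n p
      map_add' := fun p q => by ext; simp
      map_smul' := fun t p => by ext; simp }) ∘ₗ loopPart

@[simp] theorem gradedAct_hom (op : ℤ → ℤ → g × ℂ →ₗ[ℂ] Module.End ℂ W) (m n : ℤ) (p : g × ℂ)
    (w : W) :
    gradedAct ν op (hom ν m p) (Finsupp.single n w) = Finsupp.single (m + n) (op m n p w) := by
  simp [gradedAct]

@[simp] theorem gradedAct_cen (op : ℤ → ℤ → g × ℂ →ₗ[ℂ] Module.End ℂ W) (z : ℂ × ℂ) :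
    gradedAct ν op (cen ν z) = 0 := by
  simp [gradedAct]

end Graded

/-! ### The tensor product with a loop module, after the shift -/

section Shifted

variable {g : Type*} [LieRing g] [LieAlgebra ℂ g] {ν : ℂ}
variable (M : Type*) [AddCommGroup M] [Module ℂ M] [LieRingModule (AffVir g ν) M]
  [LieModule ℂ (AffVir g ν) M]
variable (V : Type*) [AddCommGroup V] [Module ℂ V] [LieRingModule g V] [LieModule ℂ g V]

/-- The space `⊕ₙ M ⊗ V ⊗ t ^ n`; `Finsupp.single n (w ⊗ v)` stands for `w ⊗ v ⊗ t ^ n`. It is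
given below an action of the affine-Virasoro algebra that depends on `l`, `a`, `b`. -/
def Shifted (_l _a _b : ℂ) : Type _ := ℤ →₀ M ⊗[ℂ] V

variable (l a b : ℂ)

instance : AddCommGroup (Shifted M V l a b) := inferInstanceAs (AddCommGroup (ℤ →₀ M ⊗[ℂ] V))
instance : Module ℂ (Shifted M V l a b) := inferInstanceAs (Module ℂ (ℤ →₀ M ⊗[ℂ] V))

/-- The element `w ⊗ v ⊗ t ^ n`, for `y = w ⊗ v`. -/
def Shifted.tpow (n : ℤ) : M ⊗[ℂ] V →ₗ[ℂ] Shifted M V l a b := Finsupp.lsingle n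

/-- The coefficient of `t ^ (m + n)` in the action of `x(m) + r dₘ` on `w ⊗ v ⊗ t ^ n`, namely
`x(m) w ⊗ v + w ⊗ x v + r (dₘ - d₀ + l + a + n + b m) w ⊗ v`. On a vector `w` with
`d₀ w = (l + deg) w` the last term is `r (dₘ + a + n - deg + b m) w ⊗ v`. -/
def shiftOp (ν : ℂ) (M : Type*) [AddCommGroup M] [Module ℂ M] [LieRingModule (AffVir g ν) M]
    [LieModule ℂ (AffVir g ν) M]
    (V : Type*) [AddCommGroup V] [Module ℂ V] [LieRingModule g V] [LieModule ℂ g V]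
    (l a b : ℂ) (m n : ℤ) : g × ℂ →ₗ[ℂ] Module.End ℂ (M ⊗[ℂ] V) where
  toFun p :=
    (LieModule.toEnd ℂ (AffVir g ν) M (hom ν m p - p.2 • vir g ν 0) +
      (p.2 * (l + a + n + b * m)) • LinearMap.id).rTensor V +
    (LieModule.toEnd ℂ g V p.1).lTensor M
  map_add' p q := by
    ext w v
    simp only [map_add, map_sub, map_smul, Prod.fst_add, Prod.snd_add,
      TensorProduct.AlgebraTensorModule.curry_apply, LinearMap.restrictScalars_self,
      TensorProduct.curry_apply, LinearMap.add_apply, LinearMap.sub_apply, LinearMap.smul_apply,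
      LinearMap.rTensor_tmul, LinearMap.lTensor_tmul, LinearMap.id_apply,
      TensorProduct.add_tmul, TensorProduct.sub_tmul, TensorProduct.tmul_add,
      ← TensorProduct.smul_tmul']
    module
  map_smul' t p := by
    ext w v
    simp only [map_sub, map_smul, Prod.smul_fst, Prod.smul_snd, smul_eq_mul,
      TensorProduct.AlgebraTensorModule.curry_apply, LinearMap.restrictScalars_self,
      TensorProduct.curry_apply, LinearMap.add_apply, LinearMap.sub_apply, LinearMap.smul_apply,
      LinearMap.rTensor_tmul, LinearMap.lTensor_tmul, LinearMap.id_apply, RingHom.id_apply,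
      TensorProduct.add_tmul, TensorProduct.sub_tmul, TensorProduct.tmul_smul,
      ← TensorProduct.smul_tmul']
    module

theorem shiftOp_tmul (m n : ℤ) (p : g × ℂ) (w : M) (v : V) :
    shiftOp ν M V l a b m n p (w ⊗ₜ v) =
      ⁅hom ν m p, w⁆ ⊗ₜ v - p.2 • (⁅vir g ν 0, w⁆ ⊗ₜ v)
        + (p.2 * (l + a + n + b * m)) • (w ⊗ₜ v) + w ⊗ₜ ⁅p.1, v⁆ := by
  simp only [shiftOp, LinearMap.coe_mk, AddHom.coe_mk, map_sub, map_smul,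
      LinearMap.add_apply, LinearMap.sub_apply, LinearMap.smul_apply,
      LinearMap.rTensor_tmul, LinearMap.lTensor_tmul, LinearMap.id_apply,
      TensorProduct.add_tmul, TensorProduct.sub_tmul,
      ← TensorProduct.smul_tmul', LieModule.toEnd_apply_apply]

/-- The action of the affine-Virasoro algebra on `⊕ₙ M ⊗ V ⊗ t ^ n`. The central elements act
through `M`. -/
def shiftAct : AffVir g ν →ₗ[ℂ] Module.End ℂ (ℤ →₀ M ⊗[ℂ] V) :=
  gradedAct ν (shiftOp ν M V l a b) +
    { toFun := fun X => Finsupp.mapRange.linearMap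
        ((LieModule.toEnd ℂ (AffVir g ν) M (cen ν (cenPart X))).rTensor V)
      map_add' := fun X Y => by
        ext; simp
      map_smul' := fun t X => by
        ext; simp }

@[simp] theorem shiftAct_hom (m n : ℤ) (p : g × ℂ) (y : M ⊗[ℂ] V) :
    shiftAct M V l a b (hom ν m p) (Finsupp.single n y) =
      Finsupp.single (m + n) (shiftOp ν M V l a b m n p y) := by
  simp [shiftAct]

@[simp] theorem shiftAct_cen (n : ℤ) (z : ℂ × ℂ) (w : M) (v : V) :
    shiftAct M V l a b (cen ν z : AffVir g ν) (Finsupp.single n (w ⊗ₜ v)) =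
      Finsupp.single n (⁅(cen ν z : AffVir g ν), w⁆ ⊗ₜ v) := by
  simp [shiftAct]

theorem shiftAct_lie (X Y : AffVir g ν) (w : ℤ →₀ M ⊗[ℂ] V) :
    shiftAct M V l a b X (shiftAct M V l a b Y w) =
      shiftAct M V l a b ⁅X, Y⁆ w + shiftAct M V l a b Y (shiftAct M V l a b X w) := by
  induction w using Finsupp.induction_linear with
  | zero => simp
  | add w w' h h' => simp only [map_add, h, h']; abel
  | single n y =>
  induction y using TensorProduct.induction_on with
  | zero => simp
  | add y y' h h' => simp only [map_add, h, h', Finsupp.single_add]; abel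
  | tmul w v =>
  induction X using induction with
  | add X X' h h' => simp only [map_add, LinearMap.add_apply, add_lie, h, h']; abel
  | cen z =>
    rw [cen_bracket, map_zero, LinearMap.zero_apply, zero_add, shiftAct_cen]
    induction Y using induction with
    | add X X' h h' => simp only [map_add, LinearMap.add_apply, h, h']
    | cen z' =>
      rw [shiftAct_cen, shiftAct_cen, shiftAct_cen, leibniz_lie, cen_bracket, zero_lie, zero_add]
    | hom m p =>
      have key (X : AffVir g ν) :
          ⁅X, ⁅(cen ν z : AffVir g ν), w⁆⁆ = ⁅(cen ν z : AffVir g ν), ⁅X, w⁆⁆ := by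
        rw [leibniz_lie, bracket_cen, zero_lie, zero_add]
      rw [shiftAct_hom, shiftAct_hom, shiftOp_tmul, shiftOp_tmul, key, key]
      simp only [Finsupp.single_add, Finsupp.single_sub, map_add, map_sub, shiftAct_cen,
        ← Finsupp.smul_single, map_smul]
  | hom m p =>
  induction Y using induction with
  | add X X' h h' => simp only [map_add, LinearMap.add_apply, lie_add, h, h']; abel
  | cen z =>
    have key (X : AffVir g ν) :
        ⁅X, ⁅(cen ν z : AffVir g ν), w⁆⁆ = ⁅(cen ν z : AffVir g ν), ⁅X, w⁆⁆ := by
      rw [leibniz_lie, bracket_cen, zero_lie, zero_add]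
    rw [bracket_cen, map_zero, LinearMap.zero_apply, zero_add, shiftAct_cen]
    rw [shiftAct_hom, shiftAct_hom, shiftOp_tmul, shiftOp_tmul, key, key]
    simp only [Finsupp.single_add, Finsupp.single_sub, map_add, map_sub, shiftAct_cen,
      ← Finsupp.smul_single, map_smul]
  | hom k q =>
  obtain ⟨x, r⟩ := p
  obtain ⟨y, s⟩ := q
  have hD (j : ℤ) (p : g × ℂ) : ⁅hom ν j p, vir g ν 0⁆ = (-(j : ℂ)) • hom ν j p := by
    rw [vir, hom_bracket, homBracket_apply, add_zero, ← map_smul]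
    rw [← add_zero (hom ν j (_ • p))]
    congr 1
    · congr 1; ext <;> simp
    · rw [← map_zero (cen ν)]; congr 1
      by_cases hj : j = 0 <;> ext <;> simp [hj]
  rw [shiftAct_hom, shiftAct_hom, shiftAct_hom, shiftAct_hom, hom_bracket]
  have hAB := hom_bracket (ν := ν) m k (x, r) (y, s)
  rw [homBracket_apply] at hAB ⊢
  rw [map_add, LinearMap.add_apply, shiftAct_hom, shiftAct_cen]
  dsimp only at hAB ⊢
  set z : ℂ × ℂ := (if m + k = 0 then (m : ℂ) * (ν * killingForm ℂ g x y) else 0,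
          if m + k = 0 then ((m : ℂ) ^ 3 - m) / 12 * (r * s) else 0) with hz
  have hC : (Finsupp.single n (⁅(cen ν z : AffVir g ν), w⁆ ⊗ₜ v) : ℤ →₀ M ⊗[ℂ] V) =
      Finsupp.single (m + k + n) (⁅(cen ν z : AffVir g ν), w⁆ ⊗ₜ v) := by
    by_cases h : m + k = 0
    · rw [h, zero_add]
    · have : z = 0 := by rw [hz]; simp [h]
      simp [this]
  rw [hC, show m + (k + n) = m + k + n by ring, show k + (m + n) = m + k + n by ring,
    ← Finsupp.single_add, ← Finsupp.single_add]
  congr 1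
  simp only [shiftOp_tmul, map_add, map_sub, map_smul]
  have e1 : ⁅hom ν m (x, r), ⁅hom ν k (y, s), w⁆⁆ =
      ⁅⁅hom ν m (x, r), hom ν k (y, s)⁆, w⁆ + ⁅hom ν k (y, s), ⁅hom ν m (x, r), w⁆⁆ :=
    leibniz_lie _ _ _
  have e2 (j : ℤ) (p : g × ℂ) : ⁅hom ν j p, ⁅vir g ν 0, w⁆⁆ =
      (-(j : ℂ)) • ⁅hom ν j p, w⁆ + ⁅vir g ν 0, ⁅hom ν j p, w⁆⁆ := by
    rw [leibniz_lie, hD, smul_lie]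
  have e3 : ⁅x, ⁅y, v⁆⁆ = ⁅⁅x, y⁆, v⁆ + ⁅y, ⁅x, v⁆⁆ := leibniz_lie _ _ _
  have e4 : ⁅hom ν (m + k) (⁅x, y⁆ + ((k : ℂ) * r) • y - ((m : ℂ) * s) • x,
      ((k : ℂ) - m) * (r * s)), w⁆ =
      ⁅⁅hom ν m (x, r), hom ν k (y, s)⁆, w⁆ - ⁅(cen ν z : AffVir g ν), w⁆ := by
    rw [eq_sub_iff_add_eq.mpr hAB.symm, sub_lie]
  rw [e1, e2, e2, e3, e4]
  simp only [TensorProduct.add_tmul, TensorProduct.tmul_add, TensorProduct.sub_tmul,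
    TensorProduct.tmul_sub, TensorProduct.tmul_smul, ← TensorProduct.smul_tmul', add_lie, sub_lie,
    smul_lie]
  push_cast
  module

instance : LieRingModule (AffVir g ν) (Shifted M V l a b) where
  bracket X w := shiftAct M V l a b X w
  add_lie X Y w := by
    change shiftAct M V l a b (X + Y) w = _
    rw [map_add]; rfl
  lie_add X w w' := map_add (shiftAct M V l a b X) w w'
  leibniz_lie X Y w := shiftAct_lie M V l a b X Y w

instance : LieModule ℂ (AffVir g ν) (Shifted M V l a b) where
  smul_lie t X w := by
    change shiftAct M V l a b (t • X) w = _
    rw [map_smul]; rfl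
  lie_smul t X w := map_smul (shiftAct M V l a b X) t w

theorem cur_lie_at (x : g) (m n : ℤ) (w : M) (v : V) :
    ⁅cur ν x m, Shifted.tpow M V l a b n (w ⊗ₜ v)⁆ =
      Shifted.tpow M V l a b (m + n) (⁅cur ν x m, w⁆ ⊗ₜ v + w ⊗ₜ ⁅x, v⁆) := by
  change shiftAct M V l a b (hom ν m (x, 0)) (Finsupp.single n _) = _
  rw [shiftAct_hom, shiftOp_tmul]
  change Finsupp.single _ _ = Finsupp.single _ _
  congr 1
  simp [cur]

theorem vir_lie_at (m n : ℤ) (w : M) (v : V) (deg : ℂ) (hw : ⁅vir g ν 0, w⁆ = (l + deg) • w) :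
    ⁅vir g ν m, Shifted.tpow M V l a b n (w ⊗ₜ v)⁆ =
      Shifted.tpow M V l a b (m + n) ((⁅vir g ν m, w⁆ + (a + n - deg + b * m) • w) ⊗ₜ v) := by
  change shiftAct M V l a b (hom ν m (0, 1)) (Finsupp.single n _) = _
  rw [shiftAct_hom, shiftOp_tmul, hw]
  change Finsupp.single _ _ = Finsupp.single _ _
  congr 1
  simp only [vir, zero_lie, TensorProduct.tmul_zero, TensorProduct.add_tmul,
    ← TensorProduct.smul_tmul']
  module

theorem cen_lie_at (z : ℂ × ℂ) (n : ℤ) (w : M) (v : V) :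
    ⁅(cen ν z : AffVir g ν), Shifted.tpow M V l a b n (w ⊗ₜ v)⁆ =
      Shifted.tpow M V l a b n (⁅(cen ν z : AffVir g ν), w⁆ ⊗ₜ v) :=
  shiftAct_cen M V l a b n z w v

end Shifted

/-! ### Subalgebras and enveloping algebras -/

section Span

variable {L : Type*} [LieRing L] [LieAlgebra ℂ L]

/-- The linear span of a set whose pairwise brackets lie in the span, as a Lie subalgebra. -/
def spanSubalgebra (S : Set L)
    (hS : ∀ x ∈ S, ∀ y ∈ S, ⁅x, y⁆ ∈ Submodule.span ℂ S) : LieSubalgebra ℂ L where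
  __ := Submodule.span ℂ S
  lie_mem' := by
    intro x y hx hy
    change ⁅x, y⁆ ∈ Submodule.span ℂ S
    change x ∈ Submodule.span ℂ S at hx
    change y ∈ Submodule.span ℂ S at hy
    induction hx using Submodule.span_induction with
    | zero => rw [zero_lie]; exact zero_mem _
    | add x x' _ _ h h' => rw [add_lie]; exact add_mem h h'
    | smul t x _ h => rw [smul_lie]; exact Submodule.smul_mem _ _ h
    | mem x hx =>
      induction hy using Submodule.span_induction with
      | zero => rw [lie_zero]; exact zero_mem _
      | add x x' _ _ h h' => rw [lie_add]; exact add_mem h h'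
      | smul t x _ h => rw [lie_smul]; exact Submodule.smul_mem _ _ h
      | mem y hy => exact hS x hx y hy

theorem mem_spanSubalgebra {S : Set L} {hS : ∀ x ∈ S, ∀ y ∈ S, ⁅x, y⁆ ∈ Submodule.span ℂ S}
    {x : L} : x ∈ spanSubalgebra S hS ↔ x ∈ Submodule.span ℂ S := Iff.rfl

theorem subset_spanSubalgebra {S : Set L}
    {hS : ∀ x ∈ S, ∀ y ∈ S, ⁅x, y⁆ ∈ Submodule.span ℂ S} {x : L} (hx : x ∈ S) :
    x ∈ spanSubalgebra S hS := Submodule.subset_span hx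

/-- A linear map that respects brackets of elements of `S` restricts to a homomorphism of Lie
algebras on the subalgebra spanned by `S`. -/
def spanHom {L' : Type*} [LieRing L'] [LieAlgebra ℂ L'] (S : Set L)
    (hS : ∀ x ∈ S, ∀ y ∈ S, ⁅x, y⁆ ∈ Submodule.span ℂ S) (T : L →ₗ[ℂ] L')
    (hT : ∀ x ∈ S, ∀ y ∈ S, T ⁅x, y⁆ = ⁅T x, T y⁆) : spanSubalgebra S hS →ₗ⁅ℂ⁆ L' where
  __ := T ∘ₗ (spanSubalgebra S hS).toSubmodule.subtype
  map_lie' := by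
    rintro ⟨x, hx⟩ ⟨y, hy⟩
    change T ⁅x, y⁆ = ⁅T x, T y⁆
    rw [mem_spanSubalgebra] at hx hy
    induction hx using Submodule.span_induction with
    | zero => simp only [zero_lie, map_zero]
    | add x x' _ _ h h' => simp only [add_lie, map_add, h, h']
    | smul t x _ h => simp only [smul_lie, map_smul, h]
    | mem x hx =>
      induction hy using Submodule.span_induction with
      | zero => simp only [lie_zero, map_zero]
      | add x x' _ _ h h' => simp only [lie_add, map_add, h, h']
      | smul t x _ h => simp only [lie_smul, map_smul, h]
      | mem y hy => exact hT x hx y hy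

@[simp] theorem spanHom_apply {L' : Type*} [LieRing L'] [LieAlgebra ℂ L'] (S : Set L)
    (hS : ∀ x ∈ S, ∀ y ∈ S, ⁅x, y⁆ ∈ Submodule.span ℂ S) (T : L →ₗ[ℂ] L')
    (hT : ∀ x ∈ S, ∀ y ∈ S, T ⁅x, y⁆ = ⁅T x, T y⁆) (x : spanSubalgebra S hS) :
    spanHom S hS T hT x = T x := rfl

/-- The homomorphism of enveloping algebras induced by a homomorphism of Lie algebras. -/
def mapU {L' : Type*} [LieRing L'] [LieAlgebra ℂ L'] (f : L →ₗ⁅ℂ⁆ L') :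
    UniversalEnvelopingAlgebra ℂ L →ₐ[ℂ] UniversalEnvelopingAlgebra ℂ L' :=
  UniversalEnvelopingAlgebra.lift ℂ ((UniversalEnvelopingAlgebra.ι ℂ).comp f)

@[simp] theorem mapU_ι {L' : Type*} [LieRing L'] [LieAlgebra ℂ L'] (f : L →ₗ⁅ℂ⁆ L') (x : L) :
    mapU f (UniversalEnvelopingAlgebra.ι ℂ x) = UniversalEnvelopingAlgebra.ι ℂ (f x) :=
  UniversalEnvelopingAlgebra.lift_ι_apply ℂ _ x

/-- The action of the enveloping algebra on a Lie module. -/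
def actU (L M : Type*) [LieRing L] [LieAlgebra ℂ L] [AddCommGroup M] [Module ℂ M]
    [LieRingModule L M] [LieModule ℂ L M] :
    UniversalEnvelopingAlgebra ℂ L →ₐ[ℂ] Module.End ℂ M :=
  UniversalEnvelopingAlgebra.lift ℂ (LieModule.toEnd ℂ L M)

@[simp] theorem actU_ι {M : Type*} [AddCommGroup M] [Module ℂ M]
    [LieRingModule L M] [LieModule ℂ L M] (x : L) (w : M) :
    actU L M (UniversalEnvelopingAlgebra.ι ℂ x) w = ⁅x, w⁆ := by
  rw [actU, UniversalEnvelopingAlgebra.lift_ι_apply]; rfl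

/-- Induction on elements of an enveloping algebra, by left multiplication with elements of the Lie
algebra. -/
theorem induction_mul {P : UniversalEnvelopingAlgebra ℂ L → Prop}
    (X : UniversalEnvelopingAlgebra ℂ L) (add : ∀ X Y, P X → P Y → P (X + Y))
    (smul : ∀ (t : ℂ) X, P X → P (t • X)) (one : P 1)
    (mul : ∀ (x : L) X, P X → P (UniversalEnvelopingAlgebra.ι ℂ x * X)) : P X := by
  let A : Submodule ℂ (UniversalEnvelopingAlgebra ℂ L) :=
    { carrier := {X | P X}
      add_mem' := fun h h' => add _ _ h h'
      zero_mem' := by simpa using smul 0 1 one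
      smul_mem' := fun t X h => smul t X h }
  let B : Subalgebra ℂ (UniversalEnvelopingAlgebra ℂ L) :=
    { carrier := {Y | ∀ X ∈ A, Y * X ∈ A}
      add_mem' := fun {Y Z} h h' X hX => by rw [add_mul]; exact A.add_mem (h X hX) (h' X hX)
      mul_mem' := fun {Y Z} h h' X hX => by rw [mul_assoc]; exact h _ (h' X hX)
      algebraMap_mem' := fun t X hX => by rw [← Algebra.smul_def]; exact A.smul_mem t hX }
  let f : L →ₗ⁅ℂ⁆ B :=
    { toFun := fun x => ⟨UniversalEnvelopingAlgebra.ι ℂ x, fun X hX => mul x X hX⟩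
      map_add' := fun x y => by ext; simp
      map_smul' := fun t x => by ext; simp
      map_lie' := fun {x y} => by
        apply Subtype.ext
        exact LieHom.map_lie (UniversalEnvelopingAlgebra.ι ℂ) x y }
  have h : B.val.comp (UniversalEnvelopingAlgebra.lift ℂ f) =
      AlgHom.id ℂ (UniversalEnvelopingAlgebra ℂ L) := by
    apply UniversalEnvelopingAlgebra.hom_ext
    ext x
    change B.val (UniversalEnvelopingAlgebra.lift ℂ f (UniversalEnvelopingAlgebra.ι ℂ x)) = _
    rw [UniversalEnvelopingAlgebra.lift_ι_apply]
    rfl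
  have h2 : X ∈ B := by
    have := congrArg (fun F => F X) h
    change ((UniversalEnvelopingAlgebra.lift ℂ f X : B) : UniversalEnvelopingAlgebra ℂ L) = X
      at this
    rw [← this]
    exact Subtype.property _
  have := h2 1 one
  rwa [mul_one] at this

end Span

open LieAlgebra LieAlgebra.IsKilling

section Triangular

variable {g : Type*} [LieRing g] [LieAlgebra ℂ g] [FiniteDimensional ℂ g] [IsSimple ℂ g]
variable {H : LieSubalgebra ℂ g} [H.IsCartanSubalgebra]

/-- A root `θ` is the highest root with respect to a base if, for every root `α`, the difference
`θ - α` is a sum of simple roots. -/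
def IsHighestRoot (b : (rootSystem H).Base) (θ : H.root) : Prop :=
  ∀ α : H.root, (rootSystem H).root θ - (rootSystem H).root α ∈
    AddSubmonoid.closure ((rootSystem H).root '' b.support)

/-- The scalar `ν` for which the form `(x | y) = ν κ(x, y)`, with `κ` the Killing form, satisfies
`(θ | θ) = 2` for the induced form on the dual of the Cartan subalgebra. -/
def formScale (θ : H.root) : ℂ := θ.1 ((cartanEquivDual H).symm θ.1.toLinear) / 2

/-- If `s` represents `θ` with respect to the scaled Killing form on the Cartan subalgebra, then
`(s | s) = 2`. -/
theorem formScale_spec (θ : H.root) (s : H)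
    (hs : ∀ h : H, formScale θ * killingForm ℂ g s h = θ.1 h) :
    formScale θ * killingForm ℂ g s s = 2 := by
  have hθ : θ.1.IsNonZero := H.isNonZero_coe_root θ
  have h0 := root_apply_cartanEquivDual_symm_ne_zero hθ
  set t := (cartanEquivDual H).symm θ.1.toLinear with ht
  have h1 : (formScale θ) • s = t := by
    rw [ht, LinearEquiv.eq_symm_apply]
    ext h
    rw [map_smul, LinearMap.smul_apply]
    exact hs h
  have h2 : θ.1 t = formScale θ * θ.1 s := by
    rw [← h1]
    exact map_smul θ.1.toLinear _ s
  rw [hs s]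
  have h3 : θ.1 t = 2 * formScale θ := by simp only [formScale]; rw [← ht]; ring
  have h4 : formScale θ ≠ 0 := by
    intro h; rw [h3, h, mul_zero] at h0; exact h0 rfl
  rw [h3, mul_comm] at h2
  exact (mul_left_cancel₀ h4 h2).symm

theorem neg_lie_neg (b : (rootSystem H).Base) (x : g)
    (hx : x ∈ {x : g | ∃ α : H.root, ¬ b.IsPos α ∧ x ∈ rootSpace H α.1}) (y : g)
    (hy : y ∈ {x : g | ∃ α : H.root, ¬ b.IsPos α ∧ x ∈ rootSpace H α.1}) :
    ⁅x, y⁆ ∈ Submodule.span ℂ {x : g | ∃ α : H.root, ¬ b.IsPos α ∧ x ∈ rootSpace H α.1} := by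
  obtain ⟨α, hα, hx⟩ := hx
  obtain ⟨β, hβ, hy⟩ := hy
  have hxy : ⁅x, y⁆ ∈ rootSpace H (α.1 + β.1 : H → ℂ) :=
    LieAlgebra.lie_mem_genWeightSpace_of_mem_genWeightSpace hx hy
  by_cases h0 : ⁅x, y⁆ = 0
  · rw [h0]; exact zero_mem _
  have hne : rootSpace H (α.1 + β.1 : H → ℂ) ≠ ⊥ := fun h => h0 (by
    rw [h] at hxy; exact (LieSubmodule.mem_bot _).mp hxy)
  let γ : LieModule.Weight ℂ H g := ⟨_, hne⟩
  have hγ : γ.IsNonZero := by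
    intro hz
    have hz : (α.1 + β.1 : H → ℂ) = 0 := hz
    let _ := (rootSystem H).indexNeg
    have e : (rootSystem H).root β = (rootSystem H).root ((rootSystem H).reflectionPerm α α) := by
      rw [RootPairing.root_reflectionPerm, RootPairing.reflection_apply_self]
      ext h
      have := congrFun hz h
      simp only [Pi.add_apply, Pi.zero_apply] at this
      simpa using eq_neg_of_add_eq_zero_right this
    have e' : β = -α := (rootSystem H).root.injective e
    rw [e', RootPairing.Base.IsPos.neg_iff_not] at hβ
    exact hβ hα
  let k : H.root := ⟨γ, by simpa using hγ⟩
  refine Submodule.subset_span ⟨k, ?_, hxy⟩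
  have hk : (rootSystem H).root k = (rootSystem H).root α + (rootSystem H).root β := by
    ext h; simp [k, γ]
  rw [RootPairing.Base.isPos_iff'] at hα hβ ⊢
  rw [b.height_add hk]
  omega

/-- The subalgebra `𝔫₋` of `g`, spanned by the root spaces of the negative roots. -/
def nMinus (b : (rootSystem H).Base) : LieSubalgebra ℂ g :=
  spanSubalgebra {x : g | ∃ α : H.root, ¬ b.IsPos α ∧ x ∈ rootSpace H α.1} (neg_lie_neg b)

end Triangular

/-! ### Negative parts -/

section Negative

variable {g : Type*} [LieRing g] [LieAlgebra ℂ g]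

theorem hom_lie_of_ne {ν : ℂ} {m n : ℤ} (h : m + n ≠ 0) (p q : g × ℂ) :
    ⁅hom ν m p, hom ν n q⁆ = hom ν (m + n) (⁅p.1, q.1⁆ + ((n : ℂ) * p.2) • q.1 -
      ((m : ℂ) * q.2) • p.1, ((n : ℂ) - m) * (p.2 * q.2)) := by
  rw [hom_bracket, homBracket_apply]
  simp only [h, if_false]
  rw [show ((0, 0) : ℂ × ℂ) = 0 from rfl, map_zero, add_zero]

theorem cur_zero_lie {ν : ℂ} (x : g) (n : ℤ) (q : g × ℂ) :
    ⁅cur ν x 0, hom ν n q⁆ = hom ν n (⁅x, q.1⁆, 0) := by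
  rw [cur, hom_bracket, homBracket_apply, zero_add, ← add_zero (hom ν n (_, 0))]
  congr 1
  · congr 1; ext <;> simp
  · rw [← map_zero (cen ν)]; congr 1
    ext <;> simp

theorem lie_cur_zero {ν : ℂ} (x : g) (n : ℤ) (q : g × ℂ) :
    ⁅hom ν n q, cur ν x 0⁆ = hom ν n (⁅q.1, x⁆, 0) := by
  rw [← lie_skew, cur_zero_lie, ← map_neg]
  congr 1; ext <;> simp

/-- The elements `x(m) + r dₘ` with `m < 0`, together with the elements `x(0)` with `x ∈ 𝔫`. -/
def negSet (ν : ℂ) (n : LieSubalgebra ℂ g) : Set (AffVir g ν) :=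
  {X | (∃ m : ℤ, m < 0 ∧ ∃ p, X = hom ν m p) ∨ ∃ x ∈ n, X = cur ν x 0}

theorem negSet_lie (ν : ℂ) (n : LieSubalgebra ℂ g) (X : AffVir g ν) (hX : X ∈ negSet ν n)
    (Y : AffVir g ν) (hY : Y ∈ negSet ν n) : ⁅X, Y⁆ ∈ Submodule.span ℂ (negSet ν n) := by
  apply Submodule.subset_span
  obtain ⟨m, hm, p, rfl⟩ | ⟨x, hx, rfl⟩ := hX <;> obtain ⟨k, hk, q, rfl⟩ | ⟨y, hy, rfl⟩ := hY
  · rw [hom_lie_of_ne (by omega)]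
    exact Or.inl ⟨m + k, by omega, _, rfl⟩
  · rw [lie_cur_zero]; exact Or.inl ⟨m, hm, _, rfl⟩
  · rw [cur_zero_lie]; exact Or.inl ⟨k, hk, _, rfl⟩
  · rw [cur.eq_1 ν y, cur_zero_lie]; exact Or.inr ⟨_, n.lie_mem hx hy, rfl⟩

/-- The negative part `𝔏(g)₋ = 𝔫₋ ⊕ (⊕_{m < 0} (g(m) ⊕ ℂ dₘ))`, for `n = 𝔫₋`. -/
def affMinus (ν : ℂ) (n : LieSubalgebra ℂ g) : LieSubalgebra ℂ (AffVir g ν) :=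
  spanSubalgebra (negSet ν n) (negSet_lie ν n)

theorem loopNeg_lie (ν : ℂ) (X : AffVir g ν) (hX : X ∈ {X | ∃ m : ℤ, m < 0 ∧ ∃ x, X = cur ν x m})
    (Y : AffVir g ν) (hY : Y ∈ {X | ∃ m : ℤ, m < 0 ∧ ∃ x, X = cur ν x m}) :
    ⁅X, Y⁆ ∈ Submodule.span ℂ {X : AffVir g ν | ∃ m : ℤ, m < 0 ∧ ∃ x, X = cur ν x m} := by
  obtain ⟨m, hm, x, rfl⟩ := hX
  obtain ⟨k, hk, y, rfl⟩ := hY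
  refine Submodule.subset_span ⟨m + k, by omega, ⁅x, y⁆, ?_⟩
  rw [cur_lie_cur, if_neg (by omega), mul_zero, zero_smul, add_zero]

variable (g) in
/-- The subalgebra `g ⊗ t⁻¹ ℂ[t⁻¹]`. -/
def loopNeg (ν : ℂ) : LieSubalgebra ℂ (AffVir g ν) :=
  spanSubalgebra {X | ∃ m : ℤ, m < 0 ∧ ∃ x, X = cur ν x m} (loopNeg_lie ν)

theorem virNeg_lie (ν : ℂ) (X : AffVir g ν) (hX : X ∈ {X | ∃ m : ℤ, m < 0 ∧ X = vir g ν m})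
    (Y : AffVir g ν) (hY : Y ∈ {X | ∃ m : ℤ, m < 0 ∧ X = vir g ν m}) :
    ⁅X, Y⁆ ∈ Submodule.span ℂ {X : AffVir g ν | ∃ m : ℤ, m < 0 ∧ X = vir g ν m} := by
  obtain ⟨m, hm, rfl⟩ := hX
  obtain ⟨k, hk, rfl⟩ := hY
  rw [vir_lie_vir, if_neg (by omega), zero_mul, zero_smul, add_zero]
  exact Submodule.smul_mem _ _ (Submodule.subset_span ⟨m + k, by omega, rfl⟩)

variable (g) in
/-- The negative part `𝒱₋` of the Virasoro algebra, spanned by the `dₘ` with `m < 0`. -/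
def virNeg (ν : ℂ) : LieSubalgebra ℂ (AffVir g ν) :=
  spanSubalgebra {X | ∃ m : ℤ, m < 0 ∧ X = vir g ν m} (virNeg_lie ν)

theorem loopNeg_le (ν : ℂ) (n : LieSubalgebra ℂ g) : loopNeg g ν ≤ affMinus ν n :=
  Submodule.span_mono (by rintro _ ⟨m, hm, x, rfl⟩; exact Or.inl ⟨m, hm, _, rfl⟩)

theorem virNeg_le (ν : ℂ) (n : LieSubalgebra ℂ g) : virNeg g ν ≤ affMinus ν n :=
  Submodule.span_mono (by rintro _ ⟨m, hm, rfl⟩; exact Or.inl ⟨m, hm, _, rfl⟩)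

/-- The inclusion `U(g ⊗ t⁻¹ ℂ[t⁻¹]) → U(𝔏(g)₋)`. -/
def inclLoop (ν : ℂ) (n : LieSubalgebra ℂ g) :
    UniversalEnvelopingAlgebra ℂ (loopNeg g ν) →ₐ[ℂ] UniversalEnvelopingAlgebra ℂ (affMinus ν n) :=
  mapU (LieSubalgebra.inclusion (loopNeg_le ν n))

/-- The inclusion `U(𝒱₋) → U(𝔏(g)₋)`. -/
def inclVir (ν : ℂ) (n : LieSubalgebra ℂ g) :
    UniversalEnvelopingAlgebra ℂ (virNeg g ν) →ₐ[ℂ] UniversalEnvelopingAlgebra ℂ (affMinus ν n) :=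
  mapU (LieSubalgebra.inclusion (virNeg_le ν n))

/-- The homomorphism `𝔫₋ → 𝔏(g)₋`, `x ↦ x(0)`. -/
def finHom (ν : ℂ) (n : LieSubalgebra ℂ g) : n →ₗ⁅ℂ⁆ affMinus ν n where
  toFun x := ⟨cur ν x 0, subset_spanSubalgebra (Or.inr ⟨x, x.2, rfl⟩)⟩
  map_add' x y := by
    apply Subtype.ext
    change hom ν 0 _ = hom ν 0 _ + hom ν 0 _
    rw [← map_add]; congr 1; ext <;> simp
  map_smul' t x := by
    apply Subtype.ext
    change hom ν 0 _ = t • hom ν 0 _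
    rw [← map_smul]; congr 1; ext <;> simp
  map_lie' := by
    intro x y
    apply Subtype.ext
    change cur ν ⁅(x : g), (y : g)⁆ 0 = ⁅cur ν (x : g) 0, cur ν (y : g) 0⁆
    rw [cur_lie_cur]; simp

/-- The inclusion `U(𝔫₋) → U(𝔏(g)₋)`. -/
def inclFin (ν : ℂ) (n : LieSubalgebra ℂ g) :
    UniversalEnvelopingAlgebra ℂ n →ₐ[ℂ] UniversalEnvelopingAlgebra ℂ (affMinus ν n) :=
  mapU (finHom ν n)

end Negative

/-! ### The functionals `ψₙ` -/

section Psi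

variable (g : Type*) [LieRing g] [LieAlgebra ℂ g] (ν : ℂ)

/-- The sum of the coefficients. -/
def coeffSum (W : Type*) [AddCommGroup W] [Module ℂ W] : (ℤ →₀ W) →ₗ[ℂ] W :=
  Finsupp.lsum ℂ fun _ => LinearMap.id

/-- The factor `- b m - a - n + (D + m)`; for `m = -k` and `D = -s` it is `k b - a - n - (s + k)`. -/
def psiFactor (a b : ℂ) (n m D : ℤ) : ℂ := -(b * m) - a - n + (D + m)

/-- The action of `dₘ` (`m < 0`) on `⊕_D ℂ t ^ D` by `t ^ D ↦ psiFactor a b n m D t ^ (D + m)`. -/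
def psiHom (a b : ℂ) (n : ℤ) : virNeg g ν →ₗ⁅ℂ⁆ Module.End ℂ (ℤ →₀ ℂ) :=
  spanHom _ _
    (gradedAct ν fun m D =>
      (LinearMap.snd ℂ g ℂ).smulRight (psiFactor a b n m D • LinearMap.id))
    (by
      rintro _ ⟨m, hm, rfl⟩ _ ⟨k, hk, rfl⟩
      rw [vir_lie_vir, if_neg (by omega), zero_mul, zero_smul, add_zero]
      rw [map_smul, LieRing.of_associative_ring_bracket]
      refine Finsupp.lhom_ext fun D c => ?_
      simp only [vir, LinearMap.smul_apply, LinearMap.sub_apply, Module.End.mul_apply,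
        gradedAct_hom, LinearMap.smulRight_apply, LinearMap.snd_apply, one_smul, LinearMap.id_apply,
        smul_eq_mul, Finsupp.smul_single]
      rw [show m + (k + D) = m + k + D by ring, show k + (m + D) = m + k + D by ring,
        ← Finsupp.single_sub]
      congr 1
      simp only [psiFactor]
      push_cast
      ring)

/-- The functional `ψₙ` on `U(𝒱₋)`. -/
def psi (a b : ℂ) (n : ℤ) : UniversalEnvelopingAlgebra ℂ (virNeg g ν) →ₗ[ℂ] ℂ :=
  coeffSum ℂ ∘ₗ (UniversalEnvelopingAlgebra.lift ℂ (psiHom g ν a b n)).toLinearMap.flip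
    (Finsupp.single 0 1)

/-- The element `d₋ₖ` of `U(𝒱₋)`, for `k ≥ 1`. -/
def dNeg (k : ℕ+) : UniversalEnvelopingAlgebra ℂ (virNeg g ν) :=
  UniversalEnvelopingAlgebra.ι ℂ
    ⟨vir g ν (-(k : ℤ)), subset_spanSubalgebra ⟨_, by simp, rfl⟩⟩

theorem psi_one (a b : ℂ) (n : ℤ) : psi g ν a b n 1 = 1 := by
  simp [psi, coeffSum]

theorem dNeg_act (a b : ℂ) (n : ℤ) (k : ℕ+) (D : ℤ) (c : ℂ) :
    UniversalEnvelopingAlgebra.lift ℂ (psiHom g ν a b n) (dNeg g ν k) (Finsupp.single D c) =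
      Finsupp.single (-(k : ℤ) + D) (psiFactor a b n (-(k : ℤ)) D * c) := by
  rw [dNeg, UniversalEnvelopingAlgebra.lift_ι_apply]
  change gradedAct ν _ (hom ν _ (0, 1)) _ = _
  rw [gradedAct_hom]
  simp

theorem psiHom_prod (a b : ℂ) (n : ℤ) (ks : List ℕ+) :
    UniversalEnvelopingAlgebra.lift ℂ (psiHom g ν a b n) (ks.map (dNeg g ν)).prod
      (Finsupp.single 0 1) =
    Finsupp.single (-((ks.map fun k : ℕ+ => ((k : ℕ) : ℤ)).sum))
      (psi g ν a b n (ks.map (dNeg g ν)).prod) := by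
  have key : ∃ c : ℂ, UniversalEnvelopingAlgebra.lift ℂ (psiHom g ν a b n)
      (ks.map (dNeg g ν)).prod (Finsupp.single 0 1) =
      Finsupp.single (-((ks.map fun k : ℕ+ => ((k : ℕ) : ℤ)).sum)) c := by
    induction ks with
    | nil => exact ⟨1, by simp⟩
    | cons k ks ih =>
      obtain ⟨c, hc⟩ := ih
      refine ⟨psiFactor a b n (-(k : ℤ)) (-((ks.map fun k : ℕ+ => ((k : ℕ) : ℤ)).sum)) * c, ?_⟩
      rw [List.map_cons, List.prod_cons, map_mul, Module.End.mul_apply, hc, dNeg_act,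
        List.map_cons, List.sum_cons, neg_add]
  obtain ⟨c, hc⟩ := key
  rw [psi, LinearMap.comp_apply, LinearMap.flip_apply, AlgHom.toLinearMap_apply, hc, coeffSum,
    Finsupp.lsum_single, LinearMap.id_apply]

/-- The values of `ψₙ` on products `d₋ₖ ⋯`: by recursion,
`ψₙ(d_{-k_r} ⋯ d_{-k_1}) = ∏ⱼ (k_j b - a - n - (k_1 + ⋯ + k_j))`. -/
theorem psi_cons (a b : ℂ) (n : ℤ) (k : ℕ+) (ks : List ℕ+) :
    psi g ν a b n ((k :: ks).map (dNeg g ν)).prod =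
      ((k : ℂ) * b - a - n - ((k :: ks).map fun k : ℕ+ => ((k : ℕ) : ℂ)).sum) *
        psi g ν a b n (ks.map (dNeg g ν)).prod := by
  rw [psi, LinearMap.comp_apply, LinearMap.flip_apply, AlgHom.toLinearMap_apply, List.map_cons,
    List.prod_cons, map_mul, Module.End.mul_apply, psiHom_prod, dNeg_act, coeffSum,
    Finsupp.lsum_single, LinearMap.id_apply]
  congr 1
  simp only [psiFactor, List.map_cons, List.sum_cons]
  have : (((ks.map fun k : ℕ+ => ((k : ℕ) : ℤ)).sum : ℤ) : ℂ) =
      (ks.map fun k : ℕ+ => ((k : ℕ) : ℂ)).sum := by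
    induction ks with
    | nil => simp
    | cons k ks ih => simp only [List.map_cons, List.sum_cons]; rw [Int.cast_add, ih, Int.cast_natCast]
  rw [Int.cast_neg, Int.cast_neg, Int.cast_natCast, this]
  ring

end Psi

/-! ### The linear maps `φₙ` -/

section Phi

variable {g : Type*} [LieRing g] [LieAlgebra ℂ g] (ν : ℂ)

/-- The evaluation `g ⊗ t⁻¹ ℂ[t⁻¹] → g`, `x(-i) ↦ x`. -/
def evalHom : loopNeg g ν →ₗ⁅ℂ⁆ g :=
  spanHom _ _ ((Finsupp.lsum ℂ fun _ => LinearMap.fst ℂ g ℂ) ∘ₗ loopPart)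
    (by
      rintro _ ⟨m, hm, x, rfl⟩ _ ⟨k, hk, y, rfl⟩
      rw [cur_lie_cur, if_neg (by omega), mul_zero, zero_smul, add_zero]
      simp [cur])

/-- The forgetful map `x ↦ x̃` from `U(g ⊗ t⁻¹ ℂ[t⁻¹])` to `U(g)`, which sends
`x_s(-i_s) ⋯ x_1(-i_1)` to `x_s ⋯ x_1`. -/
def forget : UniversalEnvelopingAlgebra ℂ (loopNeg g ν) →ₐ[ℂ] UniversalEnvelopingAlgebra ℂ g :=
  mapU (evalHom ν)

/-- The element `x(-i)` of `U(g ⊗ t⁻¹ ℂ[t⁻¹])`, for `i ≥ 1`. -/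
def curNeg (x : g) (i : ℕ+) : UniversalEnvelopingAlgebra ℂ (loopNeg g ν) :=
  UniversalEnvelopingAlgebra.ι ℂ
    ⟨cur ν x (-(i : ℤ)), subset_spanSubalgebra ⟨_, by simp, x, rfl⟩⟩

theorem forget_curNeg (x : g) (i : ℕ+) :
    forget ν (curNeg ν x i) = UniversalEnvelopingAlgebra.ι ℂ x := by
  rw [forget, curNeg, mapU_ι]
  congr 1
  change Finsupp.lsum ℂ _ (loopPart (hom ν _ (x, 0))) = x
  rw [loopPart_hom, Finsupp.lsum_single]; rfl

variable (V : Type*) [AddCommGroup V] [Module ℂ V] [LieRingModule g V] [LieModule ℂ g V]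

/-- The map sending `x ∈ g` to the operator `v ↦ -x v`, as a homomorphism into the opposite of
`End V`. -/
def circHom : g →ₗ⁅ℂ⁆ (Module.End ℂ V)ᵐᵒᵖ where
  toFun x := MulOpposite.op (-LieModule.toEnd ℂ g V x)
  map_add' x y := by rw [map_add, neg_add, MulOpposite.op_add]
  map_smul' t x := by rw [map_smul, ← smul_neg, MulOpposite.op_smul]; rfl
  map_lie' := by
    intro x y
    apply MulOpposite.unop_injective
    rw [LieHom.map_lie, LieRing.of_associative_ring_bracket, LieRing.of_associative_ring_bracket]
    simp

/-- The map `∘`: `circ x v = x ∘ v`, where `(x₁ x₂ ⋯ x_s) ∘ v = (-1) ^ s x_s ⋯ x₂ x₁ v`. -/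
def circ : UniversalEnvelopingAlgebra ℂ g →ₗ[ℂ] Module.End ℂ V :=
  (MulOpposite.opLinearEquiv ℂ).symm.toLinearMap ∘ₗ
    (UniversalEnvelopingAlgebra.lift ℂ (circHom V)).toLinearMap

theorem circ_one (v : V) : circ V (1 : UniversalEnvelopingAlgebra ℂ g) v = v := by
  simp [circ]

theorem circ_mul (X Y : UniversalEnvelopingAlgebra ℂ g) (v : V) :
    circ V (X * Y) v = circ V Y (circ V X v) := by
  simp [circ]

theorem circ_ι (x : g) (v : V) : circ V (UniversalEnvelopingAlgebra.ι ℂ x) v = -⁅x, v⁆ := by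
  rw [circ, LinearMap.comp_apply, AlgHom.toLinearMap_apply,
    UniversalEnvelopingAlgebra.lift_ι_apply]
  rfl

variable (N : Type*) [AddCommGroup N] [Module ℂ N] [LieRingModule g N] [LieModule ℂ g N]

/-- The operator by which `x(m) + r dₘ`, `m ≤ 0`, acts on the component of degree `D` of
`⊕_D Hom(V, N) t ^ D`: it sends `f` to `r (psiFactor a b n m D) f - f ∘ x`, plus `x ∘ f` when
`m = 0`. -/
def phiOp (a b : ℂ) (n m D : ℤ) : g × ℂ →ₗ[ℂ] Module.End ℂ (V →ₗ[ℂ] N) where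
  toFun p := (p.2 * psiFactor a b n m D) • LinearMap.id -
    LinearMap.lcomp ℂ N (LieModule.toEnd ℂ g V p.1) +
    if m = 0 then LinearMap.llcomp ℂ V N N (LieModule.toEnd ℂ g N p.1) else 0
  map_add' p q := by
    ext f v
    split_ifs <;> simp [add_mul, add_smul] <;> abel
  map_smul' t p := by
    ext f v
    split_ifs <;> simp [mul_assoc, smul_add, smul_sub, mul_smul]

theorem phiOp_apply (a b : ℂ) (n m D : ℤ) (p : g × ℂ) (f : V →ₗ[ℂ] N) (v : V) :
    phiOp V N a b n m D p f v = (p.2 * psiFactor a b n m D) • f v - f ⁅p.1, v⁆ +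
      if m = 0 then ⁅p.1, f v⁆ else 0 := by
  by_cases h : m = 0 <;> simp [phiOp, h]

/-- The action of `𝔏(g)₋` on `⊕_D Hom(V, N) t ^ D` through which `φₙ` is defined. -/
def phiHom (𝔫 : LieSubalgebra ℂ g) (a b : ℂ) (n : ℤ) :
    affMinus ν 𝔫 →ₗ⁅ℂ⁆ Module.End ℂ (ℤ →₀ (V →ₗ[ℂ] N)) :=
  spanHom _ _ (gradedAct ν (phiOp V N a b n))
    (by
      have aux (m k : ℤ) (hm : m ≤ 0) (hk : k ≤ 0) (p q : g × ℂ) (hp : m = 0 → p.2 = 0)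
          (hq : k = 0 → q.2 = 0) :
          gradedAct ν (phiOp V N a b n) ⁅hom ν m p, hom ν k q⁆ =
            ⁅gradedAct ν (phiOp V N a b n) (hom ν m p),
              gradedAct ν (phiOp V N a b n) (hom ν k q)⁆ := by
        rw [LieRing.of_associative_ring_bracket, hom_bracket, homBracket_apply, map_add,
          gradedAct_cen, add_zero]
        refine Finsupp.lhom_ext fun D f => ?_
        simp only [LinearMap.sub_apply, Module.End.mul_apply, gradedAct_hom]
        rw [show m + (k + D) = m + k + D by ring, show k + (m + D) = m + k + D by ring,
          ← Finsupp.single_sub]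
        congr 1
        ext v
        obtain ⟨x, r⟩ := p
        obtain ⟨y, s⟩ := q
        simp only [LinearMap.sub_apply, phiOp_apply]
        rcases hm.eq_or_lt with rfl | hm' <;> rcases hk.eq_or_lt with rfl | hk'
        · obtain rfl := hp rfl
          obtain rfl := hq rfl
          simp
          abel
        · obtain rfl := hp rfl
          simp [hk'.ne, smul_sub, lie_smul]
          module
        · obtain rfl := hq rfl
          simp [hm'.ne]
          module
        · have : m + k ≠ 0 := by omega
          simp [hm'.ne, hk'.ne, this, psiFactor]
          module
      rintro _ (⟨m, hm, p, rfl⟩ | ⟨x, hx, rfl⟩) _ (⟨k, hk, q, rfl⟩ | ⟨y, hy, rfl⟩)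
      · exact aux m k hm.le hk.le p q (fun h => by omega) (fun h => by omega)
      · exact aux m 0 hm.le le_rfl p _ (fun h => by omega) (fun h => rfl)
      · exact aux 0 k le_rfl hk.le _ q (fun h => rfl) (fun h => by omega)
      · exact aux 0 0 le_rfl le_rfl _ _ (fun h => rfl) (fun h => rfl))

/-- The corresponding action of `U(𝔏(g)₋)`. -/
def phiAlg (𝔫 : LieSubalgebra ℂ g) (a b : ℂ) (n : ℤ) :
    UniversalEnvelopingAlgebra ℂ (affMinus ν 𝔫) →ₐ[ℂ] Module.End ℂ (ℤ →₀ (V →ₗ[ℂ] N)) :=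
  UniversalEnvelopingAlgebra.lift ℂ (phiHom ν V N 𝔫 a b n)

theorem phiAlg_ι (𝔫 : LieSubalgebra ℂ g) (a b : ℂ) (n : ℤ) (x : affMinus ν 𝔫) :
    phiAlg ν V N 𝔫 a b n (UniversalEnvelopingAlgebra.ι ℂ x) =
      gradedAct ν (phiOp V N a b n) (x : AffVir g ν) := by
  rw [phiAlg, UniversalEnvelopingAlgebra.lift_ι_apply]; rfl

/-- For `f₀ : V → N`, the linear map `U(𝔏(g)₋) ⊗ V → N` sending `P ⊗ v` to the value at `v` of the
sum of the components of `P · f₀`. -/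
def phiOf (𝔫 : LieSubalgebra ℂ g) (a b : ℂ) (n : ℤ) (f₀ : V →ₗ[ℂ] N) :
    UniversalEnvelopingAlgebra ℂ (affMinus ν 𝔫) ⊗[ℂ] V →ₗ[ℂ] N :=
  TensorProduct.lift (coeffSum (V →ₗ[ℂ] N) ∘ₗ
    (phiAlg ν V N 𝔫 a b n).toLinearMap.flip
      (Finsupp.single 0 f₀))

theorem phiOf_tmul (𝔫 : LieSubalgebra ℂ g) (a b : ℂ) (n : ℤ) (f₀ : V →ₗ[ℂ] N)
    (P : UniversalEnvelopingAlgebra ℂ (affMinus ν 𝔫)) (v : V) :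
    phiOf ν V N 𝔫 a b n f₀ (P ⊗ₜ v) =
      coeffSum (V →ₗ[ℂ] N) (phiAlg ν V N 𝔫 a b n P
        (Finsupp.single 0 f₀)) v := rfl

theorem phi_loop (𝔫 : LieSubalgebra ℂ g) (a b : ℂ) (n : ℤ)
    (x : UniversalEnvelopingAlgebra ℂ (loopNeg g ν)) (F : ℤ →₀ (V →ₗ[ℂ] N)) :
    coeffSum (V →ₗ[ℂ] N) (phiAlg ν V N 𝔫 a b n
      (inclLoop ν 𝔫 x) F) = coeffSum (V →ₗ[ℂ] N) F ∘ₗ circ V (forget ν x) := by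
  have base (X : AffVir g ν) (hX : X ∈ Submodule.span ℂ {X | ∃ m : ℤ, m < 0 ∧ ∃ x, X = cur ν x m})
      (F : ℤ →₀ (V →ₗ[ℂ] N)) :
      coeffSum (V →ₗ[ℂ] N) (gradedAct ν (phiOp V N a b n) X F) =
        -(coeffSum (V →ₗ[ℂ] N) F ∘ₗ LieModule.toEnd ℂ g V
          (((Finsupp.lsum ℂ fun _ : ℤ => LinearMap.fst ℂ g ℂ) ∘ₗ loopPart) X)) := by
    induction hX using Submodule.span_induction with
    | zero => simp
    | add X Y _ _ h h' =>
      rw [map_add, map_add, map_add, LinearMap.add_apply, map_add, h, h', LinearMap.comp_add,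
        neg_add]
    | smul t X _ h =>
      rw [map_smul, map_smul, map_smul, LinearMap.smul_apply, map_smul, h, LinearMap.comp_smul,
        smul_neg]
    | mem X hX =>
      obtain ⟨m, hm, x, rfl⟩ := hX
      induction F using Finsupp.induction_linear with
      | zero => simp
      | add F F' h h' =>
        rw [map_add, map_add, map_add, h, h', LinearMap.add_comp, neg_add]
      | single D f =>
        rw [cur, gradedAct_hom]
        ext v
        simp only [coeffSum, Finsupp.lsum_single, LinearMap.id_apply, phiOp_apply, hm.ne, if_false]
        simp
  induction x using induction_mul generalizing F with
  | add X Y h h' => simp only [map_add, LinearMap.add_apply, LinearMap.comp_add, h, h']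
  | smul t X h => simp only [map_smul, LinearMap.smul_apply, LinearMap.comp_smul, h]
  | one =>
    ext v
    simp [circ_one]
  | mul x X h =>
    rw [map_mul, map_mul, Module.End.mul_apply, inclLoop, mapU_ι, phiAlg_ι]
    refine (base x.1 x.2 _).trans ?_
    rw [← inclLoop, h, map_mul]
    ext v
    rw [LinearMap.comp_apply (g := circ V _), circ_mul, forget, mapU_ι, circ_ι]
    simp only [LinearMap.neg_apply, LinearMap.comp_apply, map_neg]
    rfl

theorem phi_vir (𝔫 : LieSubalgebra ℂ g) (a b : ℂ) (n : ℤ)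
    (y : UniversalEnvelopingAlgebra ℂ (virNeg g ν)) (f : V →ₗ[ℂ] N) (h : ℤ →₀ ℂ) :
    phiAlg ν V N 𝔫 a b n (inclVir ν 𝔫 y)
      (Finsupp.mapRange.linearMap (LinearMap.toSpanSingleton ℂ _ f) h) =
    Finsupp.mapRange.linearMap (LinearMap.toSpanSingleton ℂ _ f)
      (UniversalEnvelopingAlgebra.lift ℂ (psiHom g ν a b n) y h) := by
  have base (X : AffVir g ν) (hX : X ∈ Submodule.span ℂ {X | ∃ m : ℤ, m < 0 ∧ X = vir g ν m})
      (h : ℤ →₀ ℂ) :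
      gradedAct ν (phiOp V N a b n) X
        (Finsupp.mapRange.linearMap (LinearMap.toSpanSingleton ℂ _ f) h) =
      Finsupp.mapRange.linearMap (LinearMap.toSpanSingleton ℂ _ f)
        (gradedAct ν (fun m D =>
          (LinearMap.snd ℂ g ℂ).smulRight (psiFactor a b n m D • LinearMap.id)) X h) := by
    induction hX using Submodule.span_induction with
    | zero => simp
    | add X Y _ _ h h' => simp only [map_add, LinearMap.add_apply, h, h']
    | smul t X _ h => simp only [map_smul, LinearMap.smul_apply, h]
    | mem X hX =>
      obtain ⟨m, hm, rfl⟩ := hX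
      induction h using Finsupp.induction_linear with
      | zero => simp
      | add F F' h h' => simp only [map_add, h, h']
      | single D c =>
        rw [vir, gradedAct_hom]
        simp only [Finsupp.mapRange.linearMap_apply, Finsupp.mapRange_single, gradedAct_hom]
        congr 1
        ext v
        simp [phiOp_apply, hm.ne, smul_smul, mul_comm]
  induction y using induction_mul generalizing h with
  | add X Y e e' => simp only [map_add, LinearMap.add_apply, e, e']
  | smul t X e => simp only [map_smul, LinearMap.smul_apply, e]
  | one => simp
  | mul x X hX =>
    rw [map_mul, map_mul, map_mul, Module.End.mul_apply, Module.End.mul_apply, hX, inclVir, mapU_ι,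
      phiAlg_ι, UniversalEnvelopingAlgebra.lift_ι_apply]
    exact base x.1 x.2 _

theorem phi_fin {T : Type*} [AddCommGroup T] [Module ℂ T] [LieRingModule g T] [LieModule ℂ g T]
    (𝔫 : LieSubalgebra ℂ g) (a b : ℂ) (n : ℤ) (z : UniversalEnvelopingAlgebra ℂ 𝔫) (w : T) :
    phiAlg ν V (T ⊗[ℂ] V) 𝔫 a b n (inclFin ν 𝔫 z)
      (Finsupp.single 0 (TensorProduct.mk ℂ T V w)) =
    Finsupp.single 0 (TensorProduct.mk ℂ T V (actU 𝔫 T z w)) := by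
  induction z using induction_mul with
  | add X Y h h' => simp only [map_add, LinearMap.add_apply, Finsupp.single_add, h, h']
  | smul t X h => simp only [map_smul, LinearMap.smul_apply, ← Finsupp.smul_single, h]
  | one => simp
  | mul x X h =>
    rw [map_mul, map_mul, map_mul, Module.End.mul_apply, Module.End.mul_apply, h, inclFin, mapU_ι,
      phiAlg_ι, actU_ι]
    change gradedAct ν _ (hom ν 0 ((x : g), 0)) _ = _
    rw [gradedAct_hom]
    congr 1
    ext v
    simp [phiOp_apply, TensorProduct.LieModule.lie_tmul_right]

theorem phiOf_mul {T : Type*} [AddCommGroup T] [Module ℂ T] [LieRingModule g T] [LieModule ℂ g T]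
    (𝔫 : LieSubalgebra ℂ g) (a b : ℂ) (n : ℤ) (w : T)
    (x : UniversalEnvelopingAlgebra ℂ (loopNeg g ν)) (y : UniversalEnvelopingAlgebra ℂ (virNeg g ν))
    (z : UniversalEnvelopingAlgebra ℂ 𝔫) (v : V) :
    phiOf ν V (T ⊗[ℂ] V) 𝔫 a b n (TensorProduct.mk ℂ T V w)
        ((inclLoop ν 𝔫 x * inclVir ν 𝔫 y * inclFin ν 𝔫 z) ⊗ₜ v) =
      psi g ν a b n y • (actU 𝔫 T z w ⊗ₜ circ V (forget ν x) v) := by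
  have e : (Finsupp.single 0 (TensorProduct.mk ℂ T V (actU 𝔫 T z w)) : ℤ →₀ _) =
      Finsupp.mapRange.linearMap
        (LinearMap.toSpanSingleton ℂ _ (TensorProduct.mk ℂ T V (actU 𝔫 T z w)))
        (Finsupp.single 0 1) := by simp
  have e2 (f : V →ₗ[ℂ] T ⊗[ℂ] V) (h : ℤ →₀ ℂ) : coeffSum (V →ₗ[ℂ] T ⊗[ℂ] V)
      (Finsupp.mapRange.linearMap (LinearMap.toSpanSingleton ℂ _ f) h) = coeffSum ℂ h • f := by
    induction h using Finsupp.induction_linear with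
    | zero => simp
    | add h h' e e' => simp only [map_add, add_smul, e, e']
    | single D c => simp [coeffSum]
  rw [phiOf_tmul, map_mul, map_mul, Module.End.mul_apply, Module.End.mul_apply, phi_fin, phi_loop,
    e, phi_vir, e2]
  rfl

end Phi

/-! ### Highest weight modules -/

section HighestWeight

variable {g : Type*} [LieRing g] [LieAlgebra ℂ g] [FiniteDimensional ℂ g] [IsSimple ℂ g]
variable {H : LieSubalgebra ℂ g} [H.IsCartanSubalgebra]

/-- The elements `X - χ(X)` of `U(𝔏(g))`, for `X` in a spanning set of `ℋ ⊕ 𝔏(g)₊` and `χ` the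
character by which `ℋ ⊕ 𝔏(g)₊` acts on the one-dimensional module `ℂ u`. -/
def hwRel (ν : ℂ) (b : (rootSystem H).Base) (lam : Module.Dual ℂ H) (l k c : ℂ) :
    Set (UniversalEnvelopingAlgebra ℂ (AffVir g ν)) :=
  let ι := UniversalEnvelopingAlgebra.ι ℂ (L := AffVir g ν)
  let C := algebraMap ℂ (UniversalEnvelopingAlgebra ℂ (AffVir g ν))
  {P | (∃ h : H, P = ι (cur ν (h : g) 0) - C (lam h)) ∨
    P = ι (vir g ν 0) - C l ∨ P = ι (kk g ν) - C k ∨ P = ι (cc g ν) - C c ∨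
    (∃ α : H.root, b.IsPos α ∧ ∃ x ∈ rootSpace H α.1, P = ι (cur ν x 0)) ∨
    (∃ n : ℤ, 0 < n ∧ ∃ x : g, P = ι (cur ν x n)) ∨
    ∃ n : ℤ, 0 < n ∧ P = ι (vir g ν n)}

/-- The Verma module `M(λ, l, k, c) = U(𝔏(g)) ⊗_{U(ℋ ⊕ 𝔏(g)₊)} ℂ u`, as the quotient of `U(𝔏(g))` by
the left ideal generated by the elements `X - χ(X)`, `X ∈ ℋ ⊕ 𝔏(g)₊`. -/
abbrev Verma (ν : ℂ) (b : (rootSystem H).Base) (lam : Module.Dual ℂ H) (l k c : ℂ) : Type _ :=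
  UniversalEnvelopingAlgebra ℂ (AffVir g ν) ⧸
    Submodule.span (UniversalEnvelopingAlgebra ℂ (AffVir g ν)) (hwRel ν b lam l k c)

/-- The maximal proper submodule `J(λ, l, k, c)` of the Verma module: the sum of all proper
submodules. -/
def maxSub (ν : ℂ) (b : (rootSystem H).Base) (lam : Module.Dual ℂ H) (l k c : ℂ) :
    Submodule (UniversalEnvelopingAlgebra ℂ (AffVir g ν)) (Verma ν b lam l k c) :=
  sSup {N | N ≠ ⊤}

/-- The irreducible highest weight module `L(λ, l, k, c) = M(λ, l, k, c) / J(λ, l, k, c)`. -/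
def IrrHW (ν : ℂ) (b : (rootSystem H).Base) (lam : Module.Dual ℂ H) (l k c : ℂ) : Type _ :=
  Verma ν b lam l k c ⧸ maxSub ν b lam l k c

variable (ν : ℂ) (b : (rootSystem H).Base) (lam : Module.Dual ℂ H) (l k c : ℂ)

instance : AddCommGroup (IrrHW ν b lam l k c) :=
  inferInstanceAs (AddCommGroup (Verma ν b lam l k c ⧸ maxSub ν b lam l k c))

instance : Module (UniversalEnvelopingAlgebra ℂ (AffVir g ν)) (IrrHW ν b lam l k c) :=
  inferInstanceAs (Module _ (Verma ν b lam l k c ⧸ maxSub ν b lam l k c))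

instance : Module ℂ (IrrHW ν b lam l k c) :=
  inferInstanceAs (Module ℂ (Verma ν b lam l k c ⧸ maxSub ν b lam l k c))

instance : IsScalarTower ℂ (UniversalEnvelopingAlgebra ℂ (AffVir g ν)) (IrrHW ν b lam l k c) :=
  inferInstanceAs (IsScalarTower ℂ (UniversalEnvelopingAlgebra ℂ (AffVir g ν))
    (Verma ν b lam l k c ⧸ maxSub ν b lam l k c))

instance : LieRingModule (AffVir g ν) (IrrHW ν b lam l k c) where
  bracket X w := UniversalEnvelopingAlgebra.ι ℂ X • w
  add_lie X Y w := by
    change UniversalEnvelopingAlgebra.ι ℂ (X + Y) • w = _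
    rw [map_add, add_smul]
  lie_add X w w' := smul_add (UniversalEnvelopingAlgebra.ι ℂ X) w w'
  leibniz_lie X Y w := by
    change UniversalEnvelopingAlgebra.ι ℂ X • UniversalEnvelopingAlgebra.ι ℂ Y • w =
      UniversalEnvelopingAlgebra.ι ℂ ⁅X, Y⁆ • w +
        UniversalEnvelopingAlgebra.ι ℂ Y • UniversalEnvelopingAlgebra.ι ℂ X • w
    rw [LieHom.map_lie, LieRing.of_associative_ring_bracket, sub_smul, mul_smul, mul_smul,
      sub_add_cancel]

theorem lie_irr (X : AffVir g ν) (w : IrrHW ν b lam l k c) :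
    ⁅X, w⁆ = UniversalEnvelopingAlgebra.ι ℂ X • w := rfl

instance : LieModule ℂ (AffVir g ν) (IrrHW ν b lam l k c) where
  smul_lie t X w := by
    rw [lie_irr, lie_irr, map_smul, smul_assoc]
  lie_smul t X w := by
    rw [lie_irr, lie_irr]
    rw [← algebraMap_smul (UniversalEnvelopingAlgebra ℂ (AffVir g ν)) t w,
      ← algebraMap_smul (UniversalEnvelopingAlgebra ℂ (AffVir g ν)) t (_ • w), ← mul_smul,
      ← mul_smul, Algebra.commutes]

/-- The highest weight vector `ū`. -/
def hwVec : IrrHW ν b lam l k c := Submodule.Quotient.mk (Submodule.Quotient.mk 1)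

theorem hwRel_smul (P : UniversalEnvelopingAlgebra ℂ (AffVir g ν)) (hP : P ∈ hwRel ν b lam l k c) :
    P • hwVec ν b lam l k c = 0 := by
  change (Submodule.Quotient.mk (P • Submodule.Quotient.mk 1) :
    Verma ν b lam l k c ⧸ maxSub ν b lam l k c) = 0
  rw [← Submodule.Quotient.mk_smul, smul_eq_mul, mul_one,
    (Submodule.Quotient.mk_eq_zero _).mpr (Submodule.subset_span hP)]
  rfl

theorem vir_zero_hwVec : ⁅vir g ν 0, hwVec ν b lam l k c⁆ = l • hwVec ν b lam l k c := by
  have h := hwRel_smul ν b lam l k c _ (Or.inr (Or.inl rfl))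
  rwa [sub_smul, algebraMap_smul, sub_eq_zero] at h

theorem exists_smul_hwVec (w : IrrHW ν b lam l k c) :
    ∃ P : UniversalEnvelopingAlgebra ℂ (AffVir g ν), w = P • hwVec ν b lam l k c := by
  obtain ⟨w, rfl⟩ := Submodule.Quotient.mk_surjective _ w
  obtain ⟨P, rfl⟩ := Submodule.Quotient.mk_surjective _ w
  refine ⟨P, ?_⟩
  change _ = (Submodule.Quotient.mk (P • Submodule.Quotient.mk 1) :
    Verma ν b lam l k c ⧸ maxSub ν b lam l k c)
  rw [← Submodule.Quotient.mk_smul, smul_eq_mul, mul_one]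

theorem cen_mul_comm (z : ℂ × ℂ) (P : UniversalEnvelopingAlgebra ℂ (AffVir g ν)) :
    UniversalEnvelopingAlgebra.ι ℂ (cen ν z : AffVir g ν) * P =
      P * UniversalEnvelopingAlgebra.ι ℂ (cen ν z : AffVir g ν) := by
  induction P using induction_mul with
  | add X Y h h' => rw [mul_add, add_mul, h, h']
  | smul t X h => rw [mul_smul_comm, smul_mul_assoc, h]
  | one => rw [mul_one, one_mul]
  | mul x X h =>
    have e : UniversalEnvelopingAlgebra.ι ℂ (cen ν z : AffVir g ν) *
        UniversalEnvelopingAlgebra.ι ℂ x = UniversalEnvelopingAlgebra.ι ℂ x *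
        UniversalEnvelopingAlgebra.ι ℂ (cen ν z : AffVir g ν) := by
      rw [← sub_eq_zero, ← LieRing.of_associative_ring_bracket, ← LieHom.map_lie, cen_bracket,
        map_zero]
    rw [← mul_assoc, e, mul_assoc, h, mul_assoc]

/-- The central element `𝐤` acts on `L(λ, l, k, c)` by the scalar `k`. -/
theorem kk_lie_irr (w : IrrHW ν b lam l k c) : ⁅kk g ν, w⁆ = k • w := by
  obtain ⟨P, rfl⟩ := exists_smul_hwVec ν b lam l k c w
  have h := hwRel_smul ν b lam l k c _ (Or.inr (Or.inr (Or.inl rfl)))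
  rw [sub_smul, algebraMap_smul, sub_eq_zero] at h
  rw [lie_irr, ← mul_smul, kk, cen_mul_comm, mul_smul, ← kk, h, smul_algebra_smul_comm]

/-- The central element `𝐜` acts on `L(λ, l, k, c)` by the scalar `c`. -/
theorem cc_lie_irr (w : IrrHW ν b lam l k c) : ⁅cc g ν, w⁆ = c • w := by
  obtain ⟨P, rfl⟩ := exists_smul_hwVec ν b lam l k c w
  have h := hwRel_smul ν b lam l k c _ (Or.inr (Or.inr (Or.inr (Or.inl rfl))))
  rw [sub_smul, algebraMap_smul, sub_eq_zero] at h
  rw [lie_irr, ← mul_smul, cc, cen_mul_comm, mul_smul, ← cc, h, smul_algebra_smul_comm]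

end HighestWeight

section Top

variable (g : Type*) [LieRing g] [LieAlgebra ℂ g] (ν : ℂ)
variable (M : Type*) [AddCommGroup M] [Module ℂ M] [LieRingModule (AffVir g ν) M]
  [LieModule ℂ (AffVir g ν) M] (l : ℂ)

/-- The space `M₀ = {w | d₀ w = l w}`, a module over `g = g(0)`. -/
def topComp : Submodule ℂ M :=
  Module.End.eigenspace (LieModule.toEnd ℂ (AffVir g ν) M (vir g ν 0)) l

variable {g ν M l} in
theorem mem_topComp {w : M} : w ∈ topComp g ν M l ↔ ⁅vir g ν 0, w⁆ = l • w :=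
  Module.End.mem_eigenspace_iff

theorem cur_mem_topComp (x : g) (w : topComp g ν M l) : ⁅cur ν x 0, (w : M)⁆ ∈ topComp g ν M l := by
  rw [mem_topComp, leibniz_lie, vir_lie_cur, mem_topComp.mp w.2]
  simp

instance : LieRingModule g (topComp g ν M l) where
  bracket x w := ⟨⁅cur ν x 0, (w : M)⁆, cur_mem_topComp g ν M l x w⟩
  add_lie x y w := by
    apply Subtype.ext
    change ⁅hom ν 0 (x + y, 0), (w : M)⁆ = ⁅hom ν 0 (x, 0), (w : M)⁆ + ⁅hom ν 0 (y, 0), (w : M)⁆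
    rw [← add_lie, ← map_add]; simp
  lie_add x w w' := by
    apply Subtype.ext
    change ⁅cur ν x 0, (w : M) + w'⁆ = ⁅cur ν x 0, (w : M)⁆ + ⁅cur ν x 0, (w' : M)⁆
    rw [lie_add]
  leibniz_lie x y w := by
    apply Subtype.ext
    change ⁅cur ν x 0, ⁅cur ν y 0, (w : M)⁆⁆ =
      ⁅cur ν ⁅x, y⁆ 0, (w : M)⁆ + ⁅cur ν y 0, ⁅cur ν x 0, (w : M)⁆⁆
    rw [leibniz_lie, cur_lie_cur]; simp

instance : LieModule ℂ g (topComp g ν M l) where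
  smul_lie t x w := by
    apply Subtype.ext
    change ⁅hom ν 0 (t • x, 0), (w : M)⁆ = t • ⁅hom ν 0 (x, 0), (w : M)⁆
    rw [← smul_lie, ← map_smul]; simp
  lie_smul t x w := by
    apply Subtype.ext
    change ⁅cur ν x 0, t • (w : M)⁆ = t • ⁅cur ν x 0, (w : M)⁆
    rw [lie_smul]

theorem coe_lie_topComp (x : g) (w : topComp g ν M l) :
    ((⁅x, w⁆ : topComp g ν M l) : M) = ⁅cur ν x 0, (w : M)⁆ := rfl

end Top

section Main

variable {g : Type*} [LieRing g] [LieAlgebra ℂ g] [FiniteDimensional ℂ g] [IsSimple ℂ g]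
variable {H : LieSubalgebra ℂ g} [H.IsCartanSubalgebra]
variable (ν : ℂ) (β : (rootSystem H).Base) (lam : Module.Dual ℂ H) (l k c : ℂ)

/-- The space `L(λ, l, k, c)₀ = {w | d₀ w = l w}`. -/
abbrev IrrHW₀ : Type _ := topComp g ν (IrrHW ν β lam l k c) l

/-- The highest weight vector `ū`, as an element of `L(λ, l, k, c)₀`. -/
def hwVec₀ : IrrHW₀ ν β lam l k c :=
  ⟨hwVec ν β lam l k c, mem_topComp.mpr (vir_zero_hwVec ν β lam l k c)⟩

/-- The annihilator of `ū` in `U(𝔏(g)₋)`. -/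
def Ann : Submodule ℂ (UniversalEnvelopingAlgebra ℂ (affMinus ν (nMinus β))) :=
  LinearMap.ker ((actU (affMinus ν (nMinus β)) (IrrHW ν β lam l k c)).toLinearMap.flip
    (hwVec ν β lam l k c))

theorem mem_Ann (P : UniversalEnvelopingAlgebra ℂ (affMinus ν (nMinus β))) :
    P ∈ Ann ν β lam l k c ↔
      actU (affMinus ν (nMinus β)) (IrrHW ν β lam l k c) P (hwVec ν β lam l k c) = 0 := Iff.rfl

variable (V : Type*) [AddCommGroup V] [Module ℂ V] [LieRingModule g V] [LieModule ℂ g V]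

/-- The linear map `φₙ : U(𝔏(g)₋) ⊗ V → L(λ, l, k, c)₀ ⊗ V`. -/
def phi (a b : ℂ) (n : ℤ) :
    UniversalEnvelopingAlgebra ℂ (affMinus ν (nMinus β)) ⊗[ℂ] V →ₗ[ℂ]
      IrrHW₀ ν β lam l k c ⊗[ℂ] V :=
  phiOf ν V (IrrHW₀ ν β lam l k c ⊗[ℂ] V) (nMinus β) a b n
    (TensorProduct.mk ℂ (IrrHW₀ ν β lam l k c) V (hwVec₀ ν β lam l k c))

/-- The formula that defines `φₙ`:
`φₙ(x y z ⊗ v) = ψₙ(y) z ū ⊗ (x̃ ∘ v)` for `x ∈ U(g ⊗ t⁻¹ ℂ[t⁻¹])`, `y ∈ U(𝒱₋)`, `z ∈ U(𝔫₋)`. -/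
theorem phi_mul (a b : ℂ) (n : ℤ)
    (x : UniversalEnvelopingAlgebra ℂ (loopNeg g ν)) (y : UniversalEnvelopingAlgebra ℂ (virNeg g ν))
    (z : UniversalEnvelopingAlgebra ℂ (nMinus β)) (v : V) :
    phi ν β lam l k c V a b n
        ((inclLoop ν (nMinus β) x * inclVir ν (nMinus β) y * inclFin ν (nMinus β) z) ⊗ₜ v) =
      psi g ν a b n y • (actU (nMinus β) (IrrHW₀ ν β lam l k c) z (hwVec₀ ν β lam l k c) ⊗ₜ
        circ V (forget ν x) v) :=
  phiOf_mul ν V (nMinus β) a b n _ x y z v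

/-- `V` is the finite-dimensional irreducible `g`-module `L(μ)` with highest weight `μ`: there is a
nonzero vector of weight `μ` that is annihilated by the root spaces of the positive roots. -/
structure IsFinIrrHW (mu : Module.Dual ℂ H) : Prop where
  finiteDimensional : FiniteDimensional ℂ V
  irreducible : LieModule.IsIrreducible ℂ g V
  exists_highest : ∃ v : V, v ≠ 0 ∧ (∀ h : H, ⁅(h : g), v⁆ = mu h • v) ∧
    ∀ α : H.root, β.IsPos α → ∀ x ∈ rootSpace H α.1, ⁅x, v⁆ = 0

end Main

end AffineVirasoro

end

/-!
Write `M = L(λ, l, k, c)`, and give `M ⊗ V ⊗ ℂ[t, t⁻¹]` the grading by the exponent of `t`. Up to a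
scalar shift, `d₀` acts by the exponent, so every submodule is graded (`exists_tpow_mem`).

*Large exponents.* Every nonzero submodule `W` contains `M ⊗ V ⊗ t ^ N` for all large `N`. For large
`m`, the current `x(m)` annihilates any given vectors of `M` and so acts on `V` alone; by the density
theorem for the irreducible module `V`, the products of such operators separate the components of an
element of `M ⊗ V`, and `W` contains `w ⊗ V ⊗ t ^ N` for some `w ≠ 0` and all large `N`. The `w` with
this property form a submodule of `M`, which is everything as `M` is irreducible
(`eventually_tpow_hwVec_mem`, `tpow_mem_of_hwVec`).

*One step down.* Suppose that `W` contains all components with exponents larger than `n`. For a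
monomial `P` in `U(𝔏(g)₋)`, moving the factors `x(m)` and `dₘ` with `m < 0` one after the other from
`ū` to the other tensor factors, modulo `W`, turns `P ū ⊗ v ⊗ t ^ n` into `φₙ(P ⊗ v) ⊗ t ^ n`
(`tpow_rTensor_actHw_sub_mem`). If `P ū = 0`, this puts `φₙ(P ⊗ v) ⊗ t ^ n` into `W`. Hence, if
`φₙ(Ann(ū) ⊗ V)` is everything for all `n`, descending induction gives `W = ⊤`
(`isIrreducible_of_map_phi_eq_top`).

*Converse.* If the module is irreducible, it is generated by the components with exponents larger
than `n`, already under the operators `x(m)` and `dₘ` with `m < 0`. The coefficients of `t ^ n` that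
these operators produce lie in the image of `ker φₙ` under `P ⊗ v ↦ P ū ⊗ v`, by the recursion for
`φₙ` on monomials, so this image is all of `M ⊗ V` (`map_ker_phi_eq_top`). It follows that
`ker φₙ + Ann(ū) ⊗ V` is everything, and `φₙ` is surjective because `M₀ = U(𝔫₋) ū`
(`map_phi_eq_top`).

Two facts on `M` are needed: `ū ≠ 0`, and `M` is irreducible. The generator of the Verma
module is nonzero because it maps to the nonzero highest weight vector of a module constructed on
`U(𝔏(g)₋)` without the Poincaré–Birkhoff–Witt theorem (`exists_induced_module`). The proper
submodules of the Verma module lie in a common subspace that omits the generator, by the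
eigenvalues of an element `h + K d₀` (`exists_le_of_ne_top`).
-/

noncomputable section

namespace AffineVirasoro

attribute [local instance 100] LieRing.ofAssociativeRing

open LieAlgebra LieAlgebra.IsKilling Filter

/-! ### Inducing a character from a complement of a subalgebra -/

section Induced

variable {L : Type*} [LieRing L] [LieAlgebra ℂ L] (𝔫 : LieSubalgebra ℂ L)

local notation "ι" => UniversalEnvelopingAlgebra.ι ℂ

instance nontrivial_universalEnvelopingAlgebra : Nontrivial (UniversalEnvelopingAlgebra ℂ L) :=
  (UniversalEnvelopingAlgebra.lift ℂ (0 : L →ₗ⁅ℂ⁆ ℂ)).toRingHom.domain_nontrivial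

/-- The action of `𝔫` on `Hom(L, U(𝔫))` by `(y φ)(Z) = y φ(Z) + φ([Z, y])`. -/
def homAct : 𝔫 →ₗ⁅ℂ⁆ Module.End ℂ (L →ₗ[ℂ] UniversalEnvelopingAlgebra ℂ 𝔫) where
  toFun y := LinearMap.llcomp ℂ L _ _ (LinearMap.mulLeft ℂ (ι y)) -
    LinearMap.lcomp ℂ _ (LieModule.toEnd ℂ L L y)
  map_add' y y' := by
    ext φ Z
    simp [add_mul]
    abel
  map_smul' t y := by
    ext φ Z
    simp [smul_sub]
  map_lie' := by
    intro y y'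
    ext φ Z
    simp [LieRing.of_associative_ring_bracket, sub_mul, mul_sub, mul_assoc]
    abel

theorem homAct_apply (y : 𝔫) (φ : L →ₗ[ℂ] UniversalEnvelopingAlgebra ℂ 𝔫) (Z : L) :
    homAct 𝔫 y φ Z = ι y * φ Z + φ ⁅Z, (y : L)⁆ := by
  rw [← lie_skew, map_neg, ← sub_eq_add_neg]
  rfl

/-- The bilinear map `(Z, P) ↦ Z · P`, where `P ↦ (Z ↦ Z · P)` is the map of `𝔫`-modules from
`U(𝔫)` to `Hom(L, U(𝔫))` that takes the value `φ` at `1`. -/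
def inducedAct (φ : L →ₗ[ℂ] UniversalEnvelopingAlgebra ℂ 𝔫) :
    L →ₗ[ℂ] Module.End ℂ (UniversalEnvelopingAlgebra ℂ 𝔫) :=
  ((UniversalEnvelopingAlgebra.lift ℂ (homAct 𝔫)).toLinearMap.flip φ).flip

theorem inducedAct_one (φ : L →ₗ[ℂ] UniversalEnvelopingAlgebra ℂ 𝔫) (Z : L) :
    inducedAct 𝔫 φ Z 1 = φ Z := by
  simp [inducedAct]

theorem inducedAct_mul (φ : L →ₗ[ℂ] UniversalEnvelopingAlgebra ℂ 𝔫) (Z : L) (y : 𝔫)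
    (P : UniversalEnvelopingAlgebra ℂ 𝔫) :
    inducedAct 𝔫 φ Z (ι y * P) = ι y * inducedAct 𝔫 φ Z P + inducedAct 𝔫 φ ⁅Z, (y : L)⁆ P := by
  simp only [inducedAct, LinearMap.flip_apply, AlgHom.toLinearMap_apply, map_mul,
    Module.End.mul_apply, UniversalEnvelopingAlgebra.lift_ι_apply, homAct_apply]

theorem inducedAct_of_mem (φ : L →ₗ[ℂ] UniversalEnvelopingAlgebra ℂ 𝔫)
    (hφ : ∀ y : 𝔫, φ y = ι y) (y : 𝔫) (P : UniversalEnvelopingAlgebra ℂ 𝔫) :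
    inducedAct 𝔫 φ y P = ι y * P := by
  induction P using induction_mul generalizing y with
  | add X Y h h' => rw [map_add, h, h', mul_add]
  | smul t X h => rw [map_smul, h, mul_smul_comm]
  | one => rw [inducedAct_one, hφ, mul_one]
  | mul x X h =>
    rw [inducedAct_mul, h, ← LieSubalgebra.coe_bracket, h, LieHom.map_lie,
      LieRing.of_associative_ring_bracket, sub_mul, mul_assoc, mul_assoc, add_sub_cancel]

/-- If `S` spans a complement of `𝔫` on which `χ` behaves as a character of a subalgebra, then there
is an `L`-module structure on `U(𝔫)` for which every `Z ∈ S` acts on `1` by the scalar `χ Z`. This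
is the module induced from the character `χ`; no Poincaré–Birkhoff–Witt theorem is needed, as the
action of `L` on `U(𝔫)` is obtained from the universal property of `U(𝔫)`. -/
theorem exists_induced_module (π : L →ₗ[ℂ] 𝔫) (hπ : ∀ y : 𝔫, π y = y) (χ : L →ₗ[ℂ] ℂ)
    (hχ : ∀ y : 𝔫, χ y = 0) (S : Set L) (hS : ∀ Z, Z - π Z ∈ Submodule.span ℂ S)
    (hπS : ∀ Z ∈ S, π Z = 0) (hS2 : ∀ Z ∈ S, ∀ Z' ∈ S, π ⁅Z, Z'⁆ = 0 ∧ χ ⁅Z, Z'⁆ = 0) :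
    ∃ ρ : L →ₗ⁅ℂ⁆ Module.End ℂ (UniversalEnvelopingAlgebra ℂ 𝔫),
      ∀ Z ∈ S, ρ Z 1 = χ Z • 1 := by
  let φ : L →ₗ[ℂ] UniversalEnvelopingAlgebra ℂ 𝔫 :=
    (UniversalEnvelopingAlgebra.ι ℂ : 𝔫 →ₗ⁅ℂ⁆ _).toLinearMap ∘ₗ π +
      χ.smulRight (1 : UniversalEnvelopingAlgebra ℂ 𝔫)
  have φ_apply (Z : L) : φ Z = ι (π Z) + χ Z • 1 := rfl
  have hφ (y : 𝔫) : φ y = ι y := by rw [φ_apply, hπ, hχ, zero_smul, add_zero]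
  set T := inducedAct 𝔫 φ with hT
  have hmem (y : 𝔫) (P) : T y P = ι y * P := inducedAct_of_mem 𝔫 φ hφ y P
  have hmul (Z : L) (y : 𝔫) (P) : T Z (ι y * P) = ι y * T Z P + T ⁅Z, (y : L)⁆ P :=
    inducedAct_mul 𝔫 φ Z y P
  have left (y : 𝔫) (Z' : L) (P) : T ⁅(y : L), Z'⁆ P = T y (T Z' P) - T Z' (T y P) := by
    rw [hmem, hmem, hmul, ← lie_skew, map_neg, LinearMap.neg_apply]
    abel
  have one (Z Z' : L) : T ⁅Z, Z'⁆ 1 = T Z (T Z' 1) - T Z' (T Z 1) := by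
    have base (Z : L) (hZ : Z ∈ Submodule.span ℂ S) (Z' : L) (hZ' : Z' ∈ Submodule.span ℂ S) :
        T ⁅Z, Z'⁆ 1 = T Z (T Z' 1) - T Z' (T Z 1) := by
      induction hZ using Submodule.span_induction with
      | zero => simp
      | add X Y _ _ h h' =>
        simp only [add_lie, map_add, LinearMap.add_apply, h, h']
        abel
      | smul t X _ h => simp only [smul_lie, map_smul, LinearMap.smul_apply, h, smul_sub]
      | mem Z hZ =>
      induction hZ' using Submodule.span_induction with
      | zero => simp
      | add X Y _ _ h h' =>
        simp only [lie_add, map_add, LinearMap.add_apply, h, h']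
        abel
      | smul t X _ h => simp only [lie_smul, map_smul, LinearMap.smul_apply, h, smul_sub]
      | mem Z' hZ' =>
        simp only [hT, inducedAct_one]
        rw [φ_apply, φ_apply Z, φ_apply Z', (hS2 Z hZ Z' hZ').1, (hS2 Z hZ Z' hZ').2, hπS Z hZ,
          hπS Z' hZ']
        simp only [map_zero, zero_add, map_smul, inducedAct_one, φ_apply, hπS Z hZ, hπS Z' hZ',
          zero_smul, smul_smul, mul_comm, sub_self]
    have h1 := base _ (hS Z) _ (hS Z')
    have h2 := left (π Z) Z' 1
    have h3 := left (π Z') (Z - π Z) 1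
    rw [← lie_skew] at h3
    have e : ⁅Z, Z'⁆ = ⁅Z - (π Z : L), Z' - (π Z' : L)⁆ + ⁅(π Z : L), Z'⁆ +
        ⁅Z - (π Z : L), (π Z' : L)⁆ := by
      simp only [lie_sub, sub_lie]
      abel
    rw [map_neg, LinearMap.neg_apply] at h3
    rw [e, map_add, map_add, LinearMap.add_apply, LinearMap.add_apply, h1, h2, neg_eq_iff_eq_neg.mp h3]
    simp only [map_sub, LinearMap.sub_apply]
    abel
  refine ⟨{ T with map_lie' := ?_ }, fun Z hZ => ?_⟩
  · intro Z Z'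
    refine LinearMap.ext fun P => ?_
    change T ⁅Z, Z'⁆ P = T Z (T Z' P) - T Z' (T Z P)
    induction P using induction_mul generalizing Z Z' with
    | add X Y h h' =>
      simp only [map_add, h, h']
      abel
    | smul t X h => simp only [map_smul, h, smul_sub]
    | one => exact one Z Z'
    | mul y X h =>
      simp only [hmul, map_add, h, mul_sub, lie_lie]
      rw [← lie_skew Z, ← lie_skew Z']
      simp only [map_neg, LinearMap.neg_apply, map_sub, LinearMap.sub_apply, h]
      abel
  · change T Z 1 = _
    rw [hT, inducedAct_one, φ_apply, hπS Z hZ, map_zero, zero_add]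

end Induced

/-! ### Eigenvectors in invariant subspaces -/

section Eigen

variable {E : Type*} [AddCommGroup E] [Module ℂ E]

/-- A sum of eigenvectors with eigenvalues other than `τ` is annihilated by a polynomial in the
operator that does not vanish at `τ`. -/
theorem exists_aeval_eq_zero_of_mem_iSup_eigenspace (f : Module.End ℂ E) (τ : ℂ) (S : Set ℂ)
    (hS : τ ∉ S) (z : E) (hz : z ∈ ⨆ s ∈ S, f.eigenspace s) :
    ∃ q : Polynomial ℂ, q.eval τ ≠ 0 ∧ Polynomial.aeval f q z = 0 := by
  induction hz using Submodule.iSup_induction' with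
  | zero => exact ⟨1, by simp, by simp⟩
  | add x y _ _ hx hy =>
    obtain ⟨q, hq, hqx⟩ := hx
    obtain ⟨r, hr, hry⟩ := hy
    refine ⟨q * r, by simp [hq, hr], ?_⟩
    have e : Polynomial.aeval f (q * r) x = 0 := by
      rw [mul_comm, map_mul, Module.End.mul_apply, hqx, map_zero]
    rw [map_add, e, map_mul, Module.End.mul_apply, hry, map_zero, add_zero]
  | mem s x hx =>
    by_cases hs : s ∈ S
    · rw [iSup_pos hs, Module.End.mem_eigenspace_iff] at hx
      refine ⟨Polynomial.X - Polynomial.C s, ?_, by simp [hx]⟩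
      simp only [Polynomial.eval_sub, Polynomial.eval_X, Polynomial.eval_C, ne_eq, sub_eq_zero]
      rintro rfl
      exact hS hs
    · rw [iSup_neg hs, Submodule.mem_bot] at hx
      exact ⟨1, by simp, by simp [hx]⟩

/-- If an invariant subspace contains `y + z`, where `y` satisfies `f y = τ y` and `z` is a sum of
eigenvectors with eigenvalues other than `τ`, then it contains `y`. -/
theorem mem_of_add_mem_of_mem_iSup_eigenspace (f : Module.End ℂ E) (p : Submodule ℂ E)
    (hp : ∀ x ∈ p, f x ∈ p) (τ : ℂ) (S : Set ℂ) (hS : τ ∉ S) (y z : E) (hy : f y = τ • y)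
    (hz : z ∈ ⨆ s ∈ S, f.eigenspace s) (hyz : y + z ∈ p) : y ∈ p := by
  obtain ⟨q, hq, hqz⟩ := exists_aeval_eq_zero_of_mem_iSup_eigenspace f τ S hS z hz
  have h : Polynomial.aeval f q (y + z) ∈ p := by
    have hpow (n : ℕ) : ∀ x ∈ p, (f ^ n) x ∈ p := by
      induction n with
      | zero => exact fun x hx => hx
      | succ n ih => exact fun x hx => by rw [pow_succ]; exact ih _ (hp x hx)
    rw [Polynomial.aeval_eq_sum_range, LinearMap.sum_apply]
    exact Submodule.sum_mem _ fun n _ => Submodule.smul_mem _ _ (hpow n _ hyz)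
  rw [map_add, hqz, add_zero, Module.End.aeval_apply_of_mem_apply_eq_smul hy] at h
  exact (Submodule.smul_mem_iff _ hq).mp h

end Eigen

/-! ### The density theorem -/

section Density

variable {g : Type*} [LieRing g] [LieAlgebra ℂ g]
variable (V : Type*) [AddCommGroup V] [Module ℂ V] [LieRingModule g V] [LieModule ℂ g V]

/-- On a finite-dimensional irreducible module, every endomorphism comes from the enveloping
algebra. -/
theorem actU_surjective [FiniteDimensional ℂ V] [LieModule.IsIrreducible ℂ g V] :
    Function.Surjective (actU g V) := by
  let _ : Module (UniversalEnvelopingAlgebra ℂ g) V := Module.compHom V (actU g V).toRingHom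
  have smul_def (P : UniversalEnvelopingAlgebra ℂ g) (v : V) : P • v = actU g V P v := rfl
  have : IsScalarTower ℂ (UniversalEnvelopingAlgebra ℂ g) V := ⟨fun t P v => by
    rw [smul_def, smul_def, map_smul, LinearMap.smul_apply]⟩
  have : Nontrivial V :=
    (LieSubmodule.nontrivial_iff ℂ g V).mp (inferInstance : Nontrivial (LieSubmodule ℂ g V))
  have : IsSimpleModule (UniversalEnvelopingAlgebra ℂ g) V :=
    { exists_pair_ne := ⟨⊥, ⊤, bot_ne_top⟩
      eq_bot_or_eq_top := fun N => by
        let N' : LieSubmodule ℂ g V :=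
          { N.restrictScalars ℂ with
            lie_mem := fun {x v} hv => by
              have := N.smul_mem (UniversalEnvelopingAlgebra.ι ℂ x) hv
              rwa [smul_def, actU_ι] at this }
        refine (eq_bot_or_eq_top N').imp (fun h => ?_) (fun h => ?_)
        · exact (Submodule.eq_bot_iff _).mpr fun v hv =>
            (LieSubmodule.mem_bot v).mp (h ▸ (show v ∈ N' from hv))
        · exact Submodule.eq_top_iff'.mpr fun v =>
            (show v ∈ N' from h ▸ LieSubmodule.mem_top v) }
  have hb := IsSimpleModule.algebraMap_end_bijective_of_isAlgClosed
    (A := UniversalEnvelopingAlgebra ℂ g) (V := V) ℂ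
  intro f
  let F : Module.End (Module.End (UniversalEnvelopingAlgebra ℂ g) V) V :=
    { f with
      map_smul' := fun r v => by
        obtain ⟨t, rfl⟩ := hb.2 r
        simp }
  classical
  let B := Module.finBasis ℂ V
  obtain ⟨P, hP⟩ := jacobson_density F (Finset.univ.image B)
  refine ⟨P, B.ext fun i => ?_⟩
  exact (hP (B i) (by simp)).symm

/-- On a finite-dimensional irreducible module on which `g` acts nontrivially, the products
`x₁ ⋯ x_s` with `s ≥ 1` and `xᵢ ∈ g` span all endomorphisms. -/
theorem eq_top_of_forall_toEnd_mul_mem [FiniteDimensional ℂ V] [LieModule.IsIrreducible ℂ g V]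
    (hV : ∃ (x : g) (v : V), ⁅x, v⁆ ≠ 0) (G : Submodule ℂ (Module.End ℂ V))
    (h1 : ∀ x : g, LieModule.toEnd ℂ g V x ∈ G)
    (h2 : ∀ x : g, ∀ T ∈ G, LieModule.toEnd ℂ g V x * T ∈ G) : G = ⊤ := by
  have act_mul (x : g) (P : UniversalEnvelopingAlgebra ℂ g) :
      actU g V (UniversalEnvelopingAlgebra.ι ℂ x * P) = LieModule.toEnd ℂ g V x * actU g V P := by
    rw [map_mul]; congr 1; ext v; exact actU_ι x v
  have h3 (x : g) (S : Module.End ℂ V) : LieModule.toEnd ℂ g V x * S ∈ G := by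
    obtain ⟨Q, rfl⟩ := actU_surjective (g := g) V S
    induction Q using induction_mul generalizing x with
    | add X Y h h' => rw [map_add, mul_add]; exact G.add_mem (h x) (h' x)
    | smul t X h => rw [map_smul, mul_smul_comm]; exact G.smul_mem t (h x)
    | one => rw [map_one, mul_one]; exact h1 x
    | mul y X h => rw [act_mul]; exact h2 x _ (h y)
  have h4 (R : Module.End ℂ V) (x : g) (S : Module.End ℂ V) :
      R * (LieModule.toEnd ℂ g V x * S) ∈ G := by
    obtain ⟨Q, rfl⟩ := actU_surjective (g := g) V R
    induction Q using induction_mul with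
    | add X Y h h' => rw [map_add, add_mul]; exact G.add_mem h h'
    | smul t X h => rw [map_smul, smul_mul_assoc]; exact G.smul_mem t h
    | one => rw [map_one, one_mul]; exact h3 x S
    | mul y X h => rw [act_mul, mul_assoc]; exact h2 y _ h
  obtain ⟨x, v, hxv⟩ := hV
  obtain ⟨f, hf⟩ : ∃ f : Module.Dual ℂ V, f ⁅x, v⁆ ≠ 0 := by
    by_contra! h
    exact hxv ((Module.forall_dual_apply_eq_zero_iff ℂ _).mp h)
  rw [Submodule.eq_top_iff']
  intro T
  let B := Module.finBasis ℂ V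
  -- `T` is a sum of operators of rank one, each of which factors through `v ↦ ⁅x, v⁆`.
  have e : T = ∑ j, (f.smulRight ((f ⁅x, v⁆)⁻¹ • T (B j))) *
      (LieModule.toEnd ℂ g V x * (B.coord j).smulRight v) := by
    refine B.ext fun i => ?_
    rw [LinearMap.sum_apply, Finset.sum_eq_single i]
    · simp [smul_smul, hf]
    · intro j _ hj
      simp [hj.symm]
    · simp
  rw [e]
  exact Submodule.sum_mem _ fun j _ => h4 _ _ _

end Density

/-! ### The triangular decomposition of `g` -/

section TriangularDecomposition

variable {g : Type*} [LieRing g] [LieAlgebra ℂ g] [FiniteDimensional ℂ g] [IsSimple ℂ g]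
variable {H : LieSubalgebra ℂ g} [H.IsCartanSubalgebra]

/-- A subspace of `g` that contains the Cartan subalgebra and all root spaces is everything. -/
theorem mem_of_rootSpace_le (A : Submodule ℂ g) (hH : ∀ h : H, (h : g) ∈ A)
    (hroot : ∀ α : H.root, ∀ x ∈ rootSpace H α.1, x ∈ A) (x : g) : x ∈ A := by
  have hx : x ∈ (H.toLieSubmodule ⊔
      ⨆ α : LieModule.Weight ℂ H g, ⨆ (_ : α.IsNonZero), rootSpace H α).toSubmodule := by
    rw [cartan_sup_iSup_rootSpace_eq_top]
    trivial
  rw [LieSubmodule.sup_toSubmodule, LieSubmodule.iSup_toSubmodule] at hx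
  simp only [LieSubmodule.iSup_toSubmodule] at hx
  refine (sup_le ?_ (iSup₂_le fun α hα => ?_) : _ ≤ A) hx
  · exact fun h hh => hH ⟨h, hh⟩
  · exact fun y hy => hroot ⟨α, by simpa using hα⟩ y hy

/-- Linear maps on the weight spaces of `g` glue to a linear map on `g`. -/
theorem exists_linearMap_eq_on_rootSpace {N : Type*} [AddCommGroup N] [Module ℂ N]
    (f : (H → ℂ) → g →ₗ[ℂ] N) :
    ∃ T : g →ₗ[ℂ] N, ∀ χ : H → ℂ, ∀ x ∈ rootSpace H χ, T x = f χ x := by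
  classical
  let A : (H → ℂ) → Submodule ℂ g := fun χ => (rootSpace H χ).toSubmodule
  have hint : DirectSum.IsInternal A := by
    refine DirectSum.isInternal_submodule_of_iSupIndep_of_iSup_eq_top ?_ ?_
    · exact (LieSubmodule.iSupIndep_toSubmodule).mpr (LieModule.iSupIndep_genWeightSpace ℂ H g)
    · rw [← LieSubmodule.iSup_toSubmodule, LieModule.iSup_genWeightSpace_eq_top ℂ H g,
        LieSubmodule.top_toSubmodule]
  let e := LinearEquiv.ofBijective (DirectSum.coeLinearMap A) hint
  refine ⟨DirectSum.toModule ℂ _ N (fun χ => f χ ∘ₗ (A χ).subtype) ∘ₗ e.symm.toLinearMap,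
    fun χ x hx => ?_⟩
  have : e.symm x = DirectSum.lof ℂ _ (fun χ => A χ) χ ⟨x, hx⟩ := by
    rw [LinearEquiv.symm_apply_eq]
    exact (DirectSum.coeLinearMap_lof A χ ⟨x, hx⟩).symm
  rw [LinearMap.comp_apply, LinearEquiv.coe_coe, this, DirectSum.toModule_lof]
  rfl

theorem mem_rootSpace_zero (h : H) : (h : g) ∈ rootSpace H (0 : H → ℂ) := by
  rw [rootSpace_zero_eq]; exact h.2

theorem root_coe_ne_zero (α : H.root) : (α.1 : H → ℂ) ≠ 0 :=
  H.isNonZero_coe_root α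

/-- A projection of `g` to `𝔫₋` that vanishes on the Cartan subalgebra and on the root spaces of the
positive roots. -/
theorem exists_proj_nMinus (b : (rootSystem H).Base) :
    ∃ p : g →ₗ[ℂ] nMinus b, (∀ y : nMinus b, p y = y) ∧ (∀ h : H, p h = 0) ∧
      ∀ α : H.root, b.IsPos α → ∀ x ∈ rootSpace H α.1, p x = 0 := by
  classical
  obtain ⟨T, hT⟩ := exists_linearMap_eq_on_rootSpace (H := H) (N := g) fun χ =>
    if ∃ α : H.root, ¬ b.IsPos α ∧ (α.1 : H → ℂ) = χ then LinearMap.id else 0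
  have hroot (α : H.root) (x : g) (hx : x ∈ rootSpace H α.1) :
      T x = if b.IsPos α then 0 else x := by
    rw [hT α.1 x hx]
    by_cases hα : b.IsPos α
    · rw [if_pos hα, if_neg, LinearMap.zero_apply]
      rintro ⟨β, hβ, e⟩
      obtain rfl : β = α := Subtype.ext (DFunLike.coe_injective e)
      exact hβ hα
    · rw [if_neg hα, if_pos ⟨α, hα, rfl⟩, LinearMap.id_apply]
  have hH (h : H) : T h = 0 := by
    rw [hT 0 _ (mem_rootSpace_zero h), if_neg, LinearMap.zero_apply]
    rintro ⟨α, -, e⟩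
    exact root_coe_ne_zero α e
  have hmem (x : g) : T x ∈ nMinus b := by
    refine mem_of_rootSpace_le (H := H) ((nMinus b).toSubmodule.comap T) (fun h => ?_)
      (fun α x hx => ?_) x
    · rw [Submodule.mem_comap, hH]
      exact zero_mem _
    · rw [Submodule.mem_comap, hroot α x hx]
      split_ifs with hα
      · exact zero_mem _
      · exact subset_spanSubalgebra ⟨α, hα, hx⟩
  refine ⟨T.codRestrict (nMinus b).toSubmodule hmem, fun y => ?_, fun h => ?_, fun α hα x hx => ?_⟩
  · apply Subtype.ext
    change T y = y
    have hy := mem_spanSubalgebra.mp y.2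
    generalize (y : g) = y at hy
    induction hy using Submodule.span_induction with
    | zero => simp
    | add x y _ _ h h' => rw [map_add, h, h']
    | smul t x _ h => rw [map_smul, h]
    | mem x hx =>
      obtain ⟨α, hα, hx⟩ := hx
      rw [hroot α x hx, if_neg hα]
  · exact Subtype.ext (hH h)
  · apply Subtype.ext
    change T x = 0
    rw [hroot α x hx, if_pos hα]

variable (H) in
/-- The extension of a linear form on the Cartan subalgebra by zero on the root spaces. -/
theorem exists_extend_dual (lam : Module.Dual ℂ H) :
    ∃ Λ : g →ₗ[ℂ] ℂ, (∀ h : H, Λ h = lam h) ∧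
      ∀ α : H.root, ∀ x ∈ rootSpace H α.1, Λ x = 0 := by
  classical
  obtain ⟨Λ, hΛ⟩ := LinearMap.exists_extend (p := H.toSubmodule) lam
  obtain ⟨T, hT⟩ := exists_linearMap_eq_on_rootSpace (H := H) (N := ℂ) fun χ =>
    if χ = 0 then Λ else 0
  refine ⟨T, fun h => ?_, fun α x hx => ?_⟩
  · rw [hT 0 _ (mem_rootSpace_zero h), if_pos rfl, ← hΛ]
    rfl
  · rw [hT α.1 x hx, if_neg (root_coe_ne_zero α), LinearMap.zero_apply]

/-- An element of the Cartan subalgebra at which every root takes its height as value. -/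
theorem exists_root_apply_eq_height (b : (rootSystem H).Base) :
    ∃ h : H, ∀ α : H.root, α.1 h = (b.height α : ℂ) := by
  let e := Module.evalEquiv ℂ H
  let φ : Module.Dual ℂ (Module.Dual ℂ H) := b.toWeightBasis.constr ℂ fun _ => (1 : ℂ)
  have hφ (i : H.root) (hi : i ∈ b.support) : φ ((rootSystem H).root i) = 1 := by
    have := b.toWeightBasis.constr_basis ℂ (fun _ => (1 : ℂ)) ⟨i, hi⟩
    simpa [φ] using this
  refine ⟨e.symm φ, fun α => ?_⟩
  obtain ⟨f, -, -, hf⟩ := b.exists_root_eq_sum_int α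
  rw [b.height_eq_sum hf]
  have h1 : α.1 (e.symm φ) = φ ((rootSystem H).root α) := by
    have : e (e.symm φ) = φ := e.apply_symm_apply φ
    conv_rhs => rw [← this]
    rfl
  rw [h1, hf, map_sum, Int.cast_sum]
  refine Finset.sum_congr rfl fun j hj => ?_
  rw [map_zsmul, hφ j hj]
  simp

theorem lie_rootSpace (α : H.root) (x : g) (hx : x ∈ rootSpace H α.1) (h : H) :
    ⁅(h : g), x⁆ = α.1 h • x :=
  lie_eq_smul_of_mem_rootSpace hx h

end TriangularDecomposition

/-! ### The Borel subalgebra of the affine-Virasoro algebra -/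

section Character

variable {g : Type*} [LieRing g] [LieAlgebra ℂ g]

theorem hom_eq_cur_add_vir {ν : ℂ} (m : ℤ) (x : g) (r : ℂ) :
    hom ν m (x, r) = cur ν x m + r • vir g ν m := by
  rw [cur, vir, ← map_smul, ← map_add]
  congr 1
  ext <;> simp

theorem cen_eq {ν : ℂ} (z : ℂ × ℂ) : (cen ν z : AffVir g ν) = z.1 • kk g ν + z.2 • cc g ν := by
  rw [kk, cc, ← map_smul, ← map_smul, ← map_add]
  simp

/-- The linear form on the affine-Virasoro algebra that restricts to the character of
`ℋ ⊕ 𝔏(g)₊`, when `Λ` extends the weight of the highest weight vector. -/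
def hwChar (ν : ℂ) (Λ : g →ₗ[ℂ] ℂ) (l k c : ℂ) : AffVir g ν →ₗ[ℂ] ℂ :=
  (Λ.coprod (l • LinearMap.id)) ∘ₗ Finsupp.lapply 0 ∘ₗ loopPart +
    ((k • LinearMap.id).coprod (c • LinearMap.id)) ∘ₗ cenPart

variable {ν : ℂ} {Λ : g →ₗ[ℂ] ℂ} {l k c : ℂ}

theorem hwChar_cen (z : ℂ × ℂ) : hwChar ν Λ l k c (cen ν z) = k * z.1 + c * z.2 := by
  simp [hwChar]

theorem hwChar_hom_of_ne {m : ℤ} (hm : m ≠ 0) (q : g × ℂ) :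
    hwChar ν Λ l k c (hom ν m q) = 0 := by
  simp [hwChar, hm]

theorem hwChar_hom_zero (q : g × ℂ) : hwChar ν Λ l k c (hom ν 0 q) = Λ q.1 + l * q.2 := by
  simp [hwChar]

end Character

section Borel

variable {g : Type*} [LieRing g] [LieAlgebra ℂ g] [FiniteDimensional ℂ g] [IsSimple ℂ g]
variable {H : LieSubalgebra ℂ g} [H.IsCartanSubalgebra]

theorem pos_lie_pos (b : (rootSystem H).Base) (α β : H.root) (hα : b.IsPos α) (hβ : b.IsPos β)
    (x y : g) (hx : x ∈ rootSpace H α.1) (hy : y ∈ rootSpace H β.1) :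
    ⁅x, y⁆ = 0 ∨ ∃ γ : H.root, b.IsPos γ ∧ ⁅x, y⁆ ∈ rootSpace H γ.1 := by
  have hxy : ⁅x, y⁆ ∈ rootSpace H (α.1 + β.1 : H → ℂ) :=
    LieAlgebra.lie_mem_genWeightSpace_of_mem_genWeightSpace hx hy
  refine or_iff_not_imp_left.mpr fun h0 => ?_
  have hne : rootSpace H (α.1 + β.1 : H → ℂ) ≠ ⊥ := fun h => h0 (by
    rw [h] at hxy; exact (LieSubmodule.mem_bot _).mp hxy)
  let γ : LieModule.Weight ℂ H g := ⟨_, hne⟩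
  have hγ : γ.IsNonZero := by
    intro hz
    have hz : (α.1 + β.1 : H → ℂ) = 0 := hz
    let _ := (rootSystem H).indexNeg
    have e : (rootSystem H).root β = (rootSystem H).root ((rootSystem H).reflectionPerm α α) := by
      rw [RootPairing.root_reflectionPerm, RootPairing.reflection_apply_self]
      ext h
      have := congrFun hz h
      simp only [Pi.add_apply, Pi.zero_apply] at this
      simpa using eq_neg_of_add_eq_zero_right this
    have e' : β = -α := (rootSystem H).root.injective e
    rw [e', RootPairing.Base.IsPos.neg_iff_not] at hβ
    exact hβ hα
  let k : H.root := ⟨γ, by simpa using hγ⟩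
  refine ⟨k, ?_, hxy⟩
  have hk : (rootSystem H).root k = (rootSystem H).root α + (rootSystem H).root β := by
    ext h; simp [k, γ]
  rw [RootPairing.Base.isPos_iff] at hα hβ ⊢
  rw [b.height_add hk]
  omega

/-- The elements of the Cartan subalgebra of `g` and of the root spaces of the positive roots. -/
def borelSet (b : (rootSystem H).Base) : Set g :=
  {x | (∃ h : H, x = h) ∨ ∃ α : H.root, b.IsPos α ∧ x ∈ rootSpace H α.1}

theorem zero_mem_borelSet (b : (rootSystem H).Base) : (0 : g) ∈ borelSet b :=
  Or.inl ⟨0, rfl⟩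

theorem lie_borelSet (b : (rootSystem H).Base) (x y : g) (hx : x ∈ borelSet b)
    (hy : y ∈ borelSet b) :
    ⁅x, y⁆ = 0 ∨ ∃ α : H.root, b.IsPos α ∧ ⁅x, y⁆ ∈ rootSpace H α.1 := by
  obtain ⟨h, rfl⟩ | ⟨α, hα, hx⟩ := hx <;> obtain ⟨h', rfl⟩ | ⟨β, hβ, hy⟩ := hy
  · left
    rw [← LieSubalgebra.coe_bracket, trivial_lie_zero]
    rfl
  · right
    refine ⟨β, hβ, ?_⟩
    rw [lie_rootSpace β y hy]
    exact Submodule.smul_mem _ _ hy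
  · right
    refine ⟨α, hα, ?_⟩
    rw [← lie_skew, lie_rootSpace α x hx]
    exact neg_mem (Submodule.smul_mem _ _ hx)
  · exact pos_lie_pos b α β hα hβ x y hx hy

/-- A spanning set of `ℋ ⊕ 𝔏(g)₊`, where `ℋ` is spanned by the Cartan subalgebra of `g`, `d₀`, `𝐤`
and `𝐜`. -/
def hwSet (ν : ℂ) (b : (rootSystem H).Base) : Set (AffVir g ν) :=
  {Z | (∃ z, Z = cen ν z) ∨ (∃ m : ℤ, 0 < m ∧ ∃ q, Z = hom ν m q) ∨
    ∃ x ∈ borelSet b, ∃ r, Z = hom ν 0 (x, r)}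

/-- The projection of the affine-Virasoro algebra to `𝔏(g)₋` induced by a projection `p` of `g` to
`𝔫₋`. -/
def negProj (ν : ℂ) {b : (rootSystem H).Base} (p : g →ₗ[ℂ] nMinus b) :
    AffVir g ν →ₗ[ℂ] AffVir g ν :=
  ofLoop ν ∘ₗ (Finsupp.lsum ℂ fun m : ℤ =>
    if m < 0 then Finsupp.lsingle m
    else if m = 0 then Finsupp.lsingle 0 ∘ₗ LinearMap.inl ℂ g ℂ ∘ₗ (nMinus b).toSubmodule.subtype ∘ₗ
      p ∘ₗ LinearMap.fst ℂ g ℂ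
    else 0) ∘ₗ loopPart

variable {ν : ℂ} {b : (rootSystem H).Base} {p : g →ₗ[ℂ] nMinus b} {Λ : g →ₗ[ℂ] ℂ} {l k c : ℂ}

theorem negProj_cen (z : ℂ × ℂ) : negProj ν p (cen ν z) = 0 := by
  simp [negProj]

theorem negProj_hom_of_neg {m : ℤ} (hm : m < 0) (q : g × ℂ) :
    negProj ν p (hom ν m q) = hom ν m q := by
  simp [negProj, hm, hom]

theorem negProj_hom_of_pos {m : ℤ} (hm : 0 < m) (q : g × ℂ) : negProj ν p (hom ν m q) = 0 := by
  simp [negProj, hm.not_gt, hm.ne']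

theorem negProj_hom_zero (q : g × ℂ) : negProj ν p (hom ν 0 q) = cur ν (p q.1 : g) 0 := by
  simp [negProj, cur, hom]

theorem negProj_mem (Z : AffVir g ν) : negProj ν p Z ∈ affMinus ν (nMinus b) := by
  induction Z using induction with
  | add X Y h h' => rw [map_add]; exact add_mem h h'
  | cen z => rw [negProj_cen]; exact zero_mem _
  | hom m q =>
    rcases lt_trichotomy m 0 with hm | rfl | hm
    · rw [negProj_hom_of_neg hm]
      exact subset_spanSubalgebra (Or.inl ⟨m, hm, q, rfl⟩)
    · rw [negProj_hom_zero]
      exact subset_spanSubalgebra (Or.inr ⟨_, (p q.1).2, rfl⟩)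
    · rw [negProj_hom_of_pos hm]
      exact zero_mem _

theorem sub_negProj_mem_span (hpH : ∀ h : H, p h = 0)
    (hpos : ∀ α : H.root, b.IsPos α → ∀ x ∈ rootSpace H α.1, p x = 0)
    (hp : ∀ y : nMinus b, p y = y) (Z : AffVir g ν) :
    Z - negProj ν p Z ∈ Submodule.span ℂ (hwSet ν b) := by
  induction Z using induction with
  | add X Y h h' =>
    rw [map_add, add_sub_add_comm]
    exact add_mem h h'
  | cen z =>
    rw [negProj_cen, sub_zero]
    exact Submodule.subset_span (Or.inl ⟨z, rfl⟩)
  | hom m q =>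
    rcases lt_trichotomy m 0 with hm | rfl | hm
    · rw [negProj_hom_of_neg hm, sub_self]
      exact zero_mem _
    · obtain ⟨x, r⟩ := q
      rw [negProj_hom_zero, hom_eq_cur_add_vir, add_sub_right_comm]
      refine add_mem ?_ (Submodule.smul_mem _ _ (Submodule.subset_span
        (Or.inr (Or.inr ⟨0, zero_mem_borelSet b, 1, rfl⟩))))
      let T : g →ₗ[ℂ] AffVir g ν := hom ν 0 ∘ₗ LinearMap.inl ℂ g ℂ
      refine mem_of_rootSpace_le (H := H)
        ((Submodule.span ℂ (hwSet ν b)).comap (T - T ∘ₗ (nMinus b).toSubmodule.subtype ∘ₗ p))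
        (fun h => ?_) (fun α x hx => ?_) x
      · rw [Submodule.mem_comap]
        simp only [LinearMap.sub_apply, LinearMap.comp_apply, hpH, map_zero, sub_zero]
        exact Submodule.subset_span (Or.inr (Or.inr ⟨h, Or.inl ⟨h, rfl⟩, 0, rfl⟩))
      · rw [Submodule.mem_comap]
        by_cases hα : b.IsPos α
        · simp only [LinearMap.sub_apply, LinearMap.comp_apply, hpos α hα x hx, map_zero,
            sub_zero]
          exact Submodule.subset_span (Or.inr (Or.inr ⟨x, Or.inr ⟨α, hα, hx⟩, 0, rfl⟩))
        · have hxn : x ∈ nMinus b := subset_spanSubalgebra ⟨α, hα, hx⟩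
          have : p x = ⟨x, hxn⟩ := hp ⟨x, hxn⟩
          simp only [LinearMap.sub_apply, LinearMap.comp_apply, this]
          simp
    · rw [negProj_hom_of_pos hm, sub_zero]
      exact Submodule.subset_span (Or.inr (Or.inl ⟨m, hm, q, rfl⟩))

theorem negProj_eq_zero_of_mem_hwSet (hpH : ∀ h : H, p h = 0)
    (hpos : ∀ α : H.root, b.IsPos α → ∀ x ∈ rootSpace H α.1, p x = 0) (Z : AffVir g ν)
    (hZ : Z ∈ hwSet ν b) : negProj ν p Z = 0 := by
  obtain ⟨z, rfl⟩ | ⟨m, hm, q, rfl⟩ | ⟨x, hx, r, rfl⟩ := hZ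
  · exact negProj_cen z
  · exact negProj_hom_of_pos hm q
  · have : p x = 0 := by
      obtain ⟨h, rfl⟩ | ⟨α, hα, hx⟩ := hx
      · exact hpH h
      · exact hpos α hα x hx
    rw [negProj_hom_zero, this]
    exact map_zero _

theorem lie_hwSet (hpos : ∀ α : H.root, b.IsPos α → ∀ x ∈ rootSpace H α.1, p x = 0)
    (hΛ : ∀ α : H.root, ∀ x ∈ rootSpace H α.1, Λ x = 0) (Z : AffVir g ν)
    (hZ : Z ∈ hwSet ν b) (Z' : AffVir g ν) (hZ' : Z' ∈ hwSet ν b) :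
    negProj ν p ⁅Z, Z'⁆ = 0 ∧ hwChar ν Λ l k c ⁅Z, Z'⁆ = 0 := by
  obtain ⟨z, rfl⟩ | ⟨m, hm, q, rfl⟩ | ⟨x, hx, r, rfl⟩ := hZ
  · simp [cen_bracket]
  · obtain ⟨z', rfl⟩ | ⟨m', hm', q', rfl⟩ | ⟨y, hy, s, rfl⟩ := hZ'
    · simp [bracket_cen]
    all_goals
      rw [hom_lie_of_ne (by omega)]
      exact ⟨negProj_hom_of_pos (by omega) _, hwChar_hom_of_ne (by omega) _⟩
  obtain ⟨z', rfl⟩ | ⟨m', hm', q', rfl⟩ | ⟨y, hy, s, rfl⟩ := hZ'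
  · simp [bracket_cen]
  · rw [hom_lie_of_ne (by omega)]
    exact ⟨negProj_hom_of_pos (by omega) _, hwChar_hom_of_ne (by omega) _⟩
  have e : ⁅hom ν 0 (x, r), hom ν 0 (y, s)⁆ = hom ν 0 (⁅x, y⁆, 0) := by
    rw [hom_bracket, homBracket_apply]
    simp only [Int.cast_zero, zero_mul, zero_smul, add_zero, sub_zero, sub_self, ite_self, ne_eq,
      zero_div, OfNat.ofNat_ne_zero, not_false_eq_true, zero_pow]
    exact (congrArg _ (map_zero (cen (g := g) ν))).trans (add_zero _)
  rw [e, negProj_hom_zero, hwChar_hom_zero]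
  have h : p ⁅x, y⁆ = 0 ∧ Λ ⁅x, y⁆ = 0 := by
    obtain h0 | ⟨α, hα, hxy⟩ := lie_borelSet b x y hx hy
    · rw [h0, map_zero, map_zero]
      exact ⟨rfl, rfl⟩
    · exact ⟨hpos α hα _ hxy, hΛ α _ hxy⟩
  simp only [h]
  exact ⟨map_zero _, by simp⟩

variable (ν b) in
/-- There is a representation of the affine-Virasoro algebra with a highest weight vector of any
given weight. -/
theorem exists_highest_weight_module (Λ : g →ₗ[ℂ] ℂ)
    (hΛ : ∀ α : H.root, ∀ x ∈ rootSpace H α.1, Λ x = 0) (l k c : ℂ) :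
    ∃ ρ : AffVir g ν →ₗ⁅ℂ⁆ Module.End ℂ (UniversalEnvelopingAlgebra ℂ (affMinus ν (nMinus b))),
      ∀ Z ∈ hwSet ν b, ρ Z 1 = hwChar ν Λ l k c Z • 1 := by
  obtain ⟨p, hp, hpH, hpos⟩ := exists_proj_nMinus b
  have hneg (y : affMinus ν (nMinus b)) : negProj ν p y = y := by
    have hy := mem_spanSubalgebra.mp y.2
    generalize (y : AffVir g ν) = y at hy
    induction hy using Submodule.span_induction with
    | zero => simp
    | add x y _ _ h h' => rw [map_add, h, h']
    | smul t x _ h => rw [map_smul, h]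
    | mem x hx =>
      obtain ⟨m, hm, q, rfl⟩ | ⟨x, hx, rfl⟩ := hx
      · exact negProj_hom_of_neg hm q
      · rw [cur, negProj_hom_zero]
        have : p x = ⟨x, hx⟩ := hp ⟨x, hx⟩
        simp [this, cur]
  have hneg' (y : affMinus ν (nMinus b)) : hwChar ν Λ l k c (y : AffVir g ν) = 0 := by
    have hy := mem_spanSubalgebra.mp y.2
    generalize (y : AffVir g ν) = y at hy
    induction hy using Submodule.span_induction with
    | zero => simp
    | add x y _ _ h h' => rw [map_add, h, h', add_zero]
    | smul t x _ h => rw [map_smul, h, smul_zero]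
    | mem x hx =>
      obtain ⟨m, hm, q, rfl⟩ | ⟨x, hx, rfl⟩ := hx
      · exact hwChar_hom_of_ne hm.ne q
      · rw [cur, hwChar_hom_zero]
        simp only [mul_zero, add_zero]
        replace hx := mem_spanSubalgebra.mp hx
        induction hx using Submodule.span_induction with
        | zero => simp
        | add x y _ _ h h' => rw [map_add, h, h', add_zero]
        | smul t x _ h => rw [map_smul, h, smul_zero]
        | mem x hx =>
          obtain ⟨α, -, hx⟩ := hx
          exact hΛ α x hx
  refine exists_induced_module (affMinus ν (nMinus b))
    ((negProj ν p).codRestrict (affMinus ν (nMinus b)).toSubmodule negProj_mem)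
    (fun y => Subtype.ext (hneg y)) (hwChar ν Λ l k c) hneg' (hwSet ν b)
    (sub_negProj_mem_span hpH hpos hp)
    (fun Z hZ => Subtype.ext (negProj_eq_zero_of_mem_hwSet hpH hpos Z hZ))
    (fun Z hZ Z' hZ' => ?_)
  have := lie_hwSet (l := l) (k := k) (c := c) hpos hΛ Z hZ Z' hZ'
  exact ⟨Subtype.ext this.1, this.2⟩

end Borel

/-! ### Representations generated by a highest weight vector -/

/-- Let `S` be a set of vectors such that a subspace that contains `S` and is stable under `T`
contains the images of `S` under the whole Lie algebra. Then such a subspace contains an invariant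
subspace that contains `S`, namely the smallest subspace that contains `S` and is stable under `T`.
This replaces the factorization of the enveloping algebra along a triangular decomposition. -/
theorem exists_invariant_le {L M : Type*} [LieRing L] [LieAlgebra ℂ L] [AddCommGroup M] [Module ℂ M]
    (ρ : L →ₗ⁅ℂ⁆ Module.End ℂ M) (T : Set L) (S : Set M)
    (hS : ∀ A : Submodule ℂ M, S ⊆ A → (∀ Y ∈ T, ∀ w ∈ A, ρ Y w ∈ A) → ∀ u ∈ S, ∀ Z, ρ Z u ∈ A)
    (A : Submodule ℂ M) (hSA : S ⊆ A) (hA : ∀ Y ∈ T, ∀ w ∈ A, ρ Y w ∈ A) :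
    ∃ A₀ : Submodule ℂ M, S ⊆ A₀ ∧ (∀ Z, ∀ w ∈ A₀, ρ Z w ∈ A₀) ∧ A₀ ≤ A := by
  let A₀ : Submodule ℂ M := sInf {A | S ⊆ A ∧ ∀ Y ∈ T, ∀ w ∈ A, ρ Y w ∈ A}
  have hS₀ : S ⊆ A₀ := fun u hu => Submodule.mem_sInf.mpr fun A hA => hA.1 hu
  have hA₀ (Y) (hY : Y ∈ T) (w) (hw : w ∈ A₀) : ρ Y w ∈ A₀ :=
    Submodule.mem_sInf.mpr fun A hA => hA.2 Y hY w (Submodule.mem_sInf.mp hw A hA)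
  -- The elements of `A₀` that the whole algebra keeps in `A₀`.
  let B : Submodule ℂ M :=
    { carrier := {w | w ∈ A₀ ∧ ∀ Z, ρ Z w ∈ A₀}
      add_mem' := fun h h' => ⟨add_mem h.1 h'.1, fun Z => by
        rw [map_add]; exact add_mem (h.2 Z) (h'.2 Z)⟩
      zero_mem' := ⟨zero_mem _, fun Z => by rw [map_zero]; exact zero_mem _⟩
      smul_mem' := fun t w h => ⟨A₀.smul_mem t h.1, fun Z => by
        rw [map_smul]; exact A₀.smul_mem t (h.2 Z)⟩ }
  have hB : A₀ ≤ B := by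
    refine sInf_le ⟨fun u hu => ⟨hS₀ hu, hS A₀ hS₀ hA₀ u hu⟩, fun Y hY w hw =>
      ⟨hA₀ Y hY w hw.1, fun Z => ?_⟩⟩
    have : ρ Z (ρ Y w) = ρ ⁅Z, Y⁆ w + ρ Y (ρ Z w) := by
      rw [LieHom.map_lie, LieRing.of_associative_ring_bracket]
      simp
    rw [this]
    exact add_mem (hw.2 _) (hA₀ Y hY _ (hw.2 Z))
  exact ⟨A₀, hS₀, fun Z w hw => (hB hw).2 Z, sInf_le ⟨hSA, hA⟩⟩

section HighestWeightVector

variable {g : Type*} [LieRing g] [LieAlgebra ℂ g] [FiniteDimensional ℂ g] [IsSimple ℂ g]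
variable {H : LieSubalgebra ℂ g} [H.IsCartanSubalgebra]
variable {ν : ℂ} {b : (rootSystem H).Base}
variable {M : Type*} [AddCommGroup M] [Module ℂ M]

theorem mem_span_hwSet_sup_negSet (Z : AffVir g ν) :
    Z ∈ Submodule.span ℂ (hwSet ν b) ⊔ Submodule.span ℂ (negSet ν (nMinus b)) := by
  obtain ⟨p, hp, hpH, hpos⟩ := exists_proj_nMinus b
  have h1 := sub_negProj_mem_span hpH hpos hp Z
  have h2 : negProj ν p Z ∈ Submodule.span ℂ (negSet ν (nMinus b)) := negProj_mem Z
  rw [← sub_add_cancel Z (negProj ν p Z)]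
  exact Submodule.add_mem_sup h1 h2

/-- In a representation generated by a highest weight vector `u`, every subspace that contains `u`
and is stable under `𝔏(g)₋` is everything. -/
theorem eq_top_of_negSet_stable (ρ : AffVir g ν →ₗ⁅ℂ⁆ Module.End ℂ M) (u : M)
    (hu : ∀ Z ∈ hwSet ν b, ∃ t : ℂ, ρ Z u = t • u)
    (hgen : ∀ A : Submodule ℂ M, u ∈ A → (∀ Z, ∀ w ∈ A, ρ Z w ∈ A) → A = ⊤)
    (A : Submodule ℂ M) (huA : u ∈ A) (hA : ∀ Y ∈ negSet ν (nMinus b), ∀ w ∈ A, ρ Y w ∈ A) :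
    A = ⊤ := by
  obtain ⟨A₀, hu₀, hA₀, hle⟩ := exists_invariant_le ρ (negSet ν (nMinus b)) {u}
    (fun A hu₁ hA u' hu' Z => by
      rw [Set.mem_singleton_iff.mp hu']
      let ev : AffVir g ν →ₗ[ℂ] M := (ρ : AffVir g ν →ₗ[ℂ] Module.End ℂ M).flip u
      refine (sup_le (Submodule.span_le.mpr fun Z hZ => ?_)
        (Submodule.span_le.mpr fun Z hZ => ?_) : _ ≤ A.comap ev)
        (mem_span_hwSet_sup_negSet (b := b) Z)
      · obtain ⟨t, ht⟩ := hu Z hZ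
        change ρ Z u ∈ A
        rw [ht]
        exact A.smul_mem t (hu₁ rfl)
      · exact hA Z hZ u (hu₁ rfl))
    A (by simpa using huA) hA
  exact top_le_iff.mp (hgen A₀ (hu₀ rfl) hA₀ ▸ hle)

/-- A representation generated by a nonzero highest weight vector `u` has a subspace, not
containing `u`, that contains all proper invariant subspaces: the sum of the eigenspaces, for
eigenvalues of real part smaller than that of `u`, of an element `h + K d₀` whose adjoint action has
negative eigenvalues on `𝔏(g)₋`. -/
theorem exists_le_of_ne_top (ρ : AffVir g ν →ₗ⁅ℂ⁆ Module.End ℂ M) (u : M) (hu0 : u ≠ 0)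
    (hu : ∀ Z ∈ hwSet ν b, ∃ t : ℂ, ρ Z u = t • u)
    (hgen : ∀ A : Submodule ℂ M, u ∈ A → (∀ Z, ∀ w ∈ A, ρ Z w ∈ A) → A = ⊤) :
    ∃ R : Submodule ℂ M, u ∉ R ∧
      ∀ A : Submodule ℂ M, (∀ Z, ∀ w ∈ A, ρ Z w ∈ A) → A ≠ ⊤ → A ≤ R := by
  obtain ⟨h, hh⟩ := exists_root_apply_eq_height b
  -- `K` exceeds the heights of all roots, so that `ad D` has negative eigenvalues on `𝔏(g)₋`.
  let K : ℤ := 1 + ∑ α : H.root, |b.height α|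
  have hK (α : H.root) : b.height α < K := by
    have := Finset.single_le_sum (f := fun α : H.root => |b.height α|)
      (fun _ _ => abs_nonneg _) (Finset.mem_univ α)
    have := le_abs_self (b.height α)
    simp only [K]
    omega
  have hK0 : 0 < K := by
    have := Finset.sum_nonneg (s := Finset.univ) (f := fun α : H.root => |b.height α|)
      (fun _ _ => abs_nonneg _)
    simp only [K]
    omega
  obtain ⟨D, hD⟩ : ∃ D : AffVir g ν, D = cur ν (h : g) 0 + (K : ℂ) • vir g ν 0 := ⟨_, rfl⟩
  obtain ⟨τ, hτ⟩ : ∃ τ : ℂ, ρ D u = τ • u := by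
    obtain ⟨t, ht⟩ := hu _ (Or.inr (Or.inr ⟨(h : g), Or.inl ⟨h, rfl⟩, (K : ℂ), rfl⟩))
    refine ⟨t, ?_⟩
    rw [← ht, hom_eq_cur_add_vir, hD]
  let S : Set ℂ := {s | s.re < τ.re}
  let R : Submodule ℂ M := ⨆ s ∈ S, (ρ D).eigenspace s
  have hτS : τ ∉ S := fun h => lt_irrefl _ (show τ.re < τ.re from h)
  -- An eigenvector of `ad D` with eigenvalue of negative real part maps `ℂ u + R` to itself.
  have step (Y : AffVir g ν) (e : ℝ) (he : e < 0) (hY : ⁅D, Y⁆ = (e : ℂ) • Y) :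
      ∀ w ∈ Submodule.span ℂ {u} ⊔ R, ρ Y w ∈ Submodule.span ℂ {u} ⊔ R := by
    have key (s : ℂ) (w : M) (hw : ρ D w = s • w) : ρ D (ρ Y w) = (s + e) • ρ Y w := by
      have : ρ D (ρ Y w) = ρ ⁅D, Y⁆ w + ρ Y (ρ D w) := by
        rw [LieHom.map_lie, LieRing.of_associative_ring_bracket]
        simp
      rw [this, hY, hw, map_smul, map_smul, LinearMap.smul_apply, add_smul, add_comm]
    have memR (s : ℂ) (hs : s.re ≤ τ.re) (w : M) (hw : ρ D w = s • w) : ρ Y w ∈ R := by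
      refine Submodule.mem_iSup_of_mem (s + e) (Submodule.mem_iSup_of_mem ?_ ?_)
      · change (s + e).re < τ.re
        simp only [Complex.add_re, Complex.ofReal_re]
        linarith
      · exact Module.End.mem_eigenspace_iff.mpr (key s w hw)
    suffices Submodule.span ℂ {u} ⊔ R ≤ R.comap (ρ Y) from
      fun w hw => Submodule.mem_sup_right (this hw)
    refine sup_le ?_ (iSup₂_le fun s hs w hw => ?_)
    · rw [Submodule.span_singleton_le_iff_mem]
      exact memR τ le_rfl u hτ
    · exact memR s (le_of_lt hs) w (Module.End.mem_eigenspace_iff.mp hw)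
  have hDcur (m : ℤ) (α : H.root) (x : g) (hx : x ∈ rootSpace H α.1) :
      ⁅D, cur ν x m⁆ = (((K * m + b.height α : ℤ) : ℝ) : ℂ) • cur ν x m := by
    have : ⁅(h : g), x⁆ = (b.height α : ℂ) • x := by rw [lie_rootSpace α x hx, hh]
    rw [hD, add_lie, smul_lie, vir_lie_cur, cur_lie_cur, this]
    have e (t : ℂ) : cur ν (t • x) m = t • cur ν x m := by
      rw [cur, cur, ← map_smul]; congr 1; ext <;> simp
    rw [zero_add, e, add_zero]
    push_cast
    simp only [zero_mul, zero_smul]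
    module
  have hDcurH (m : ℤ) (h' : H) :
      ⁅D, cur ν (h' : g) m⁆ = (((K * m : ℤ) : ℝ) : ℂ) • cur ν (h' : g) m := by
    have : ⁅(h : g), (h' : g)⁆ = 0 := by
      rw [← LieSubalgebra.coe_bracket, trivial_lie_zero]; rfl
    rw [hD, add_lie, smul_lie, vir_lie_cur, cur_lie_cur, this]
    have e : cur ν (0 : g) (0 + m) = 0 := map_zero (hom ν _)
    rw [e, add_zero]
    push_cast
    simp only [zero_mul, zero_smul]
    module
  have hDvir (m : ℤ) : ⁅D, vir g ν m⁆ = (((K * m : ℤ) : ℝ) : ℂ) • vir g ν m := by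
    rw [hD, add_lie, smul_lie, vir_lie_vir, ← lie_skew, vir_lie_cur, zero_add]
    push_cast
    simp
    module
  let good : Submodule ℂ (AffVir g ν) :=
    { carrier := {Y | ∀ w ∈ Submodule.span ℂ {u} ⊔ R, ρ Y w ∈ Submodule.span ℂ {u} ⊔ R}
      add_mem' := fun h h' w hw => by rw [map_add]; exact add_mem (h w hw) (h' w hw)
      zero_mem' := fun w _ => by rw [map_zero]; exact zero_mem _
      smul_mem' := fun t Y h w hw => by rw [map_smul]; exact Submodule.smul_mem _ t (h w hw) }
  have htop : Submodule.span ℂ {u} ⊔ R = ⊤ := by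
    refine eq_top_of_negSet_stable (b := b) ρ u hu hgen _
      (Submodule.mem_sup_left (Submodule.mem_span_singleton_self u)) fun Y hY => ?_
    change Y ∈ good
    have neg (m : ℤ) (hm : m < 0) : ((K * m : ℤ) : ℝ) < 0 := by
      exact_mod_cast mul_neg_of_pos_of_neg hK0 hm
    obtain ⟨m, hm, ⟨x, r⟩, rfl⟩ | ⟨x, hx, rfl⟩ := hY
    · rw [hom_eq_cur_add_vir]
      refine add_mem ?_ (good.smul_mem r (step _ _ (neg m hm) (hDvir m)))
      refine mem_of_rootSpace_le (H := H) (good.comap (hom ν m ∘ₗ LinearMap.inl ℂ g ℂ))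
        (fun h' => step _ _ (neg m hm) (hDcurH m h')) (fun α x hx => step _ _ ?_ (hDcur m α x hx)) x
      have h1 := hK α
      have : K * m + b.height α < 0 := by nlinarith
      exact_mod_cast this
    · replace hx := mem_spanSubalgebra.mp hx
      refine (Submodule.span_le.mpr ?_ : _ ≤ good.comap (hom ν 0 ∘ₗ LinearMap.inl ℂ g ℂ)) hx
      rintro x ⟨α, hα, hx⟩
      refine step _ _ ?_ (hDcur 0 α x hx)
      rw [RootPairing.Base.isPos_iff'] at hα
      have : K * 0 + b.height α < 0 := by omega
      exact_mod_cast this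
  refine ⟨R, fun huR => hu0 ?_, fun A hA hne w hw => ?_⟩
  · have := mem_of_add_mem_of_mem_iSup_eigenspace (ρ D) ⊥ (by simp) τ S hτS u (-u) hτ
      (neg_mem huR) (by simp)
    simpa using this
  · have hw' : w ∈ Submodule.span ℂ {u} ⊔ R := htop ▸ Submodule.mem_top
    obtain ⟨y, hy, z, hz, rfl⟩ := Submodule.mem_sup.mp hw'
    obtain ⟨t, rfl⟩ := Submodule.mem_span_singleton.mp hy
    have htu := mem_of_add_mem_of_mem_iSup_eigenspace (ρ D) A (hA D) τ S hτS (t • u) z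
      (by rw [map_smul, hτ, smul_comm]) hz hw
    by_cases ht : t = 0
    · rw [ht, zero_smul, zero_add]
      exact hz
    · exact absurd (hgen A ((A.smul_mem_iff ht).mp htu) hA) hne

end HighestWeightVector

/-! ### Irreducibility of `L(λ, l, k, c)` -/

section Irreducible

variable {g : Type*} [LieRing g] [LieAlgebra ℂ g] [FiniteDimensional ℂ g] [IsSimple ℂ g]
variable {H : LieSubalgebra ℂ g} [H.IsCartanSubalgebra]
variable (ν : ℂ) (b : (rootSystem H).Base) (lam : Module.Dual ℂ H) (l k c : ℂ)

theorem exists_smul_eq_of_mem_hwSet {N : Type*} [AddCommGroup N] [Module ℂ N]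
    [Module (UniversalEnvelopingAlgebra ℂ (AffVir g ν)) N]
    [IsScalarTower ℂ (UniversalEnvelopingAlgebra ℂ (AffVir g ν)) N] (u : N)
    (hu : ∀ P ∈ hwRel ν b lam l k c, P • u = 0) (Z : AffVir g ν) (hZ : Z ∈ hwSet ν b) :
    ∃ t : ℂ, UniversalEnvelopingAlgebra.ι ℂ Z • u = t • u := by
  have scalar (Z : AffVir g ν) (t : ℂ) (h : UniversalEnvelopingAlgebra.ι ℂ Z -
      algebraMap ℂ (UniversalEnvelopingAlgebra ℂ (AffVir g ν)) t ∈ hwRel ν b lam l k c) :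
      UniversalEnvelopingAlgebra.ι ℂ Z • u = t • u := by
    have := hu _ h
    rwa [sub_smul, algebraMap_smul, sub_eq_zero] at this
  have zero (Z : AffVir g ν) (h : UniversalEnvelopingAlgebra.ι ℂ Z ∈ hwRel ν b lam l k c) :
      UniversalEnvelopingAlgebra.ι ℂ Z • u = (0 : ℂ) • u := by rw [hu _ h, zero_smul]
  obtain ⟨z, rfl⟩ | ⟨m, hm, ⟨x, r⟩, rfl⟩ | ⟨x, hx, r, rfl⟩ := hZ
  · have h1 := scalar (kk g ν) k (Or.inr (Or.inr (Or.inl rfl)))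
    have h2 := scalar (cc g ν) c (Or.inr (Or.inr (Or.inr (Or.inl rfl))))
    refine ⟨z.1 * k + z.2 * c, ?_⟩
    rw [cen_eq, map_add, map_smul, map_smul, add_smul, smul_assoc, smul_assoc, h1, h2]
    module
  · have h1 := zero (cur ν x m)
      (Or.inr (Or.inr (Or.inr (Or.inr (Or.inr (Or.inl ⟨m, hm, x, rfl⟩))))))
    have h2 := zero (vir g ν m)
      (Or.inr (Or.inr (Or.inr (Or.inr (Or.inr (Or.inr ⟨m, hm, rfl⟩))))))
    refine ⟨0, ?_⟩
    rw [hom_eq_cur_add_vir, map_add, map_smul, add_smul, smul_assoc, h1, h2]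
    module
  · have h2 := scalar (vir g ν 0) l (Or.inr (Or.inl rfl))
    obtain ⟨t, h1⟩ : ∃ t : ℂ, UniversalEnvelopingAlgebra.ι ℂ (cur ν x 0) • u = t • u := by
      obtain ⟨h, rfl⟩ | ⟨α, hα, hx⟩ := hx
      · exact ⟨_, scalar _ _ (Or.inl ⟨h, rfl⟩)⟩
      · exact ⟨0, zero _ (Or.inr (Or.inr (Or.inr (Or.inr (Or.inl ⟨α, hα, x, hx, rfl⟩)))))⟩
    refine ⟨t + r * l, ?_⟩
    rw [hom_eq_cur_add_vir, map_add, map_smul, add_smul, smul_assoc, h1, h2]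
    module

/-- The representation on a module over the enveloping algebra. -/
def repU {L : Type*} [LieRing L] [LieAlgebra ℂ L] (N : Type*) [AddCommGroup N] [Module ℂ N]
    [Module (UniversalEnvelopingAlgebra ℂ L) N]
    [IsScalarTower ℂ (UniversalEnvelopingAlgebra ℂ L) N] : L →ₗ⁅ℂ⁆ Module.End ℂ N :=
  (Algebra.lsmul ℂ ℂ N : UniversalEnvelopingAlgebra ℂ L →ₐ[ℂ] Module.End ℂ N).toLieHom.comp
    (UniversalEnvelopingAlgebra.ι ℂ)

/-- A subspace that is stable under the Lie algebra is stable under the enveloping algebra. -/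
theorem smul_mem_of_ι_smul_mem {L : Type*} [LieRing L] [LieAlgebra ℂ L] {N : Type*}
    [AddCommGroup N] [Module ℂ N] [Module (UniversalEnvelopingAlgebra ℂ L) N]
    [IsScalarTower ℂ (UniversalEnvelopingAlgebra ℂ L) N] (A : Submodule ℂ N)
    (hA : ∀ Z : L, ∀ w ∈ A, UniversalEnvelopingAlgebra.ι ℂ Z • w ∈ A)
    (P : UniversalEnvelopingAlgebra ℂ L) (w : N) (hw : w ∈ A) : P • w ∈ A := by
  induction P using induction_mul with
  | add X Y h h' => rw [add_smul]; exact add_mem h h'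
  | smul t X h => rw [smul_assoc]; exact A.smul_mem t h
  | one => rwa [one_smul]
  | mul x X h => rw [mul_smul]; exact hA x _ h

/-- The generator of the Verma module. -/
def vermaVec : Verma ν b lam l k c := Submodule.Quotient.mk 1

theorem hwRel_smul_vermaVec (P : UniversalEnvelopingAlgebra ℂ (AffVir g ν))
    (hP : P ∈ hwRel ν b lam l k c) : P • vermaVec ν b lam l k c = 0 := by
  rw [vermaVec, ← Submodule.Quotient.mk_smul, smul_eq_mul, mul_one,
    (Submodule.Quotient.mk_eq_zero _).mpr (Submodule.subset_span hP)]

theorem smul_vermaVec_surjective (w : Verma ν b lam l k c) :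
    ∃ P : UniversalEnvelopingAlgebra ℂ (AffVir g ν), P • vermaVec ν b lam l k c = w := by
  obtain ⟨P, rfl⟩ := Submodule.Quotient.mk_surjective _ w
  exact ⟨P, by rw [vermaVec, ← Submodule.Quotient.mk_smul, smul_eq_mul, mul_one]⟩

theorem vermaVec_ne_zero : vermaVec ν b lam l k c ≠ 0 := by
  obtain ⟨Λ, hΛH, hΛ⟩ := exists_extend_dual H lam
  obtain ⟨ρ, hρ⟩ := exists_highest_weight_module ν b Λ hΛ l k c
  intro h
  rw [vermaVec, Submodule.Quotient.mk_eq_zero] at h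
  let F := UniversalEnvelopingAlgebra.lift ℂ ρ
  have key (P) (hP : P ∈ Submodule.span (UniversalEnvelopingAlgebra ℂ (AffVir g ν))
      (hwRel ν b lam l k c)) : F P 1 = 0 := by
    induction hP using Submodule.span_induction with
    | zero => simp
    | add x y _ _ h h' => rw [map_add, LinearMap.add_apply, h, h', add_zero]
    | smul t x _ h => rw [smul_eq_mul, map_mul, Module.End.mul_apply, h, map_zero]
    | mem P hP =>
      have hF (Z : AffVir g ν) : F (UniversalEnvelopingAlgebra.ι ℂ Z) = ρ Z :=
        UniversalEnvelopingAlgebra.lift_ι_apply ℂ ρ Z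
      have hs (Z : AffVir g ν) (t : ℂ) (hZ : Z ∈ hwSet ν b) (ht : hwChar ν Λ l k c Z = t) :
          F (UniversalEnvelopingAlgebra.ι ℂ Z - algebraMap ℂ _ t) 1 = 0 := by
        rw [map_sub, LinearMap.sub_apply, hF, hρ Z hZ, ht, AlgHom.commutes,
          Module.algebraMap_end_apply, sub_self]
      have hz (Z : AffVir g ν) (hZ : Z ∈ hwSet ν b) (ht : hwChar ν Λ l k c Z = 0) :
          F (UniversalEnvelopingAlgebra.ι ℂ Z) 1 = 0 := by
        rw [hF, hρ Z hZ, ht, zero_smul]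
      obtain ⟨h, rfl⟩ | rfl | rfl | rfl | ⟨α, hα, x, hx, rfl⟩ | ⟨n, hn, x, rfl⟩ | ⟨n, hn, rfl⟩ := hP
      · refine hs _ _ (Or.inr (Or.inr ⟨h, Or.inl ⟨h, rfl⟩, 0, rfl⟩)) ?_
        rw [cur, hwChar_hom_zero]
        simp [hΛH]
      · refine hs _ _ (Or.inr (Or.inr ⟨0, zero_mem_borelSet b, 1, rfl⟩)) ?_
        rw [vir, hwChar_hom_zero]
        simp
      · refine hs _ _ (Or.inl ⟨_, rfl⟩) ?_
        rw [kk, hwChar_cen]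
        simp
      · refine hs _ _ (Or.inl ⟨_, rfl⟩) ?_
        rw [cc, hwChar_cen]
        simp
      · refine hz _ (Or.inr (Or.inr ⟨x, Or.inr ⟨α, hα, hx⟩, 0, rfl⟩)) ?_
        rw [cur, hwChar_hom_zero]
        simp [hΛ α x hx]
      · exact hz _ (Or.inr (Or.inl ⟨n, hn, _, rfl⟩)) (hwChar_hom_of_ne hn.ne' _)
      · exact hz _ (Or.inr (Or.inl ⟨n, hn, _, rfl⟩)) (hwChar_hom_of_ne hn.ne' _)
  have h1 := key 1 h
  rw [map_one F, Module.End.one_apply] at h1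
  exact one_ne_zero h1

theorem vermaVec_notMem_maxSub : vermaVec ν b lam l k c ∉ maxSub ν b lam l k c := by
  have hgen (A : Submodule ℂ (Verma ν b lam l k c)) (huA : vermaVec ν b lam l k c ∈ A)
      (hA : ∀ Z : AffVir g ν, ∀ w ∈ A, repU (Verma ν b lam l k c) Z w ∈ A) : A = ⊤ := by
    refine Submodule.eq_top_iff'.mpr fun w => ?_
    obtain ⟨P, rfl⟩ := smul_vermaVec_surjective ν b lam l k c w
    exact smul_mem_of_ι_smul_mem A hA P _ huA
  obtain ⟨R, hR, hle⟩ := exists_le_of_ne_top (b := b) (repU (Verma ν b lam l k c))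
    (vermaVec ν b lam l k c) (vermaVec_ne_zero ν b lam l k c)
    (exists_smul_eq_of_mem_hwSet ν b lam l k c _ (hwRel_smul_vermaVec ν b lam l k c)) hgen
  intro hmem
  refine hR ?_
  rw [maxSub, sSup_eq_iSup] at hmem
  generalize vermaVec ν b lam l k c = u at hmem ⊢
  induction hmem using Submodule.iSup_induction' with
  | zero => exact zero_mem _
  | add x y _ _ h h' => exact add_mem h h'
  | mem N x hx =>
    by_cases hN : N ≠ ⊤
    · rw [iSup_pos (show N ∈ {N | N ≠ ⊤} from hN)] at hx
      refine hle (N.restrictScalars ℂ) (fun Z w hw => N.smul_mem _ hw) (fun h => hN ?_) hx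
      exact (Submodule.restrictScalars_eq_top_iff ..).mp h
    · rw [iSup_neg (show N ∉ {N | N ≠ ⊤} from hN), Submodule.mem_bot] at hx
      rw [hx]
      exact zero_mem _

theorem hwVec_ne_zero : hwVec ν b lam l k c ≠ 0 := fun h =>
  vermaVec_notMem_maxSub ν b lam l k c ((Submodule.Quotient.mk_eq_zero _).mp h)

/-- The module `L(λ, l, k, c)` is irreducible. -/
theorem irrHW_eq_bot_or_eq_top (A : Submodule ℂ (IrrHW ν b lam l k c))
    (hA : ∀ Z : AffVir g ν, ∀ w ∈ A, ⁅Z, w⁆ ∈ A) : A = ⊥ ∨ A = ⊤ := by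
  let A' : Submodule (UniversalEnvelopingAlgebra ℂ (AffVir g ν)) (IrrHW ν b lam l k c) :=
    { A with smul_mem' := fun P w hw => smul_mem_of_ι_smul_mem A hA P w hw }
  let B : Submodule (UniversalEnvelopingAlgebra ℂ (AffVir g ν)) (Verma ν b lam l k c) :=
    A'.comap (maxSub ν b lam l k c).mkQ
  have hB (w : Verma ν b lam l k c) :
      w ∈ B ↔ (Submodule.Quotient.mk w : IrrHW ν b lam l k c) ∈ A := Iff.rfl
  by_cases h : B = ⊤
  · right
    refine Submodule.eq_top_iff'.mpr fun w => ?_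
    obtain ⟨w, rfl⟩ := Submodule.Quotient.mk_surjective _ w
    exact (hB w).mp (h ▸ Submodule.mem_top)
  · left
    refine (Submodule.eq_bot_iff _).mpr fun w hw => ?_
    obtain ⟨w, rfl⟩ := Submodule.Quotient.mk_surjective _ w
    exact (Submodule.Quotient.mk_eq_zero _).mpr
      ((le_sSup (show B ∈ {N | N ≠ ⊤} from h) : B ≤ maxSub ν b lam l k c) ((hB w).mpr hw))

/-- A subspace of `L(λ, l, k, c)` that contains the highest weight vector and is stable under
`𝔏(g)₋` is everything. -/
theorem irrHW_eq_top (A : Submodule ℂ (IrrHW ν b lam l k c)) (hu : hwVec ν b lam l k c ∈ A)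
    (hA : ∀ Y ∈ negSet ν (nMinus b), ∀ w ∈ A, ⁅Y, w⁆ ∈ A) : A = ⊤ := by
  refine eq_top_of_negSet_stable (b := b) (repU (IrrHW ν b lam l k c)) (hwVec ν b lam l k c)
    (exists_smul_eq_of_mem_hwSet ν b lam l k c _ (hwRel_smul ν b lam l k c))
    (fun A huA hA => Submodule.eq_top_iff'.mpr fun w => ?_) A hu hA
  obtain ⟨P, rfl⟩ := exists_smul_hwVec ν b lam l k c w
  exact smul_mem_of_ι_smul_mem A hA P _ huA

end Irreducible

/-! ### Homogeneous monomials in `U(𝔏(g)₋)` -/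

section Monomials

variable {g : Type*} [LieRing g] [LieAlgebra ℂ g] {ν : ℂ} {𝔫 : LieSubalgebra ℂ g}

/-- The element `x(m) + r dₘ` of `𝔏(g)₋`, for `m < 0` and `q = (x, r)`. -/
def negHom (ν : ℂ) (𝔫 : LieSubalgebra ℂ g) (m : ℤ) (hm : m < 0) (q : g × ℂ) : affMinus ν 𝔫 :=
  ⟨hom ν m q, subset_spanSubalgebra (Or.inl ⟨m, hm, q, rfl⟩)⟩

/-- `IsMonomial P j` says that `P` is a product of elements `x(m) + r dₘ` with `m < 0` and of
elements of `𝔫`, and that `j` is the sum of the degrees `m` of the factors. -/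
inductive IsMonomial : UniversalEnvelopingAlgebra ℂ (affMinus ν 𝔫) → ℤ → Prop
  | one : IsMonomial 1 0
  | neg {P : UniversalEnvelopingAlgebra ℂ (affMinus ν 𝔫)} {j : ℤ} (m : ℤ) (hm : m < 0)
      (q : g × ℂ) (h : IsMonomial P j) :
      IsMonomial (UniversalEnvelopingAlgebra.ι ℂ (negHom ν 𝔫 m hm q) * P) (m + j)
  | fin {P : UniversalEnvelopingAlgebra ℂ (affMinus ν 𝔫)} {j : ℤ} (x : 𝔫) (h : IsMonomial P j) :
      IsMonomial (UniversalEnvelopingAlgebra.ι ℂ (finHom ν 𝔫 x) * P) j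

theorem IsMonomial.nonpos {P : UniversalEnvelopingAlgebra ℂ (affMinus ν 𝔫)} {j : ℤ}
    (h : IsMonomial P j) : j ≤ 0 := by
  induction h with
  | one => exact le_rfl
  | neg m hm q h ih => omega
  | fin x h ih => exact ih

theorem IsMonomial.exists_inclFin {P : UniversalEnvelopingAlgebra ℂ (affMinus ν 𝔫)} {j : ℤ}
    (h : IsMonomial P j) (hj : j = 0) : ∃ z, inclFin ν 𝔫 z = P := by
  induction h with
  | one => exact ⟨1, map_one _⟩
  | neg m hm q h ih =>
    have := h.nonpos
    omega
  | fin x h ih =>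
    obtain ⟨z, rfl⟩ := ih hj
    exact ⟨UniversalEnvelopingAlgebra.ι ℂ x * z, by rw [map_mul, inclFin, mapU_ι]⟩

theorem span_isMonomial :
    Submodule.span ℂ {P : UniversalEnvelopingAlgebra ℂ (affMinus ν 𝔫) | ∃ j, IsMonomial P j} = ⊤ := by
  refine Submodule.eq_top_iff'.mpr fun P => ?_
  induction P using induction_mul with
  | add X Y h h' => exact add_mem h h'
  | smul t X h => exact Submodule.smul_mem _ t h
  | one => exact Submodule.subset_span ⟨0, .one⟩
  | mul Y X h =>
    induction h using Submodule.span_induction with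
    | zero => rw [mul_zero]; exact zero_mem _
    | add X X' _ _ h h' => rw [mul_add]; exact add_mem h h'
    | smul t X _ h => rw [mul_smul_comm]; exact Submodule.smul_mem _ t h
    | mem X hX =>
      obtain ⟨j, hX⟩ := hX
      obtain ⟨Y, hY⟩ := Y
      have hY' := mem_spanSubalgebra.mp hY
      induction hY' using Submodule.span_induction with
      | zero =>
        have : UniversalEnvelopingAlgebra.ι ℂ (0 : affMinus ν 𝔫) * X = 0 := by
          rw [map_zero, zero_mul]
        exact this ▸ zero_mem _
      | add Y Y' h₁ h₂ h h' =>
        have := add_mem (h (mem_spanSubalgebra.mpr h₁)) (h' (mem_spanSubalgebra.mpr h₂))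
        rw [← add_mul, ← map_add] at this
        exact this
      | smul t Y h₁ h =>
        have := Submodule.smul_mem _ t (h (mem_spanSubalgebra.mpr h₁))
        rw [← smul_mul_assoc, ← map_smul] at this
        exact this
      | mem Y h₁ =>
        obtain ⟨m, hm, q, rfl⟩ | ⟨x, hx, rfl⟩ := h₁
        · exact Submodule.subset_span ⟨_, .neg m hm q hX⟩
        · exact Submodule.subset_span ⟨_, .fin ⟨x, hx⟩ hX⟩

variable {V : Type*} [AddCommGroup V] [Module ℂ V] [LieRingModule g V] [LieModule ℂ g V]
variable {N : Type*} [AddCommGroup N] [Module ℂ N] [LieRingModule g N] [LieModule ℂ g N]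

/-- Monomials act homogeneously on `⊕_D Hom(V, N) t ^ D`, and so the values `φₙ(P ⊗ v)` obey a
recursion on monomials `P`. -/
theorem IsMonomial.phiAlg_single {P : UniversalEnvelopingAlgebra ℂ (affMinus ν 𝔫)} {j : ℤ}
    (h : IsMonomial P j) (a b : ℂ) (n : ℤ) (f₀ : V →ₗ[ℂ] N) :
    phiAlg ν V N 𝔫 a b n P (Finsupp.single 0 f₀) =
      Finsupp.single j (coeffSum (V →ₗ[ℂ] N) (phiAlg ν V N 𝔫 a b n P (Finsupp.single 0 f₀))) := by
  suffices ∃ F, phiAlg ν V N 𝔫 a b n P (Finsupp.single 0 f₀) = Finsupp.single j F by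
    obtain ⟨F, hF⟩ := this
    rw [hF, coeffSum, Finsupp.lsum_single, LinearMap.id_apply]
  induction h with
  | one => exact ⟨f₀, by simp⟩
  | @neg P j m hm q h ih =>
    obtain ⟨F, hF⟩ := ih
    refine ⟨phiOp V N a b n m j q F, ?_⟩
    rw [map_mul, Module.End.mul_apply, hF, phiAlg_ι]
    exact gradedAct_hom _ m j q F
  | @fin P j x h ih =>
    obtain ⟨F, hF⟩ := ih
    refine ⟨phiOp V N a b n 0 j (x, 0) F, ?_⟩
    rw [map_mul, Module.End.mul_apply, hF, phiAlg_ι]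
    refine (gradedAct_hom _ 0 j ((x : g), 0) F).trans ?_
    rw [zero_add]
    rfl

theorem IsMonomial.phiOf_neg {P : UniversalEnvelopingAlgebra ℂ (affMinus ν 𝔫)} {j : ℤ}
    (h : IsMonomial P j) (a b : ℂ) (n : ℤ) (f₀ : V →ₗ[ℂ] N) (m : ℤ) (hm : m < 0) (q : g × ℂ)
    (v : V) :
    phiOf ν V N 𝔫 a b n f₀ ((UniversalEnvelopingAlgebra.ι ℂ (negHom ν 𝔫 m hm q) * P) ⊗ₜ v) =
      (q.2 * psiFactor a b n m j) • phiOf ν V N 𝔫 a b n f₀ (P ⊗ₜ v) -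
        phiOf ν V N 𝔫 a b n f₀ (P ⊗ₜ ⁅q.1, v⁆) := by
  rw [phiOf_tmul, phiOf_tmul, phiOf_tmul, map_mul, Module.End.mul_apply, h.phiAlg_single, phiAlg_ι]
  change coeffSum (V →ₗ[ℂ] N) (gradedAct ν _ (hom ν m q) _) v = _
  rw [gradedAct_hom]
  simp [coeffSum, phiOp_apply, hm.ne]

theorem IsMonomial.phiOf_fin {P : UniversalEnvelopingAlgebra ℂ (affMinus ν 𝔫)} {j : ℤ}
    (h : IsMonomial P j) (a b : ℂ) (n : ℤ) (f₀ : V →ₗ[ℂ] N) (x : 𝔫) (v : V) :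
    phiOf ν V N 𝔫 a b n f₀ ((UniversalEnvelopingAlgebra.ι ℂ (finHom ν 𝔫 x) * P) ⊗ₜ v) =
      ⁅(x : g), phiOf ν V N 𝔫 a b n f₀ (P ⊗ₜ v)⁆ -
        phiOf ν V N 𝔫 a b n f₀ (P ⊗ₜ ⁅(x : g), v⁆) := by
  rw [phiOf_tmul, phiOf_tmul, phiOf_tmul, map_mul, Module.End.mul_apply, h.phiAlg_single, phiAlg_ι]
  change coeffSum (V →ₗ[ℂ] N) (gradedAct ν _ (hom ν 0 ((x : g), 0)) _) v = _
  rw [gradedAct_hom]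
  simp [coeffSum, phiOp_apply]
  abel

end Monomials

/-! ### The grading of `L(λ, l, k, c)` -/

section Grading

variable {g : Type*} [LieRing g] [LieAlgebra ℂ g] [FiniteDimensional ℂ g] [IsSimple ℂ g]
variable {H : LieSubalgebra ℂ g} [H.IsCartanSubalgebra]
variable (ν : ℂ) (β : (rootSystem H).Base) (lam : Module.Dual ℂ H) (l k c : ℂ)

/-- The map `P ↦ P ū` from `U(𝔏(g)₋)` to `L(λ, l, k, c)`, whose kernel is `Ann(ū)`. -/
def actHw : UniversalEnvelopingAlgebra ℂ (affMinus ν (nMinus β)) →ₗ[ℂ] IrrHW ν β lam l k c :=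
  (actU (affMinus ν (nMinus β)) (IrrHW ν β lam l k c)).toLinearMap.flip (hwVec ν β lam l k c)

theorem actHw_one : actHw ν β lam l k c 1 = hwVec ν β lam l k c := by
  simp [actHw]

theorem actHw_mul (Y : affMinus ν (nMinus β))
    (P : UniversalEnvelopingAlgebra ℂ (affMinus ν (nMinus β))) :
    actHw ν β lam l k c (UniversalEnvelopingAlgebra.ι ℂ Y * P) =
      ⁅(Y : AffVir g ν), actHw ν β lam l k c P⁆ := by
  rw [actHw, LinearMap.flip_apply, AlgHom.toLinearMap_apply, map_mul, Module.End.mul_apply, actU_ι]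
  rfl

theorem actHw_surjective : Function.Surjective (actHw ν β lam l k c) := by
  rw [← LinearMap.range_eq_top]
  refine irrHW_eq_top ν β lam l k c _ ⟨1, actHw_one ν β lam l k c⟩ ?_
  rintro Y hY _ ⟨P, rfl⟩
  exact ⟨UniversalEnvelopingAlgebra.ι ℂ ⟨Y, subset_spanSubalgebra hY⟩ * P, actHw_mul ..⟩

/-- The module `L(λ, l, k, c)` is spanned by the vectors `P ū` with `P` a monomial. -/
theorem mem_of_isMonomial (A : Submodule ℂ (IrrHW ν β lam l k c))
    (hA : ∀ (P : UniversalEnvelopingAlgebra ℂ (affMinus ν (nMinus β))) (j : ℤ),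
      IsMonomial P j → actHw ν β lam l k c P ∈ A) (w : IrrHW ν β lam l k c) : w ∈ A := by
  obtain ⟨P, rfl⟩ := actHw_surjective ν β lam l k c w
  have hP : P ∈ Submodule.span ℂ {P : UniversalEnvelopingAlgebra ℂ (affMinus ν (nMinus β)) |
      ∃ j, IsMonomial P j} := by
    rw [span_isMonomial]
    trivial
  refine (Submodule.span_le.mpr ?_ : _ ≤ A.comap (actHw ν β lam l k c)) hP
  rintro P ⟨j, hP⟩
  exact hA P j hP

variable {ν β} in
theorem IsMonomial.vir_lie_actHw {P : UniversalEnvelopingAlgebra ℂ (affMinus ν (nMinus β))} {j : ℤ}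
    (h : IsMonomial P j) :
    ⁅vir g ν 0, actHw ν β lam l k c P⁆ = (l + j) • actHw ν β lam l k c P := by
  induction h with
  | one => rw [actHw_one, vir_zero_hwVec]; simp
  | @neg P j m hm q h ih =>
    have e : ⁅vir g ν 0, hom ν m q⁆ = (m : ℂ) • hom ν m q := by
      rw [vir, hom_lie_of_ne (by omega), ← map_smul, zero_add]
      congr 1
      ext <;> simp
    rw [actHw_mul, leibniz_lie, ih]
    change ⁅⁅vir g ν 0, hom ν m q⁆, actHw ν β lam l k c P⁆ + ⁅hom ν m q, _⁆ =
      _ • ⁅hom ν m q, actHw ν β lam l k c P⁆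
    rw [e, lie_smul, smul_lie]
    push_cast
    module
  | @fin P j x h ih =>
    rw [actHw_mul, leibniz_lie, ih]
    change ⁅⁅vir g ν 0, cur ν (x : g) 0⁆, actHw ν β lam l k c P⁆ + ⁅cur ν (x : g) 0, _⁆ =
      _ • ⁅cur ν (x : g) 0, actHw ν β lam l k c P⁆
    rw [vir_lie_cur, lie_smul]
    simp

theorem hom_lie_hwVec (m : ℤ) (hm : 0 < m) (q : g × ℂ) : ⁅hom ν m q, hwVec ν β lam l k c⁆ = 0 := by
  obtain ⟨x, r⟩ := q
  have h1 : ⁅cur ν x m, hwVec ν β lam l k c⁆ = 0 := hwRel_smul ν β lam l k c _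
    (Or.inr (Or.inr (Or.inr (Or.inr (Or.inr (Or.inl ⟨m, hm, x, rfl⟩))))))
  have h2 : ⁅vir g ν m, hwVec ν β lam l k c⁆ = 0 := hwRel_smul ν β lam l k c _
    (Or.inr (Or.inr (Or.inr (Or.inr (Or.inr (Or.inr ⟨m, hm, rfl⟩))))))
  rw [hom_eq_cur_add_vir, add_lie, smul_lie, h1, h2, smul_zero, add_zero]

/-- Every vector of `L(λ, l, k, c)` is annihilated by `x(m)` and `dₘ` for all large `m`. -/
theorem eventually_hom_lie_eq_zero (w : IrrHW ν β lam l k c) :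
    ∀ᶠ m : ℤ in Filter.atTop, ∀ q : g × ℂ, ⁅hom ν m q, w⁆ = 0 := by
  let A : Submodule ℂ (IrrHW ν β lam l k c) :=
    { carrier := {w | ∀ᶠ m : ℤ in Filter.atTop, ∀ q : g × ℂ, ⁅hom ν m q, w⁆ = 0}
      add_mem' := fun h h' => by
        filter_upwards [h, h'] with m hm hm' q
        rw [lie_add, hm, hm', add_zero]
      zero_mem' := Filter.Eventually.of_forall fun m q => lie_zero (hom ν m q)
      smul_mem' := fun t w h => by
        filter_upwards [h] with m hm q
        rw [lie_smul, hm, smul_zero] }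
  have hA : A = ⊤ := by
    refine irrHW_eq_top ν β lam l k c A ?_ fun Y hY w hw => ?_
    · filter_upwards [Filter.eventually_gt_atTop 0] with m hm q
      exact hom_lie_hwVec ν β lam l k c m hm q
    · have hw' : ∀ᶠ m : ℤ in Filter.atTop, ∀ q, ⁅hom ν m q, w⁆ = 0 := hw
      obtain ⟨m', hm', q', rfl⟩ | ⟨x, hx, rfl⟩ := hY
      · have hs := (Filter.tendsto_atTop_add_const_right Filter.atTop m' Filter.tendsto_id).eventually
          (hw'.and (Filter.eventually_gt_atTop 0))
        filter_upwards [hw', hs] with m h1 h2 q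
        rw [leibniz_lie, h1, lie_zero, add_zero, hom_lie_of_ne (show m + m' ≠ 0 from h2.2.ne')]
        exact h2.1 _
      · filter_upwards [hw'] with m h1 q
        rw [leibniz_lie, h1, lie_zero, add_zero, lie_cur_zero, h1]
  exact (hA ▸ Submodule.mem_top : w ∈ A)

theorem actHw_inclFin (z : UniversalEnvelopingAlgebra ℂ (nMinus β)) :
    actHw ν β lam l k c (inclFin ν (nMinus β) z) =
      (actU (nMinus β) (IrrHW₀ ν β lam l k c) z (hwVec₀ ν β lam l k c) : IrrHW ν β lam l k c) := by
  induction z using induction_mul with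
  | add X Y h h' => simp only [map_add, LinearMap.add_apply, Submodule.coe_add, h, h']
  | smul t X h => simp only [map_smul, LinearMap.smul_apply, Submodule.coe_smul, h]
  | one => rw [map_one, actHw_one, map_one, Module.End.one_apply]; rfl
  | mul x X h =>
    rw [map_mul, inclFin, mapU_ι, actHw_mul, ← inclFin, h, map_mul, Module.End.mul_apply, actU_ι]
    rfl

/-- The top component `L(λ, l, k, c)₀` is generated by `ū` over `U(𝔫₋)`. -/
theorem exists_actU_hwVec₀ (w : IrrHW₀ ν β lam l k c) :
    ∃ z, actU (nMinus β) (IrrHW₀ ν β lam l k c) z (hwVec₀ ν β lam l k c) = w := by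
  let f := LieModule.toEnd ℂ (AffVir g ν) (IrrHW ν β lam l k c) (vir g ν 0)
  let A := LinearMap.range (actHw ν β lam l k c ∘ₗ (inclFin ν (nMinus β)).toLinearMap)
  have hw : (w : IrrHW ν β lam l k c) ∈ A ⊔ ⨆ s ∈ ({l}ᶜ : Set ℂ), f.eigenspace s := by
    refine mem_of_isMonomial ν β lam l k c _ (fun P j hP => ?_) w
    by_cases hj : j = 0
    · obtain ⟨z, rfl⟩ := hP.exists_inclFin hj
      exact Submodule.mem_sup_left ⟨z, rfl⟩
    · refine Submodule.mem_sup_right (Submodule.mem_iSup_of_mem (l + j)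
        (Submodule.mem_iSup_of_mem ?_ (Module.End.mem_eigenspace_iff.mpr (hP.vir_lie_actHw ..))))
      simpa using hj
  obtain ⟨_, ⟨z, rfl⟩, y, hy, hzy⟩ := Submodule.mem_sup.mp hw
  refine ⟨z, Subtype.ext ?_⟩
  have hz : (actHw ν β lam l k c ∘ₗ (inclFin ν (nMinus β)).toLinearMap) z =
      (actU (nMinus β) (IrrHW₀ ν β lam l k c) z (hwVec₀ ν β lam l k c) : IrrHW ν β lam l k c) :=
    actHw_inclFin ν β lam l k c z
  rw [hz] at hzy
  set w' := actU (nMinus β) (IrrHW₀ ν β lam l k c) z (hwVec₀ ν β lam l k c)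
  have h1 : ((w - w' : IrrHW₀ ν β lam l k c) : IrrHW ν β lam l k c) ∈
      (⊥ : Submodule ℂ (IrrHW ν β lam l k c)) := by
    refine mem_of_add_mem_of_mem_iSup_eigenspace f ⊥ (by simp) l {l}ᶜ (by simp) _ (-y)
      (mem_topComp.mp (w - w').2) (neg_mem hy) ?_
    rw [Submodule.coe_sub, ← hzy]
    simp
  rw [Submodule.mem_bot, Submodule.coe_sub, sub_eq_zero] at h1
  exact h1.symm

end Grading

/-! ### Submodules of the tensor product with a loop module -/

section Shifted

variable {g : Type*} [LieRing g] [LieAlgebra ℂ g] {ν : ℂ}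
variable {M : Type*} [AddCommGroup M] [Module ℂ M] [LieRingModule (AffVir g ν) M]
  [LieModule ℂ (AffVir g ν) M]
variable {V : Type*} [AddCommGroup V] [Module ℂ V] [LieRingModule g V] [LieModule ℂ g V]
variable {l a b : ℂ}

/-- Induction on elements of `⊕ₙ M ⊗ V ⊗ t ^ n`. -/
theorem Shifted.induction {P : Shifted M V l a b → Prop} (z : Shifted M V l a b) (zero : P 0)
    (add : ∀ z z', P z → P z' → P (z + z')) (tpow : ∀ n y, P (Shifted.tpow M V l a b n y)) : P z :=
  Finsupp.induction_linear z zero add tpow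

theorem hom_lie_tpow (m n : ℤ) (q : g × ℂ) (y : M ⊗[ℂ] V) :
    ⁅hom ν m q, Shifted.tpow M V l a b n y⁆ =
      Shifted.tpow M V l a b (m + n) (shiftOp ν M V l a b m n q y) :=
  shiftAct_hom M V l a b m n q y

variable (M V l a b) in
/-- The coefficient of `t ^ n`. -/
def Shifted.coeff (n : ℤ) : Shifted M V l a b →ₗ[ℂ] M ⊗[ℂ] V := Finsupp.lapply n

theorem coeff_tpow (n n' : ℤ) (y : M ⊗[ℂ] V) :
    Shifted.coeff M V l a b n (Shifted.tpow M V l a b n' y) = if n' = n then y else 0 :=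
  Finsupp.single_apply

theorem tpow_ne_zero {n : ℤ} {y : M ⊗[ℂ] V} (hy : y ≠ 0) : Shifted.tpow M V l a b n y ≠ 0 :=
  fun h => hy (by rw [← if_pos (c := n = n) rfl (t := y) (e := 0), ← coeff_tpow, h, map_zero])

theorem coeff_hom_lie (m n : ℤ) (q : g × ℂ) (z : Shifted M V l a b) :
    Shifted.coeff M V l a b n ⁅hom ν m q, z⁆ =
      shiftOp ν M V l a b m (n - m) q (Shifted.coeff M V l a b (n - m) z) := by
  induction z using Shifted.induction with
  | zero => rw [lie_zero, map_zero, map_zero, map_zero]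
  | add f f' h h' => rw [lie_add, map_add, h, h', map_add, map_add]
  | tpow n' y =>
    rw [hom_lie_tpow, coeff_tpow, coeff_tpow]
    by_cases h : n' = n - m
    · subst h
      simp
    · rw [if_neg (by omega), if_neg h, map_zero]

theorem vir_zero_lie_tpow (n : ℤ) (y : M ⊗[ℂ] V) :
    ⁅vir g ν 0, Shifted.tpow M V l a b n y⁆ = (l + a + n) • Shifted.tpow M V l a b n y := by
  rw [vir, hom_lie_tpow, zero_add, ← map_smul]
  congr 1
  induction y using TensorProduct.induction_on with
  | zero => simp
  | add y y' h h' => rw [map_add, h, h', smul_add]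
  | tmul w v =>
    rw [shiftOp_tmul]
    simp [vir]

theorem mem_of_forall_tpow_mem (W : Submodule ℂ (Shifted M V l a b))
    (h : ∀ n y, Shifted.tpow M V l a b n y ∈ W) (z : Shifted M V l a b) : z ∈ W := by
  induction z using Shifted.induction with
  | zero => exact zero_mem W
  | add f f' h h' => exact add_mem h h'
  | tpow n y => exact h n y

theorem forall_tpow_mem_of_tmul (W : Submodule ℂ (Shifted M V l a b)) (n : ℤ)
    (h : ∀ w v, Shifted.tpow M V l a b n (w ⊗ₜ v) ∈ W) (y : M ⊗[ℂ] V) :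
    Shifted.tpow M V l a b n y ∈ W := by
  induction y using TensorProduct.induction_on with
  | zero => rw [map_zero]; exact zero_mem W
  | add y y' h h' => rw [map_add]; exact add_mem h h'
  | tmul w v => exact h w v

variable (W : LieSubmodule ℂ (AffVir g ν) (Shifted M V l a b))

/-- A nonzero submodule contains a nonzero vector that is homogeneous with respect to `d₀`. -/
theorem exists_tpow_mem (hW : W ≠ ⊥) :
    ∃ n y, y ≠ 0 ∧ Shifted.tpow M V l a b n y ∈ W := by
  obtain ⟨z, hz, hz0⟩ : ∃ z ∈ W, z ≠ 0 := by
    by_contra! h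
    exact hW ((LieSubmodule.eq_bot_iff W).mpr h)
  obtain ⟨n, hn⟩ : ∃ n, Shifted.coeff M V l a b n z ≠ 0 := by
    by_contra! h
    exact hz0 (Finsupp.ext h)
  let f := LieModule.toEnd ℂ (AffVir g ν) (Shifted M V l a b) (vir g ν 0)
  have hf (k : ℤ) (y : M ⊗[ℂ] V) :
      f (Shifted.tpow M V l a b k y) = (l + a + k) • Shifted.tpow M V l a b k y :=
    vir_zero_lie_tpow k y
  have key (z : Shifted M V l a b) :
      z - Shifted.tpow M V l a b n (Shifted.coeff M V l a b n z) ∈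
        ⨆ s ∈ ({l + a + n}ᶜ : Set ℂ), f.eigenspace s := by
    induction z using Shifted.induction with
    | zero => simp
    | add z z' h h' =>
      rw [map_add, map_add, add_sub_add_comm]
      exact add_mem h h'
    | tpow k y =>
      rw [coeff_tpow]
      by_cases hk : k = n
      · rw [if_pos hk, hk, sub_self]
        exact zero_mem _
      · rw [if_neg hk, map_zero, sub_zero]
        refine Submodule.mem_iSup_of_mem (l + a + k) (Submodule.mem_iSup_of_mem ?_
          (Module.End.mem_eigenspace_iff.mpr (hf k y)))
        simpa using hk
  refine ⟨n, Shifted.coeff M V l a b n z, hn, ?_⟩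
  refine mem_of_add_mem_of_mem_iSup_eigenspace f W.toSubmodule (fun x hx => W.lie_mem hx)
    (l + a + n) _ (by simp) _ _ (hf n _) (key z) ?_
  rwa [add_sub_cancel]

variable {W}

/-- The operators `x(m) + r (dₘ - d₀)` on `M` preserve the vectors `w` with `w ⊗ V ⊗ t ^ N ⊆ W`, up
to a change of `N`. The summand `- r d₀` disappears when `w` is homogeneous. -/
theorem hom_sub_tmul_mem (m N : ℤ) (q : g × ℂ) (w : M)
    (h : ∀ v, Shifted.tpow M V l a b N (w ⊗ₜ v) ∈ W)
    (h' : ∀ v, Shifted.tpow M V l a b (N - m) (w ⊗ₜ v) ∈ W) (v : V) :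
    Shifted.tpow M V l a b N ((⁅hom ν m q, w⁆ - q.2 • ⁅vir g ν 0, w⁆) ⊗ₜ v) ∈ W := by
  have h1 := W.lie_mem (x := hom ν m q) (h' v)
  rw [hom_lie_tpow, shiftOp_tmul, add_sub_cancel, map_add, map_add, map_smul,
    TensorProduct.smul_tmul', ← TensorProduct.sub_tmul] at h1
  have h2 := W.smul_mem (q.2 * (l + a + (N - m : ℤ) + b * m)) (h v)
  exact (add_mem_cancel_right h2).mp ((add_mem_cancel_right (h ⁅q.1, v⁆)).mp h1)

theorem hom_tmul_mem (m N : ℤ) (q : g × ℂ) (w : M) (s : ℂ) (hw : ⁅vir g ν 0, w⁆ = s • w)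
    (h : ∀ v, Shifted.tpow M V l a b N (w ⊗ₜ v) ∈ W)
    (h' : ∀ v, Shifted.tpow M V l a b (N - m) (w ⊗ₜ v) ∈ W) (v : V) :
    Shifted.tpow M V l a b N (⁅hom ν m q, w⁆ ⊗ₜ v) ∈ W := by
  have h1 := hom_sub_tmul_mem m N q w h h' v
  rw [hw, smul_smul, TensorProduct.sub_tmul, ← TensorProduct.smul_tmul', map_sub, map_smul] at h1
  have h2 := add_mem h1 (W.smul_mem (q.2 * s) (h v))
  rwa [sub_add_cancel] at h2

end Shifted

section HighestWeightTensor

variable {g : Type*} [LieRing g] [LieAlgebra ℂ g] [FiniteDimensional ℂ g] [IsSimple ℂ g]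
variable {H : LieSubalgebra ℂ g} [H.IsCartanSubalgebra]
variable {ν : ℂ} {β : (rootSystem H).Base} {lam : Module.Dual ℂ H} {l k c : ℂ}
variable {V : Type*} [AddCommGroup V] [Module ℂ V] [LieRingModule g V] [LieModule ℂ g V]
variable {a b : ℂ}
variable {W : LieSubmodule ℂ (AffVir g ν) (Shifted (IrrHW ν β lam l k c) V l a b)}

theorem eventually_sub {P : ℤ → Prop} (h : ∀ᶠ N : ℤ in atTop, P N) (m : ℤ) :
    ∀ᶠ N : ℤ in atTop, P (N - m) :=
  (tendsto_atTop_add_const_right atTop (-m) tendsto_id).eventually h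

/-- A nonzero submodule contains `ū ⊗ V ⊗ t ^ N` for all large `N`. -/
theorem eventually_tpow_hwVec_mem [FiniteDimensional ℂ V] [LieModule.IsIrreducible ℂ g V]
    (hV : ∃ (x : g) (v : V), ⁅x, v⁆ ≠ 0) (hW : W ≠ ⊥) :
    ∀ᶠ N : ℤ in atTop, ∀ v : V, Shifted.tpow (IrrHW ν β lam l k c) V l a b N
      (hwVec ν β lam l k c ⊗ₜ v) ∈ W := by
  set tpow := Shifted.tpow (IrrHW ν β lam l k c) V l a b with htpow
  let B := Module.finBasis ℂ V
  obtain ⟨n, y, hy, hyW⟩ := exists_tpow_mem W hW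
  obtain ⟨w, rfl⟩ : ∃ w : Fin (Module.finrank ℂ V) → IrrHW ν β lam l k c,
      y = ∑ i, w i ⊗ₜ B i := by
    clear hy hyW
    induction y using TensorProduct.induction_on with
    | zero => exact ⟨0, by simp⟩
    | add y y' h h' =>
      obtain ⟨w, rfl⟩ := h
      obtain ⟨w', rfl⟩ := h'
      exact ⟨w + w', by simp [TensorProduct.add_tmul, Finset.sum_add_distrib]⟩
    | tmul w v =>
      refine ⟨fun i => B.repr v i • w, ?_⟩
      simp only [TensorProduct.smul_tmul]
      rw [← TensorProduct.tmul_sum, B.sum_repr]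
  obtain ⟨i₀, hi₀⟩ : ∃ i, w i ≠ 0 := by
    by_contra! h
    exact hy (by simp [h])
  -- For large `m`, the operator `x(m)` acts on `wᵢ ⊗ v` through `v` alone.
  have hlarge : ∀ᶠ m : ℤ in atTop, ∀ (T : Module.End ℂ V) (N : ℤ) (x : g),
      ⁅cur ν x m, tpow N (∑ i, w i ⊗ₜ T (B i))⁆ =
        tpow (m + N) (∑ i, w i ⊗ₜ (LieModule.toEnd ℂ g V x * T) (B i)) := by
    filter_upwards [eventually_all.mpr fun i => eventually_hom_lie_eq_zero ν β lam l k c (w i)]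
      with m hm T N x
    rw [cur, htpow, hom_lie_tpow, map_sum]
    simp [shiftOp_tmul, hm]
  let G : Submodule ℂ (Module.End ℂ V) :=
    { carrier := {T | ∀ᶠ N : ℤ in atTop, tpow N (∑ i, w i ⊗ₜ T (B i)) ∈ W}
      add_mem' := fun {T T'} h h' => by
        filter_upwards [h, h'] with N hN hN'
        simp only [LinearMap.add_apply, TensorProduct.tmul_add, Finset.sum_add_distrib, map_add]
        exact add_mem hN hN'
      zero_mem' := Eventually.of_forall fun N => by simp
      smul_mem' := fun t T h => by
        filter_upwards [h] with N hN
        simp only [LinearMap.smul_apply, TensorProduct.tmul_smul, ← Finset.smul_sum, map_smul]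
        exact W.smul_mem t hN }
  have hG : G = ⊤ := by
    refine eq_top_of_forall_toEnd_mul_mem V hV G (fun x => ?_) (fun x T hT => ?_)
    · filter_upwards [eventually_sub hlarge n] with N hN
      have h1 := W.lie_mem (x := cur ν x (N - n)) hyW
      have h2 := hN 1 n x
      simp only [Module.End.one_apply, mul_one, sub_add_cancel] at h2
      rwa [← htpow, h2] at h1
    · obtain ⟨m, hm⟩ := hlarge.exists
      filter_upwards [eventually_sub hT m] with N hN
      have h1 := W.lie_mem (x := cur ν x m) hN
      rwa [hm, add_sub_cancel] at h1
  have hw (v : V) : ∀ᶠ N : ℤ in atTop, tpow N (w i₀ ⊗ₜ v) ∈ W := by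
    have hT : (B.coord i₀).smulRight v ∈ G := hG ▸ Submodule.mem_top
    filter_upwards [hT] with N hN
    simpa [Finsupp.single_apply, ite_smul, TensorProduct.tmul_ite] using hN
  let A : Submodule ℂ (IrrHW ν β lam l k c) :=
    { carrier := {w | ∀ᶠ N : ℤ in atTop, ∀ v, tpow N (w ⊗ₜ v) ∈ W}
      add_mem' := fun {w w'} h h' => by
        filter_upwards [h, h'] with N hN hN' v
        rw [TensorProduct.add_tmul, map_add]
        exact add_mem (hN v) (hN' v)
      zero_mem' := Eventually.of_forall fun N v => by simp
      smul_mem' := fun t w h => by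
        filter_upwards [h] with N hN v
        rw [← TensorProduct.smul_tmul', map_smul]
        exact W.smul_mem t (hN v) }
  have hwA : w i₀ ∈ A := by
    filter_upwards [eventually_all.mpr fun i => hw (B i)] with N hN v
    rw [← B.sum_repr v, TensorProduct.tmul_sum, map_sum]
    refine sum_mem fun i _ => ?_
    rw [TensorProduct.tmul_smul, map_smul]
    exact W.smul_mem _ (hN i)
  have hsub (m : ℤ) (q : g × ℂ) (w) (hw : w ∈ A) : ⁅hom ν m q, w⁆ - q.2 • ⁅vir g ν 0, w⁆ ∈ A := by
    filter_upwards [hw, eventually_sub hw m] with N hN hN'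
    exact hom_sub_tmul_mem m N q w hN hN'
  -- Since `dₘ w = 0` for large `m`, the vector `d₀ w` lies in `A` along with `w`.
  have hvir (w) (hw : w ∈ A) : ⁅vir g ν 0, w⁆ ∈ A := by
    obtain ⟨m, hm⟩ := (eventually_hom_lie_eq_zero ν β lam l k c w).exists
    have h1 := hsub m (0, 1) w hw
    rw [hm, one_smul, zero_sub] at h1
    simpa using neg_mem h1
  have hA (Z : AffVir g ν) (w) (hw : w ∈ A) : ⁅Z, w⁆ ∈ A := by
    induction Z using induction with
    | add X Y h h' => rw [add_lie]; exact add_mem h h'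
    | hom m q =>
      have h1 := add_mem (hsub m q w hw) (A.smul_mem q.2 (hvir w hw))
      rwa [sub_add_cancel] at h1
    | cen z =>
      rw [cen_eq, add_lie, smul_lie, smul_lie, kk_lie_irr, cc_lie_irr]
      exact add_mem (A.smul_mem _ (A.smul_mem _ hw)) (A.smul_mem _ (A.smul_mem _ hw))
  have hA' : A = ⊤ := (irrHW_eq_bot_or_eq_top ν β lam l k c A hA).resolve_left fun h =>
    hi₀ ((Submodule.mem_bot ℂ).mp (h ▸ hwA))
  exact (hA' ▸ Submodule.mem_top : hwVec ν β lam l k c ∈ A)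

end HighestWeightTensor

/-! ### The maps `φₙ` and submodules of the tensor product -/

section Criterion

variable {g : Type*} [LieRing g] [LieAlgebra ℂ g] [FiniteDimensional ℂ g] [IsSimple ℂ g]
variable {H : LieSubalgebra ℂ g} [H.IsCartanSubalgebra]
variable (ν : ℂ) (β : (rootSystem H).Base) (lam : Module.Dual ℂ H) (l k c : ℂ)
variable (V : Type*) [AddCommGroup V] [Module ℂ V] [LieRingModule g V] [LieModule ℂ g V]
variable (a b : ℂ)

/-- The inclusion `L(λ, l, k, c)₀ ⊗ V → L(λ, l, k, c) ⊗ V`. -/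
def topIncl : IrrHW₀ ν β lam l k c ⊗[ℂ] V →ₗ[ℂ] IrrHW ν β lam l k c ⊗[ℂ] V :=
  (topComp g ν (IrrHW ν β lam l k c) l).subtype.rTensor V

theorem cur_zero_lie_tpow_topIncl (n : ℤ) (x : g) (t : IrrHW₀ ν β lam l k c ⊗[ℂ] V) :
    ⁅cur ν x 0, Shifted.tpow (IrrHW ν β lam l k c) V l a b n (topIncl ν β lam l k c V t)⁆ =
      Shifted.tpow (IrrHW ν β lam l k c) V l a b n (topIncl ν β lam l k c V ⁅x, t⁆) := by
  induction t using TensorProduct.induction_on with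
  | zero => simp
  | add t t' h h' => rw [map_add, map_add, lie_add, h, h', lie_add, map_add, map_add]
  | tmul w v =>
    rw [TensorProduct.LieModule.lie_tmul_right, map_add, topIncl, LinearMap.rTensor_tmul,
      LinearMap.rTensor_tmul, LinearMap.rTensor_tmul, cur_lie_at, zero_add]
    rfl

theorem phi_inclFin (n : ℤ) (z : UniversalEnvelopingAlgebra ℂ (nMinus β)) (v : V) :
    phi ν β lam l k c V a b n (inclFin ν (nMinus β) z ⊗ₜ v) =
      actU (nMinus β) (IrrHW₀ ν β lam l k c) z (hwVec₀ ν β lam l k c) ⊗ₜ v := by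
  have h := phi_mul ν β lam l k c V a b n 1 1 z v
  rwa [map_one, map_one, one_mul, one_mul, psi_one, one_smul, map_one, circ_one] at h

variable {ν β V}

theorem IsMonomial.phi_neg {P : UniversalEnvelopingAlgebra ℂ (affMinus ν (nMinus β))} {j : ℤ}
    (h : IsMonomial P j) (n m : ℤ) (hm : m < 0) (q : g × ℂ) (v : V) :
    phi ν β lam l k c V a b n
        ((UniversalEnvelopingAlgebra.ι ℂ (negHom ν (nMinus β) m hm q) * P) ⊗ₜ v) =
      (q.2 * psiFactor a b n m j) • phi ν β lam l k c V a b n (P ⊗ₜ v) -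
        phi ν β lam l k c V a b n (P ⊗ₜ ⁅q.1, v⁆) :=
  h.phiOf_neg a b n _ m hm q v

theorem IsMonomial.phi_fin {P : UniversalEnvelopingAlgebra ℂ (affMinus ν (nMinus β))} {j : ℤ}
    (h : IsMonomial P j) (n : ℤ) (x : nMinus β) (v : V) :
    phi ν β lam l k c V a b n
        ((UniversalEnvelopingAlgebra.ι ℂ (finHom ν (nMinus β) x) * P) ⊗ₜ v) =
      ⁅(x : g), phi ν β lam l k c V a b n (P ⊗ₜ v)⁆ -
        phi ν β lam l k c V a b n (P ⊗ₜ ⁅(x : g), v⁆) :=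
  h.phiOf_fin a b n _ x v

/-- For `Y = x(m) + r dₘ` with `m < 0` and a monomial `P`, the vector `Y (P ū ⊗ v ⊗ t ^ (n - m))` is
the image under `P ⊗ v ↦ P ū ⊗ v` of an element of the kernel of `φₙ`, times `t ^ n`: compare
`IsMonomial.phi_neg`. -/
theorem IsMonomial.shiftOp_actHw
    {P : UniversalEnvelopingAlgebra ℂ (affMinus ν (nMinus β))} {j : ℤ}
    (h : IsMonomial P j) (n m : ℤ) (hm : m < 0) (q : g × ℂ) (v : V) :
    shiftOp ν (IrrHW ν β lam l k c) V l a b m (n - m) q (actHw ν β lam l k c P ⊗ₜ v) =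
      (actHw ν β lam l k c).rTensor V
        ((UniversalEnvelopingAlgebra.ι ℂ (negHom ν (nMinus β) m hm q) * P) ⊗ₜ v -
          (q.2 * psiFactor a b n m j) • P ⊗ₜ v + P ⊗ₜ ⁅q.1, v⁆) := by
  rw [shiftOp_tmul, h.vir_lie_actHw, map_add, map_sub, map_smul, LinearMap.rTensor_tmul,
    LinearMap.rTensor_tmul, LinearMap.rTensor_tmul, actHw_mul, ← TensorProduct.smul_tmul',
    psiFactor]
  change ⁅hom ν m q, _⁆ ⊗ₜ v - _ + _ + _ = ⁅hom ν m q, _⁆ ⊗ₜ v - _ + _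
  push_cast
  module

variable {W : LieSubmodule ℂ (AffVir g ν) (Shifted (IrrHW ν β lam l k c) V l a b)}
variable {lam l k c a b}

/-- A submodule that contains `ū ⊗ V ⊗ t ^ N` for all `N ≥ n` contains
`L(λ, l, k, c) ⊗ V ⊗ t ^ N` for all `N ≥ n`: for `m < 0`, the vector `x(m) w ⊗ v ⊗ t ^ N` is obtained
from vectors with the exponents `N` and `N - m > N`. -/
theorem tpow_mem_of_hwVec (n : ℤ)
    (h : ∀ N, n ≤ N → ∀ v : V, Shifted.tpow (IrrHW ν β lam l k c) V l a b N
      (hwVec ν β lam l k c ⊗ₜ v) ∈ W) (N : ℤ) (hN : n ≤ N) (y) :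
    Shifted.tpow (IrrHW ν β lam l k c) V l a b N y ∈ W := by
  let A : Submodule ℂ (IrrHW ν β lam l k c) :=
    { carrier := {w | ∀ N, n ≤ N → ∀ v,
        Shifted.tpow (IrrHW ν β lam l k c) V l a b N (w ⊗ₜ v) ∈ W}
      add_mem' := fun h h' N hN v => by
        rw [TensorProduct.add_tmul, map_add]
        exact add_mem (h N hN v) (h' N hN v)
      zero_mem' := fun N _ v => by simp
      smul_mem' := fun t w h N hN v => by
        rw [← TensorProduct.smul_tmul', map_smul]
        exact W.smul_mem t (h N hN v) }
  have hA (w) : w ∈ A := by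
    refine mem_of_isMonomial ν β lam l k c A (fun P j hP => ?_) w
    induction hP with
    | one => rw [actHw_one]; exact h
    | @neg P j m hm q hP ih =>
      intro N hN v
      rw [actHw_mul]
      exact hom_tmul_mem m N q _ _ (hP.vir_lie_actHw ..) (ih N hN) (ih (N - m) (by omega)) v
    | @fin P j x hP ih =>
      intro N hN v
      rw [actHw_mul]
      exact hom_tmul_mem 0 N ((x : g), 0) _ _ (hP.vir_lie_actHw ..) (ih N hN)
        (ih (N - 0) (by omega)) v
  exact forall_tpow_mem_of_tmul W.toSubmodule N (fun w v => hA w N hN v) y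

/-- If `W` contains all `w ⊗ v ⊗ t ^ N` with `N > n`, then `P ū ⊗ v ⊗ t ^ n` is congruent to
`φₙ(P ⊗ v) ⊗ t ^ n` modulo `W`. -/
theorem tpow_rTensor_actHw_sub_mem (n : ℤ)
    (h : ∀ N, n < N → ∀ y, Shifted.tpow (IrrHW ν β lam l k c) V l a b N y ∈ W)
    (t : UniversalEnvelopingAlgebra ℂ (affMinus ν (nMinus β)) ⊗[ℂ] V) :
    Shifted.tpow (IrrHW ν β lam l k c) V l a b n ((actHw ν β lam l k c).rTensor V t -
      topIncl ν β lam l k c V (phi ν β lam l k c V a b n t)) ∈ W := by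
  let F := Shifted.tpow (IrrHW ν β lam l k c) V l a b n ∘ₗ ((actHw ν β lam l k c).rTensor V -
    topIncl ν β lam l k c V ∘ₗ phi ν β lam l k c V a b n)
  have key {P : UniversalEnvelopingAlgebra ℂ (affMinus ν (nMinus β))} {j : ℤ}
      (hP : IsMonomial P j) (v : V) : F (P ⊗ₜ v) ∈ W := by
    induction hP generalizing v with
    | one =>
      have h1 := phi_inclFin ν β lam l k c V a b n 1 v
      rw [map_one, map_one, Module.End.one_apply] at h1
      have h2 : F (1 ⊗ₜ v) = 0 := by
        change Shifted.tpow _ V l a b n (_ - topIncl ν β lam l k c V _) = 0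
        rw [h1, topIncl, LinearMap.rTensor_tmul, LinearMap.rTensor_tmul, actHw_one]
        exact (congrArg _ (sub_self _)).trans (map_zero _)
      rw [h2]
      exact zero_mem W
    | @neg P j m hm q hP ih =>
      have h1 := W.lie_mem (x := hom ν m q)
        (h (n - m) (by omega) (actHw ν β lam l k c P ⊗ₜ v))
      rw [hom_lie_tpow, add_sub_cancel, hP.shiftOp_actHw lam l k c a b n m hm q v] at h1
      have h2 : phi ν β lam l k c V a b n
          ((UniversalEnvelopingAlgebra.ι ℂ (negHom ν (nMinus β) m hm q) * P) ⊗ₜ v -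
            (q.2 * psiFactor a b n m j) • P ⊗ₜ v + P ⊗ₜ ⁅q.1, v⁆) = 0 := by
        rw [map_add, map_sub, map_smul, hP.phi_neg]
        abel
      have h3 : F ((UniversalEnvelopingAlgebra.ι ℂ (negHom ν (nMinus β) m hm q) * P) ⊗ₜ v -
            (q.2 * psiFactor a b n m j) • P ⊗ₜ v + P ⊗ₜ ⁅q.1, v⁆) ∈ W := by
        change Shifted.tpow _ V l a b n (_ - topIncl ν β lam l k c V _) ∈ W
        rw [h2, map_zero, sub_zero]
        exact h1
      rw [map_add, map_sub, map_smul] at h3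
      have h4 := sub_mem (add_mem h3 (W.smul_mem (q.2 * psiFactor a b n m j) (ih v))) (ih ⁅q.1, v⁆)
      convert h4 using 1
      abel
    | @fin P j x hP ih =>
      have h1 := sub_mem (W.lie_mem (x := cur ν (x : g) 0) (ih v)) (ih ⁅(x : g), v⁆)
      convert h1 using 1
      change Shifted.tpow _ V l a b n (_ - topIncl ν β lam l k c V _) =
        ⁅cur ν (x : g) 0, Shifted.tpow _ V l a b n (_ - topIncl ν β lam l k c V _)⁆ -
          Shifted.tpow _ V l a b n (_ - topIncl ν β lam l k c V _)
      rw [map_sub, map_sub, map_sub, lie_sub, cur_zero_lie_tpow_topIncl, hP.phi_fin,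
        LinearMap.rTensor_tmul, LinearMap.rTensor_tmul, LinearMap.rTensor_tmul, cur_lie_at,
        actHw_mul, zero_add, map_sub, map_sub, map_add]
      change Shifted.tpow _ V l a b n (⁅cur ν (x : g) 0, _⁆ ⊗ₜ v) - _ = _
      abel
  change F t ∈ W
  induction t using TensorProduct.induction_on with
  | zero => rw [map_zero]; exact zero_mem W
  | add t t' h h' => rw [map_add]; exact add_mem h h'
  | tmul P v =>
    have hP : P ∈ Submodule.span ℂ {P : UniversalEnvelopingAlgebra ℂ (affMinus ν (nMinus β)) |
        ∃ j, IsMonomial P j} := by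
      rw [span_isMonomial]
      trivial
    refine (Submodule.span_le.mpr ?_ :
      _ ≤ W.toSubmodule.comap (F ∘ₗ (TensorProduct.mk ℂ _ V).flip v)) hP
    rintro P ⟨j, hP⟩
    exact key hP v

instance : Nontrivial (IrrHW ν β lam l k c) := ⟨_, _, hwVec_ne_zero ν β lam l k c⟩

/-- If every `φₙ` maps `Ann(ū) ⊗ V` onto `L(λ, l, k, c)₀ ⊗ V`, then the tensor product with the
loop module is irreducible. -/
theorem isIrreducible_of_map_phi_eq_top [FiniteDimensional ℂ V] [LieModule.IsIrreducible ℂ g V]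
    (hV : ∃ (x : g) (v : V), ⁅x, v⁆ ≠ 0)
    (h : ∀ n : ℤ, Submodule.map (phi ν β lam l k c V a b n)
      (LinearMap.range ((Ann ν β lam l k c).subtype.rTensor V)) = ⊤) :
    LieModule.IsIrreducible ℂ (AffVir g ν) (Shifted (IrrHW ν β lam l k c) V l a b) := by
  have : Nontrivial V := by
    obtain ⟨x, v, hxv⟩ := hV
    exact ⟨_, _, hxv⟩
  obtain ⟨y, hy⟩ := exists_ne (0 : IrrHW ν β lam l k c ⊗[ℂ] V)
  have : Nontrivial (Shifted (IrrHW ν β lam l k c) V l a b) :=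
    ⟨_, _, tpow_ne_zero (n := 0) hy⟩
  refine LieModule.IsIrreducible.mk fun W hW => ?_
  obtain ⟨n₀, hn₀⟩ := eventually_atTop.mp (eventually_tpow_hwVec_mem hV hW)
  have hn₀' := tpow_mem_of_hwVec n₀ hn₀
  -- Descending induction on the exponent, one step at a time through `φₙ`.
  have step (n : ℤ) (hn : ∀ N, n < N → ∀ y, Shifted.tpow (IrrHW ν β lam l k c) V l a b N y ∈ W) :
      ∀ N, n ≤ N → ∀ y, Shifted.tpow (IrrHW ν β lam l k c) V l a b N y ∈ W := by
    refine tpow_mem_of_hwVec n fun N hN v => ?_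
    obtain rfl | hN := hN.eq_or_lt
    · have hv : hwVec₀ ν β lam l k c ⊗ₜ v ∈ Submodule.map (phi ν β lam l k c V a b n)
          (LinearMap.range ((Ann ν β lam l k c).subtype.rTensor V)) := h n ▸ Submodule.mem_top
      obtain ⟨_, ⟨t, rfl⟩, ht⟩ := hv
      have h1 := tpow_rTensor_actHw_sub_mem n hn ((Ann ν β lam l k c).subtype.rTensor V t)
      have h2 : (actHw ν β lam l k c).rTensor V ((Ann ν β lam l k c).subtype.rTensor V t) = 0 := by
        rw [← LinearMap.comp_apply, ← LinearMap.rTensor_comp]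
        have h3 : actHw ν β lam l k c ∘ₗ (Ann ν β lam l k c).subtype = 0 :=
          LinearMap.comp_ker_subtype _
        rw [h3, LinearMap.rTensor_zero, LinearMap.zero_apply]
      rw [h2, ht, zero_sub, map_neg, topIncl, LinearMap.rTensor_tmul] at h1
      exact neg_mem_iff.mp h1
    · exact hn N hN _
  have all (n : ℤ) : ∀ N, n ≤ N → ∀ y, Shifted.tpow (IrrHW ν β lam l k c) V l a b N y ∈ W := by
    obtain hn | hn := le_total n₀ n
    · exact fun N hN => hn₀' N (hn.trans hN)
    · induction n, hn using Int.leInductionDown with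
      | base => exact hn₀'
      | pred n hn ih => exact step (n - 1) fun N hN => ih N (by omega)
  rw [← LieSubmodule.toSubmodule_eq_top, Submodule.eq_top_iff']
  exact mem_of_forall_tpow_mem W.toSubmodule fun n => all n n le_rfl

theorem exists_cen_lie_tpow (z : ℂ × ℂ) (n : ℤ) (y : IrrHW ν β lam l k c ⊗[ℂ] V) :
    ∃ y', ⁅(cen ν z : AffVir g ν), Shifted.tpow (IrrHW ν β lam l k c) V l a b n y⁆ =
      Shifted.tpow (IrrHW ν β lam l k c) V l a b n y' := by
  induction y using TensorProduct.induction_on with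
  | zero => exact ⟨0, by simp⟩
  | add y y' h h' =>
    obtain ⟨u, hu⟩ := h
    obtain ⟨u', hu'⟩ := h'
    exact ⟨u + u', by rw [map_add, lie_add, hu, hu', map_add]⟩
  | tmul w v => exact ⟨_, cen_lie_at _ V l a b z n w v⟩

/-- If the tensor product with the loop module is irreducible, then `P ⊗ v ↦ P ū ⊗ v` maps the
kernel of `φₙ` onto `L(λ, l, k, c) ⊗ V`. Indeed, the components with exponents larger than `n`
generate everything, and they do so under the operators `x(m)` and `dₘ` with `m < 0`; the
coefficients of `t ^ n` that these operators produce lie in the image of the kernel of `φₙ`. -/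
theorem map_ker_phi_eq_top
    [LieModule.IsIrreducible ℂ (AffVir g ν) (Shifted (IrrHW ν β lam l k c) V l a b)]
    [Nontrivial V] (n : ℤ) :
    (LinearMap.ker (phi ν β lam l k c V a b n)).map ((actHw ν β lam l k c).rTensor V) = ⊤ := by
  set Z := (LinearMap.ker (phi ν β lam l k c V a b n)).map ((actHw ν β lam l k c).rTensor V)
    with hZ
  have hop (m : ℤ) (hm : m < 0) (q : g × ℂ) (y) :
      shiftOp ν (IrrHW ν β lam l k c) V l a b m (n - m) q y ∈ Z := by
    induction y using TensorProduct.induction_on with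
    | zero => rw [map_zero]; exact zero_mem Z
    | add y y' h h' => rw [map_add]; exact add_mem h h'
    | tmul w v =>
      refine mem_of_isMonomial ν β lam l k c
        (Z.comap (shiftOp ν (IrrHW ν β lam l k c) V l a b m (n - m) q ∘ₗ
          (TensorProduct.mk ℂ _ V).flip v)) (fun P j hP => ?_) w
      change shiftOp ν (IrrHW ν β lam l k c) V l a b m (n - m) q (actHw ν β lam l k c P ⊗ₜ v) ∈ Z
      rw [hP.shiftOp_actHw lam l k c a b n m hm q v]
      refine Submodule.mem_map_of_mem ?_
      rw [LinearMap.mem_ker, map_add, map_sub, map_smul, hP.phi_neg]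
      abel
  let S : Set (Shifted (IrrHW ν β lam l k c) V l a b) :=
    {z | ∃ N, n < N ∧ ∃ y, z = Shifted.tpow (IrrHW ν β lam l k c) V l a b N y}
  obtain ⟨A₀, hSA₀, hA₀, hA₀K⟩ := exists_invariant_le
    (LieModule.toEnd ℂ (AffVir g ν) (Shifted (IrrHW ν β lam l k c) V l a b))
    {Y | ∃ m < 0, ∃ q, Y = hom ν m q} S
    (by
      rintro A hSA hA _ ⟨N, hN, y, rfl⟩ X
      induction X using induction with
      | add X Y h h' => rw [map_add]; exact add_mem h h'
      | hom m q =>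
        obtain hm | hm := lt_or_ge m 0
        · exact hA _ ⟨m, hm, q, rfl⟩ _ (hSA ⟨N, hN, y, rfl⟩)
        · exact hSA ⟨m + N, by omega, _, hom_lie_tpow m N q y⟩
      | cen z =>
        obtain ⟨y', hy'⟩ := exists_cen_lie_tpow z N y
        exact hSA ⟨N, hN, y', hy'⟩)
    (Z.comap (Shifted.coeff (IrrHW ν β lam l k c) V l a b n))
    (by
      rintro _ ⟨N, hN, y, rfl⟩
      change Shifted.coeff (IrrHW ν β lam l k c) V l a b n _ ∈ Z
      rw [coeff_tpow, if_neg hN.ne']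
      exact zero_mem Z)
    (by
      rintro _ ⟨m, hm, q, rfl⟩ z -
      change Shifted.coeff (IrrHW ν β lam l k c) V l a b n ⁅hom ν m q, z⁆ ∈ Z
      rw [coeff_hom_lie]
      exact hop m hm q _)
  let A : LieSubmodule ℂ (AffVir g ν) (Shifted (IrrHW ν β lam l k c) V l a b) :=
    { A₀ with lie_mem := fun {X w} hw => hA₀ X w hw }
  have hA : A ≠ ⊥ := by
    intro h
    obtain ⟨y, hy⟩ := exists_ne (0 : IrrHW ν β lam l k c ⊗[ℂ] V)
    exact tpow_ne_zero hy ((LieSubmodule.eq_bot_iff A).mp h _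
      (hSA₀ ⟨n + 1, by omega, y, rfl⟩))
  have := (LieSubmodule.nontrivial_iff_ne_bot ℂ (AffVir g ν) _).mpr hA
  have hA' := LieSubmodule.eq_top_of_isIrreducible ℂ (AffVir g ν) _ A
  refine Submodule.eq_top_iff'.mpr fun y => ?_
  have hy : Shifted.tpow (IrrHW ν β lam l k c) V l a b n y ∈ A₀ := by
    change _ ∈ A
    rw [hA']
    exact LieSubmodule.mem_top _
  have h1 : Shifted.coeff (IrrHW ν β lam l k c) V l a b n (Shifted.tpow _ V l a b n y) ∈ Z :=
    hA₀K hy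
  rwa [coeff_tpow, if_pos rfl] at h1

/-- If the tensor product with the loop module is irreducible, then every `φₙ` maps `Ann(ū) ⊗ V`
onto `L(λ, l, k, c)₀ ⊗ V`. -/
theorem map_phi_eq_top
    [LieModule.IsIrreducible ℂ (AffVir g ν) (Shifted (IrrHW ν β lam l k c) V l a b)]
    [Nontrivial V] (n : ℤ) :
    Submodule.map (phi ν β lam l k c V a b n)
      (LinearMap.range ((Ann ν β lam l k c).subtype.rTensor V)) = ⊤ := by
  refine Submodule.eq_top_iff'.mpr fun y => ?_
  induction y using TensorProduct.induction_on with
  | zero => exact zero_mem _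
  | add y y' h h' => exact add_mem h h'
  | tmul w v =>
    obtain ⟨z, rfl⟩ := exists_actU_hwVec₀ ν β lam l k c w
    have h1 : (actHw ν β lam l k c).rTensor V (inclFin ν (nMinus β) z ⊗ₜ v) ∈
        (LinearMap.ker (phi ν β lam l k c V a b n)).map ((actHw ν β lam l k c).rTensor V) :=
      by
      rw [map_ker_phi_eq_top]
      trivial
    obtain ⟨t, ht, ht'⟩ := h1
    have hex := rTensor_exact V (LinearMap.exact_subtype_ker_map (actHw ν β lam l k c))
      (actHw_surjective ν β lam l k c)
    refine ⟨inclFin ν (nMinus β) z ⊗ₜ v - t, (hex _).mp ?_, ?_⟩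
    · rw [map_sub, ht', sub_self]
    · rw [map_sub, LinearMap.mem_ker.mp ht, sub_zero, phi_inclFin]

end Criterion

end AffineVirasoro

end

theorem theorem4p3 {g : Type*} [LieRing g] [LieAlgebra ℂ g] [FiniteDimensional ℂ g]
    [LieAlgebra.IsSimple ℂ g] (H : LieSubalgebra ℂ g) [H.IsCartanSubalgebra]
    (β : (LieAlgebra.IsKilling.rootSystem H).Base)
    (θ : H.root) (hθ : AffineVirasoro.IsHighestRoot β θ)
    (lam mu : Module.Dual ℂ H) (hmu : mu ≠ 0)
    (l k c a b : ℂ) (ha : 0 ≤ a.re) (ha' : a.re < 1)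
    (V : Type*) [AddCommGroup V] [Module ℂ V] [LieRingModule g V] [LieModule ℂ g V]
    (hV : AffineVirasoro.IsFinIrrHW β V mu) :
    LieModule.IsIrreducible ℂ (AffineVirasoro.AffVir g (AffineVirasoro.formScale θ))
        (AffineVirasoro.Shifted
          (AffineVirasoro.IrrHW (AffineVirasoro.formScale θ) β lam l k c) V l a b) ↔
      ∀ n : ℤ,
        Submodule.map
          (AffineVirasoro.phi (AffineVirasoro.formScale θ) β lam l k c V a b n)
          (LinearMap.range
            ((AffineVirasoro.Ann (AffineVirasoro.formScale θ) β lam l k c).subtype.rTensor V)) =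
        ⊤ := by
  obtain ⟨_, _, v, hv, hv', -⟩ := hV
  have : Nontrivial V := ⟨v, 0, hv⟩
  obtain ⟨h, hh⟩ : ∃ h, mu h ≠ 0 := by
    by_contra! h
    exact hmu (LinearMap.ext h)
  refine ⟨fun _ n => AffineVirasoro.map_phi_eq_top n, fun hphi =>
    AffineVirasoro.isIrreducible_of_map_phi_eq_top ⟨h, v, ?_⟩ hphi⟩
  rw [hv' h]
  exact smul_ne_zero hh hv
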